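/- Let $\Pi=\{x\in\mathbb R^3 : |x_h|>1\}$, $x_h=(x_1,x_2)$, let $(r,\theta,z)$ be the cylindrical coordinates with unit vectors $e_r,e_\theta,e_z$, and let $n=-e_r$ be the outward unit normal on $\partial\Pi$. All norms $\|\cdot\|_p$ are those of $L^p(\Pi)$, and $|\nabla w|^2=\sum_{i,j}|\partial_i w_j|^2$ for vector fields. Let $L^2_\sigma(\Pi)$ be the $L^2$-closure of the smooth solenoidal vector fields with compact support in $\Pi$, let $D(u)=\frac12(\nabla u+\nabla^{T}u)$, let $f_{\mathrm{tan}}=f-n(f\cdot n)$, and let $$D(A)=\{u\in L^2_\sigma(\Pi)\cap H^2(\Pi)^3 : (D(u)n)_{\mathrm{tan}}=0,\ u\cdot n=0 \text{ on } \partial\Pi\}$$ be the domain of the Stokes operator with the slip boundary condition. A vector field $u$ is called axisymmetric if $u(x)={}^{t}Ru(Rx)$ for a.e. $x\in\Pi$, for every rotation $R$ about the $z$-axis. There is a constant $C$ such that the following holds for every axisymmetric $u=u^re_r+u^\theta e_\theta+u^ze_z\in D(A)$. Let $v=u^re_r+u^ze_z$ and $\omega^\theta=e_\theta\cdot\operatorname{curl}u=\partial_zu^r-\partial_ru^z$.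 Then $v\in H^1(\Pi)^3$, $\omega^\theta\in H^1_0(\Pi)$, $\omega^\theta e_\theta\in H^1(\Pi)^3$, and $$\|\nabla v\|_2=\|\omega^\theta\|_2,$$ $$\|u^r\|_4\le C\|u^r\|_2^{1/4}\|\omega^\theta\|_2^{3/4},$$ $$\|u^z\|_4\le C\|u^z\|_2^{1/4}(\|u^z\|_2+\|\omega^\theta\|_2)^{3/4},$$ $$\|\omega^\theta\|_4\le C\|\omega^\theta\|_2^{1/4}\|\nabla\omega^\theta\|_2^{3/4},$$ $$\|\nabla(\omega^\theta e_\theta)\|_2=\Big(\|\nabla\omega^\theta\|_2^2+\Big\|\frac{\omega^\theta}{r}\Big\|_2^2\Big)^{1/2},$$ $$\|v\|_4\le C\|v\|_2^{1/4}(\|v\|_2+\|\omega^\theta\|_2)^{3/4}.$$ -/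

import Mathlib

open MeasureTheory Filter Topology
open scoped ENNReal NNReal ContDiff Matrix

noncomputable section

namespace CylinderFlow

/-- Euclidean three-space; the coordinates `x₁, x₂, x₃ = z` are `x 0, x 1, x 2`. -/
abbrev E3 : Type := EuclideanSpace ℝ (Fin 3)

/-! ### Cylindrical coordinates and the domain -/

/-- The distance `r = |x_h|` to the `z`-axis. -/
def rad (x : E3) : ℝ := Real.sqrt (x 0 ^ 2 + x 1 ^ 2)

/-- The exterior of the unit cylinder, `Π = {|x_h| > 1}`. -/
def Cyl : Set E3 := {x | 1 < rad x}

/-- `e_r(θ) = (cos θ, sin θ, 0)` at the point `x`. -/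
def er (x : E3) : E3 := !₂[x 0 / rad x, x 1 / rad x, 0]

/-- `e_θ(θ) = (-sin θ, cos θ, 0)` at the point `x`. -/
def eθ (x : E3) : E3 := !₂[-(x 1) / rad x, x 0 / rad x, 0]

/-- `e_z = (0, 0, 1)`. -/
def ez : E3 := !₂[0, 0, 1]

/-- The matrix `R = (e_r(η), e_θ(η), e_z)` with these vectors as columns. -/
def rot (η : ℝ) : Matrix (Fin 3) (Fin 3) ℝ :=
  !![Real.cos η, -Real.sin η, 0; Real.sin η, Real.cos η, 0; 0, 0, 1]

/-- Lebesgue measure on `Π`. -/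
def μC : Measure E3 := volume.restrict Cyl

/-- The norm of `L^p(Π)`, with values in `[0, ∞]`; vectors carry the Euclidean norm. -/
def nrm {F : Type*} [NormedAddCommGroup F] (p : ℝ≥0∞) (f : E3 → F) : ℝ≥0∞ := eLpNorm f p μC

/-- An axisymmetric vector field on `Π`: `u(x) = ᵗR u(R x)` for every rotation `R` about the
`z`-axis, as an identity between elements of a Lebesgue space, i.e. for almost every `x`. -/
def IsAxisymmetric (u : E3 → E3) : Prop :=
  ∀ η : ℝ, ∀ᵐ x ∂μC,
    u x = Matrix.toEuclideanLin (rot η)ᵀ (u (Matrix.toEuclideanLin (rot η) x))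

/-! ### Weak derivatives and Sobolev spaces on `Π` -/

/-- The classical partial derivative `∂_i φ`. -/
def pd (i : Fin 3) (φ : E3 → ℝ) (x : E3) : ℝ := fderiv ℝ φ x (EuclideanSpace.single i 1)

/-- Smooth functions with compact support contained in `Π`. -/
def IsTest {F : Type*} [NormedAddCommGroup F] [NormedSpace ℝ F] (φ : E3 → F) : Prop :=
  ContDiff ℝ ∞ φ ∧ HasCompactSupport φ ∧ tsupport φ ⊆ Cyl

/-- `g` is a weak partial derivative `∂_i f` in `Π`. -/
def HasWeakPartial (i : Fin 3) (f g : E3 → ℝ) : Prop :=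
  LocallyIntegrableOn f Cyl ∧ LocallyIntegrableOn g Cyl ∧
    ∀ φ : E3 → ℝ, IsTest φ → ∫ x, f x * pd i φ x ∂μC = -∫ x, g x * φ x ∂μC

open Classical in
/-- The weak partial derivative `∂_i f` in `Π` (unique up to null sets when it exists; the value
is `0` when there is none). -/
def wpd (i : Fin 3) (f : E3 → ℝ) : E3 → ℝ :=
  if h : ∃ g, HasWeakPartial i f g then h.choose else 0

/-- `f ∈ H¹(Π)`. -/
def MemH1 (f : E3 → ℝ) : Prop :=
  MemLp f 2 μC ∧ ∀ i, ∃ g, HasWeakPartial i f g ∧ MemLp g 2 μC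

/-- `f ∈ H²(Π)`. -/
def MemH2 (f : E3 → ℝ) : Prop :=
  MemLp f 2 μC ∧ ∀ i, ∃ g, HasWeakPartial i f g ∧ MemH1 g

/-- `f ∈ H¹₀(Π)`: the closure of the test functions in `H¹(Π)`, i.e. the functions in `H¹(Π)`
whose trace vanishes on `∂Π`. -/
def MemH10 (f : E3 → ℝ) : Prop :=
  MemH1 f ∧ ∃ φ : ℕ → E3 → ℝ, (∀ n, IsTest (φ n)) ∧
    Tendsto (fun n => nrm 2 (fun x => f x - φ n x)) atTop (𝓝 0) ∧
    ∀ i, Tendsto (fun n => nrm 2 (fun x => wpd i f x - pd i (φ n) x)) atTop (𝓝 0)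

/-- The weak gradient of a function. -/
def grad (f : E3 → ℝ) (x : E3) : E3 := WithLp.toLp 2 fun i => wpd i f x

/-- The weak gradient `(∂_i w_j)` of a vector field; its norm is
`|∇w| = (∑_{i,j} |∂_i w_j|²)^{1/2}`. -/
def vgrad (w : E3 → E3) (x : E3) : EuclideanSpace ℝ (Fin 3 × Fin 3) :=
  WithLp.toLp 2 fun q => wpd q.1 (fun y => w y q.2) x

/-- The weak curl of a vector field. -/
def curl (w : E3 → E3) (x : E3) : E3 :=
  !₂[wpd 1 (fun y => w y 2) x - wpd 2 (fun y => w y 1) x,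
     wpd 2 (fun y => w y 0) x - wpd 0 (fun y => w y 2) x,
     wpd 0 (fun y => w y 1) x - wpd 1 (fun y => w y 0) x]

/-! ### The domain of the Stokes operator with the slip boundary condition -/

/-- `u ∈ L²_σ(Π)`: the `L²`-closure of the smooth solenoidal vector fields with compact support
in `Π`. -/
def MemL2Sigma (u : E3 → E3) : Prop :=
  MemLp u 2 μC ∧ ∃ w : ℕ → E3 → E3,
    (∀ n, IsTest (w n) ∧ ∀ x, ∑ i, pd i (fun y => w n y i) x = 0) ∧
    Tendsto (fun n => nrm 2 (fun x => u x - w n x)) atTop (𝓝 0)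

/-- The unit outward normal `n = -e_r` of `∂Π`, extended to `Π` by the same formula. -/
def normal (x : E3) : E3 := -er x

/-- `f_tan = f - n (f · n)`. -/
def tanPart (f : E3 → E3) (x : E3) : E3 := f x - inner ℝ (f x) (normal x) • normal x

/-- The deformation tensor `D(u) = (∇u + ∇ᵀu) / 2`. -/
def deform (u : E3 → E3) (x : E3) : Matrix (Fin 3) (Fin 3) ℝ :=
  Matrix.of fun i j => (wpd i (fun y => u y j) x + wpd j (fun y => u y i) x) / 2

/-- `D(u) n`. -/
def deformNormal (u : E3 → E3) (x : E3) : E3 := Matrix.toEuclideanLin (deform u x) (normal x)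

/-- `u ∈ D(A) = {u ∈ L²_σ ∩ H² | (D(u) n)_tan = 0, u · n = 0 on ∂Π}`. The functions that have
to vanish on `∂Π` belong to `H¹(Π)` since `n` is smooth with bounded derivatives on `Π`; that
their trace on `∂Π` is zero is expressed by membership in `H¹₀(Π)`. -/
structure MemDA (u : E3 → E3) : Prop where
  solenoidal : MemL2Sigma u
  memH2 : ∀ j, MemH2 (fun x => u x j)
  slip : ∀ j, MemH10 (fun x => tanPart (deformNormal u) x j)
  impermeable : MemH10 (fun x => inner ℝ (u x) (normal x))

/-! ### Components of velocity and vorticity -/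

/-- `u^r = u · e_r`. -/
def ur (u : E3 → E3) (x : E3) : ℝ := inner ℝ (u x) (er x)

/-- `u^z = u · e_z`. -/
def uz (u : E3 → E3) (x : E3) : ℝ := inner ℝ (u x) ez

/-- `v = u^r e_r + u^z e_z`. -/
def merid (u : E3 → E3) (x : E3) : E3 := ur u x • er x + uz u x • ez

/-- The azimuthal vorticity `ω^θ = e_θ · curl u = ∂_z u^r - ∂_r u^z`. -/
def ωθ (u : E3 → E3) (x : E3) : ℝ := inner ℝ (curl u x) (eθ x)

/-- The vector field `ω^θ e_θ`. -/
def ωθVec (u : E3 → E3) (x : E3) : E3 := ωθ u x • eθ x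

end CylinderFlow

end

namespace CylinderFlow

/-! ### The domain and test functions -/

/-! Write `u^r`, `u^z`, `ω` for the components. Everything rests on three facts.

Boundary values. The outward normal has no vertical component, so the vertical part of the slip
condition is `-(∂_z u^r + ∂_r u^z)/2`, with zero trace. Since `u^r` itself has zero trace and `∂_z`
is tangential to the cylinder, `∂_z u^r` also has zero trace; hence so does `ω = ∂_z u^r - ∂_r u^z`
(`MemDA.memH10_ωθ`). This uses that `H¹₀(Π)` consists exactly of the functions whose zero extension
has square integrable weak derivatives on the whole space (`MemH10.hasZeroExtPartial`,
`memH10_of_hasZeroExtPartial`).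

The gradient of `v`. Axisymmetry turns the horizontal gradients of `u^r` and `u^z` into multiples of
`e_r` and makes `u^θ e_θ` divergence free, so `∂_r u^r + u^r/r + ∂_z u^z = 0`. With this relation
`|∇v|² - ω²` equals, pointwise, a sum of null Lagrangians in `u^r e_r` and `u^z` minus the
divergence of `(u^r)² e_r / r`. Both integrate to zero because `u^r` vanishes on the boundary
(`MemDA.nrm_vgrad_merid`). In particular `∇u^r` and `∇u^z` are bounded in `L²` by `ω`. The formula
for `∇(ω e_θ)` is pointwise: `e_θ` is a unit field orthogonal to its own derivatives, and `|∇e_θ| =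
1/r`.

Interpolation. The inequality `‖f‖_4 ≤ 4 ‖f‖_2^{1/4} ‖∇f‖_2^{3/4}` holds on all of `H¹(Π)`, with no
boundary condition and no lower order term (`MemH1.nrm_four_le`). Gagliardo's argument only needs,
from every point, one ray inside the domain parallel to each axis, and each of the four quadrants of
`Π` has such rays. Density of smooth functions comes from mollification combined with a slight
dilation, which moves points of `Π` away from the boundary. All three scalar inequalities follow,
and the one for `v` by adding two of them. -/

lemma continuous_rad : Continuous rad := by
  unfold rad; fun_prop

lemma isOpen_Cyl : IsOpen Cyl := isOpen_lt continuous_const continuous_rad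

lemma measurableSet_Cyl : MeasurableSet Cyl := isOpen_Cyl.measurableSet

lemma ae_mem_Cyl : ∀ᵐ x ∂μC, x ∈ Cyl := ae_restrict_mem measurableSet_Cyl

instance : IsLocallyFiniteMeasure μC := by unfold μC; infer_instance

lemma contDiffAt_of_Cyl {a : E3 → ℝ} (ha : ContDiffOn ℝ ∞ a Cyl) {x : E3} (hx : x ∈ Cyl) :
    ContDiffAt ℝ ∞ a x := ha.contDiffAt (isOpen_Cyl.mem_nhds hx)

lemma differentiableAt_of_Cyl {a : E3 → ℝ} (ha : ContDiffOn ℝ ∞ a Cyl) {x : E3} (hx : x ∈ Cyl) :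
    DifferentiableAt ℝ a x := (contDiffAt_of_Cyl ha hx).differentiableAt (by simp)

lemma pd_mul {a b : E3 → ℝ} {x : E3} (i : Fin 3) (ha : DifferentiableAt ℝ a x)
    (hb : DifferentiableAt ℝ b x) :
    pd i (fun y => a y * b y) x = a x * pd i b x + pd i a x * b x := by
  simp only [pd]
  rw [fderiv_fun_mul ha hb]
  simp; ring

lemma pd_congr {a b : E3 → ℝ} {x : E3} (i : Fin 3) (h : a =ᶠ[𝓝 x] b) : pd i a x = pd i b x := by
  simp only [pd, h.fderiv_eq]

lemma pd_congr_Cyl {a b : E3 → ℝ} (i : Fin 3) (h : Set.EqOn a b Cyl) :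
    Set.EqOn (pd i a) (pd i b) Cyl := fun _ hx =>
  pd_congr i (h.eventuallyEq_of_mem (isOpen_Cyl.mem_nhds hx))

lemma contDiff_pd {φ : E3 → ℝ} (i : Fin 3) (h : ContDiff ℝ ∞ φ) : ContDiff ℝ ∞ (pd i φ) :=
  (h.fderiv_right (m := ∞) (by simp)).clm_apply contDiff_const

lemma contDiffOn_pd {a : E3 → ℝ} (i : Fin 3) (h : ContDiffOn ℝ ∞ a Cyl) :
    ContDiffOn ℝ ∞ (pd i a) Cyl :=
  (h.fderiv_of_isOpen (m := ∞) isOpen_Cyl (by simp)).clm_apply contDiffOn_const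

lemma support_pd_subset (i : Fin 3) (φ : E3 → ℝ) : tsupport (pd i φ) ⊆ tsupport φ :=
  closure_minimal (fun x hx => support_fderiv_subset ℝ (fun h => hx (by simp [pd, h])))
    (isClosed_tsupport _)

lemma hasCompactSupport_pd (i : Fin 3) {φ : E3 → ℝ} (h : HasCompactSupport φ) :
    HasCompactSupport (pd i φ) :=
  h.of_isClosed_subset (isClosed_tsupport _) (support_pd_subset i φ)

lemma IsTest.pd {φ : E3 → ℝ} (i : Fin 3) (h : IsTest φ) : IsTest (pd i φ) :=
  ⟨contDiff_pd i h.1, hasCompactSupport_pd i h.2.1, (support_pd_subset i φ).trans h.2.2⟩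

/-- Smoothness of the factor on `Π` is enough, since the product vanishes near every point off the
support of `φ`. This matters for `e_r` and `1/r`, which are singular on the axis. -/
lemma IsTest.mul_left {a φ : E3 → ℝ} (ha : ContDiffOn ℝ ∞ a Cyl) (h : IsTest φ) :
    IsTest (fun x => a x * φ x) := by
  refine ⟨contDiff_iff_contDiffAt.2 fun x => ?_, h.2.1.mul_left,
    (tsupport_mul_subset_right).trans h.2.2⟩
  by_cases hx : x ∈ tsupport φ
  · exact (contDiffAt_of_Cyl ha (h.2.2 hx)).mul h.1.contDiffAt
  · have : (fun x => a x * φ x) =ᶠ[𝓝 x] fun _ => 0 := by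
      filter_upwards [notMem_tsupport_iff_eventuallyEq.1 hx] with y hy
      simp [hy]
    exact contDiffAt_const.congr_of_eventuallyEq this

lemma IsTest.mul_contDiff {a φ : E3 → ℝ} (ha : ContDiff ℝ ∞ a) (h : IsTest φ) :
    IsTest (fun x => a x * φ x) := h.mul_left ha.contDiffOn

lemma IsTest.memLp {φ : E3 → ℝ} (h : IsTest φ) (p : ℝ≥0∞) : MemLp φ p μC :=
  (h.1.continuous.memLp_of_hasCompactSupport h.2.1).mono_measure Measure.restrict_le_self

/-! ### Weak derivatives -/

lemma locallyIntegrableOn_Cyl_of_memLp {f : E3 → ℝ} (hf : MemLp f 2 μC) :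
    LocallyIntegrableOn f Cyl :=
  locallyIntegrableOn_of_locallyIntegrable_restrict (hf.locallyIntegrable (by norm_num))

lemma integrable_mul_test {f φ : E3 → ℝ} (hf : LocallyIntegrableOn f Cyl) (h : IsTest φ) :
    Integrable (fun x => f x * φ x) μC := by
  have hK := (hf.integrableOn_compact_subset h.2.2 h.2.1).mul_continuousOn
    h.1.continuous.continuousOn h.2.1
  have : Integrable (fun x => f x * φ x) volume :=
    (integrableOn_iff_integrable_of_support_subset (fun x hx => subset_tsupport φ
      (fun h0 => hx (by simp [h0])))).1 hK
  exact this.restrict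

/-- The fundamental lemma of the calculus of variations on `Π`. It gives uniqueness of weak
derivatives and turns each distributional identity below into an almost everywhere one. -/
lemma ae_eq_of_integral_test {f g : E3 → ℝ} (hf : LocallyIntegrableOn f Cyl)
    (hg : LocallyIntegrableOn g Cyl)
    (h : ∀ φ, IsTest φ → ∫ x, f x * φ x ∂μC = ∫ x, g x * φ x ∂μC) : f =ᵐ[μC] g := by
  have := isOpen_Cyl.ae_eq_zero_of_integral_contDiff_smul_eq_zero (hf.sub hg) (fun φ h1 h2 h3 => by
    have ht : IsTest φ := ⟨h1, h2, h3⟩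
    have h4 : ∫ x, φ x • (f - g) x ∂μC = 0 := by
      have : ∀ x, φ x • (f - g) x = f x * φ x - g x * φ x := fun x => by simp; ring
      simp_rw [this]
      rw [integral_sub (integrable_mul_test hf ht) (integrable_mul_test hg ht), h φ ht, sub_self]
    rw [← h4, μC, setIntegral_eq_integral_of_forall_compl_eq_zero]
    intro x hx
    simp [image_eq_zero_of_notMem_tsupport (fun hx' => hx (h3 hx'))])
  filter_upwards [(ae_restrict_iff' measurableSet_Cyl).2 this] with x hx
  simpa [sub_eq_zero] using hx

lemma HasWeakPartial.ae_unique {i : Fin 3} {f g g' : E3 → ℝ} (h : HasWeakPartial i f g)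
    (h' : HasWeakPartial i f g') : g =ᵐ[μC] g' :=
  ae_eq_of_integral_test h.2.1 h'.2.1 fun φ hφ => by
    have := h.2.2 φ hφ
    rw [h'.2.2 φ hφ] at this
    linarith

lemma HasWeakPartial.wpd {i : Fin 3} {f g : E3 → ℝ} (h : HasWeakPartial i f g) :
    HasWeakPartial i f (wpd i f) := by
  have : ∃ g, HasWeakPartial i f g := ⟨g, h⟩
  rw [CylinderFlow.wpd, dif_pos this]
  exact this.choose_spec

/-- `wpd` picks an arbitrary representative, so it is computed only almost everywhere, by exhibiting
some weak derivative. -/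
lemma HasWeakPartial.wpd_ae {i : Fin 3} {f g : E3 → ℝ} (h : HasWeakPartial i f g) :
    CylinderFlow.wpd i f =ᵐ[μC] g := h.wpd.ae_unique h

lemma HasWeakPartial.congr {i : Fin 3} {f g f' g' : E3 → ℝ} (h : HasWeakPartial i f g)
    (hf : f =ᵐ[μC] f') (hg : g =ᵐ[μC] g') : HasWeakPartial i f' g' := by
  refine ⟨h.1.congr hf, h.2.1.congr hg, fun φ hφ => ?_⟩
  have e1 : ∫ x, f' x * CylinderFlow.pd i φ x ∂μC = ∫ x, f x * CylinderFlow.pd i φ x ∂μC :=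
    integral_congr_ae (by filter_upwards [hf] with x hx; rw [hx])
  have e2 : ∫ x, g' x * φ x ∂μC = ∫ x, g x * φ x ∂μC :=
    integral_congr_ae (by filter_upwards [hg] with x hx; rw [hx])
  rw [e1, e2, h.2.2 φ hφ]

lemma HasWeakPartial.add {i : Fin 3} {f g f' g' : E3 → ℝ} (h : HasWeakPartial i f g)
    (h' : HasWeakPartial i f' g') :
    HasWeakPartial i (fun x => f x + f' x) (fun x => g x + g' x) := by
  refine ⟨h.1.add h'.1, h.2.1.add h'.2.1, fun φ hφ => ?_⟩
  simp_rw [add_mul]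
  rw [integral_add (integrable_mul_test h.1 (hφ.pd i)) (integrable_mul_test h'.1 (hφ.pd i)),
    integral_add (integrable_mul_test h.2.1 hφ) (integrable_mul_test h'.2.1 hφ),
    h.2.2 φ hφ, h'.2.2 φ hφ]
  ring

lemma HasWeakPartial.smooth_mul {i : Fin 3} {f g a : E3 → ℝ} (ha : ContDiffOn ℝ ∞ a Cyl)
    (h : HasWeakPartial i f g) :
    HasWeakPartial i (fun x => a x * f x) (fun x => a x * g x + CylinderFlow.pd i a x * f x) := by
  have hl := isOpen_Cyl.isLocallyClosed
  have ha' := contDiffOn_pd i ha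
  refine ⟨h.1.continuousOn_mul ha.continuousOn hl,
    (h.2.1.continuousOn_mul ha.continuousOn hl).add
      (h.1.continuousOn_mul ha'.continuousOn hl), fun φ hφ => ?_⟩
  have key := h.2.2 _ (hφ.mul_left ha)
  have e1 : ∫ x, f x * CylinderFlow.pd i (fun y => a y * φ y) x ∂μC
      = ∫ x, (f x * (a x * CylinderFlow.pd i φ x)
        + f x * (CylinderFlow.pd i a x * φ x)) ∂μC := by
    refine integral_congr_ae ?_
    filter_upwards [ae_mem_Cyl] with x hx
    rw [pd_mul i (differentiableAt_of_Cyl ha hx) (hφ.1.differentiable (by simp) x)]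
    ring
  rw [e1, integral_add (integrable_mul_test h.1 ((hφ.pd i).mul_left ha))
    (integrable_mul_test h.1 (hφ.mul_left ha'))] at key
  have e2 : ∀ x, (a x * g x + CylinderFlow.pd i a x * f x) * φ x
    = g x * (a x * φ x) + f x * (CylinderFlow.pd i a x * φ x) := fun x => by ring
  simp_rw [e2]
  rw [integral_add (integrable_mul_test h.2.1 (hφ.mul_left ha))
    (integrable_mul_test h.1 (hφ.mul_left ha'))]
  have e3 : ∀ x, a x * f x * CylinderFlow.pd i φ x = f x * (a x * CylinderFlow.pd i φ x) :=
    fun x => by ring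
  simp_rw [e3]
  linarith

lemma pd_const (i : Fin 3) (c : ℝ) (x : E3) : pd i (fun _ => c) x = 0 := by
  simp [pd]

lemma HasWeakPartial.const_mul {i : Fin 3} {f g : E3 → ℝ} (c : ℝ) (h : HasWeakPartial i f g) :
    HasWeakPartial i (fun x => c * f x) (fun x => c * g x) := by
  simpa [pd_const] using h.smooth_mul (a := fun _ => c) contDiffOn_const

lemma HasWeakPartial.of_memLp {i : Fin 3} {f g : E3 → ℝ} (hf : MemLp f 2 μC) (hg : MemLp g 2 μC)
    (h : ∀ φ : E3 → ℝ, IsTest φ →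
      ∫ x, f x * CylinderFlow.pd i φ x ∂μC = -∫ x, g x * φ x ∂μC) : HasWeakPartial i f g :=
  ⟨locallyIntegrableOn_Cyl_of_memLp hf, locallyIntegrableOn_Cyl_of_memLp hg, h⟩

lemma integral_pd_mul {φ ψ : E3 → ℝ} (i : Fin 3) (hφ : ContDiff ℝ ∞ φ) (hψ : ContDiff ℝ ∞ ψ)
    (h : HasCompactSupport ψ) :
    ∫ x, φ x * pd i ψ x = -∫ x, pd i φ x * ψ x := by
  have hs : ∀ a b : E3 → ℝ, Continuous a → Continuous b → HasCompactSupport b →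
      Integrable (fun x => a x * b x) := fun a b ha hb hc =>
    (ha.mul hb).integrable_of_hasCompactSupport hc.mul_left
  exact integral_mul_fderiv_eq_neg_fderiv_mul_of_integrable
    (hs _ _ (contDiff_pd i hφ).continuous hψ.continuous h)
    (hs _ _ hφ.continuous (contDiff_pd i hψ).continuous (hasCompactSupport_pd i h))
    (hs _ _ hφ.continuous hψ.continuous h)
    (fun x _ => hφ.differentiable (by simp) x) (fun x _ => hψ.differentiable (by simp) x)

lemma setIntegral_mul_test {f φ : E3 → ℝ} (h : IsTest φ) :
    ∫ x, f x * φ x ∂μC = ∫ x, f x * φ x :=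
  setIntegral_eq_integral_of_forall_compl_eq_zero fun x hx => by
    simp [image_eq_zero_of_notMem_tsupport (fun hx' => hx (h.2.2 hx'))]

lemma hasWeakPartial_of_contDiff {φ : E3 → ℝ} (i : Fin 3) (hφ : ContDiff ℝ ∞ φ) :
    HasWeakPartial i φ (pd i φ) :=
  ⟨hφ.continuous.locallyIntegrable.locallyIntegrableOn _,
    (contDiff_pd i hφ).continuous.locallyIntegrable.locallyIntegrableOn _, fun ψ hψ => by
      rw [setIntegral_mul_test hψ, setIntegral_mul_test (hψ.pd i),
        integral_pd_mul i hφ hψ.1 hψ.2.1]⟩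

/-! ### The spaces `H¹` and `H²` -/

lemma MemH1.hasWeakPartial {f : E3 → ℝ} (h : MemH1 f) (i : Fin 3) :
    HasWeakPartial i f (wpd i f) := by
  obtain ⟨g, hg, -⟩ := h.2 i
  exact hg.wpd

lemma MemH1.memLp_wpd {f : E3 → ℝ} (h : MemH1 f) (i : Fin 3) : MemLp (wpd i f) 2 μC := by
  obtain ⟨g, hg, hm⟩ := h.2 i
  exact hm.ae_eq hg.wpd_ae.symm

lemma MemH1.congr {f g : E3 → ℝ} (h : MemH1 f) (hfg : f =ᵐ[μC] g) : MemH1 g :=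
  ⟨h.1.ae_eq hfg, fun i => ⟨_, (h.hasWeakPartial i).congr hfg ae_eq_rfl, h.memLp_wpd i⟩⟩

lemma MemH1.add {f g : E3 → ℝ} (hf : MemH1 f) (hg : MemH1 g) : MemH1 (fun x => f x + g x) :=
  ⟨hf.1.add hg.1, fun i => ⟨_, (hf.hasWeakPartial i).add (hg.hasWeakPartial i),
    (hf.memLp_wpd i).add (hg.memLp_wpd i)⟩⟩

lemma MemH1.const_mul {f : E3 → ℝ} (c : ℝ) (hf : MemH1 f) : MemH1 (fun x => c * f x) :=
  ⟨hf.1.const_mul c, fun i => ⟨_, (hf.hasWeakPartial i).const_mul c, (hf.memLp_wpd i).const_mul c⟩⟩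

lemma MemH2.memH1 {f : E3 → ℝ} (h : MemH2 f) : MemH1 f :=
  ⟨h.1, fun i => (h.2 i).imp fun _ hg => ⟨hg.1, hg.2.1⟩⟩

lemma MemH2.memH1_wpd {f : E3 → ℝ} (h : MemH2 f) (i : Fin 3) : MemH1 (wpd i f) := by
  obtain ⟨g, hg, hm⟩ := h.2 i
  exact hm.congr hg.wpd_ae.symm

lemma MemH2.add {f g : E3 → ℝ} (hf : MemH2 f) (hg : MemH2 g) : MemH2 (fun x => f x + g x) :=
  ⟨hf.1.add hg.1, fun i => ⟨_, (hf.memH1.hasWeakPartial i).add (hg.memH1.hasWeakPartial i),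
    (hf.memH1_wpd i).add (hg.memH1_wpd i)⟩⟩

/-! ### Multiplication by smooth functions with bounded derivatives -/

/-- A function that is smooth on `Π` and bounded there along with its first derivatives. -/
structure IsCoeff (a : E3 → ℝ) : Prop where
  smooth : ContDiffOn ℝ ∞ a Cyl
  bdd : ∃ C, ∀ x ∈ Cyl, |a x| ≤ C
  bdd_pd : ∀ i, ∃ C, ∀ x ∈ Cyl, |pd i a x| ≤ C

lemma IsCoeff.congr {a b : E3 → ℝ} (ha : IsCoeff a) (h : Set.EqOn a b Cyl) : IsCoeff b where
  smooth := ha.smooth.congr fun x hx => (h hx).symm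
  bdd := ha.bdd.imp fun C hC x hx => by rw [← h hx]; exact hC x hx
  bdd_pd i := (ha.bdd_pd i).imp fun C hC x hx => by
    rw [← pd_congr_Cyl i h hx]; exact hC x hx

lemma isCoeff_const (c : ℝ) : IsCoeff fun _ => c where
  smooth := contDiffOn_const
  bdd := ⟨|c|, fun _ _ => le_rfl⟩
  bdd_pd i := ⟨0, fun x _ => by simp [pd_const]⟩

lemma abs_mul_le_of_le {a b A B : ℝ} (ha : |a| ≤ A) (hb : |b| ≤ B) : |a * b| ≤ A * B := by
  rw [abs_mul]
  exact mul_le_mul ha hb (abs_nonneg _) ((abs_nonneg _).trans ha)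

lemma IsCoeff.mul {a b : E3 → ℝ} (ha : IsCoeff a) (hb : IsCoeff b) :
    IsCoeff fun x => a x * b x where
  smooth := ha.smooth.mul hb.smooth
  bdd := by
    obtain ⟨A, hA⟩ := ha.bdd
    obtain ⟨B, hB⟩ := hb.bdd
    exact ⟨A * B, fun x hx => abs_mul_le_of_le (hA x hx) (hB x hx)⟩
  bdd_pd i := by
    obtain ⟨A, hA⟩ := ha.bdd
    obtain ⟨B, hB⟩ := hb.bdd
    obtain ⟨A', hA'⟩ := ha.bdd_pd i
    obtain ⟨B', hB'⟩ := hb.bdd_pd i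
    refine ⟨A * B' + A' * B, fun x hx => ?_⟩
    rw [pd_mul i (differentiableAt_of_Cyl ha.smooth hx) (differentiableAt_of_Cyl hb.smooth hx)]
    exact (abs_add_le _ _).trans (add_le_add (abs_mul_le_of_le (hA x hx) (hB' x hx))
      (abs_mul_le_of_le (hA' x hx) (hB x hx)))

lemma IsCoeff.add {a b : E3 → ℝ} (ha : IsCoeff a) (hb : IsCoeff b) :
    IsCoeff fun x => a x + b x where
  smooth := ha.smooth.add hb.smooth
  bdd := by
    obtain ⟨A, hA⟩ := ha.bdd
    obtain ⟨B, hB⟩ := hb.bdd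
    exact ⟨A + B, fun x hx => (abs_add_le _ _).trans (add_le_add (hA x hx) (hB x hx))⟩
  bdd_pd i := by
    obtain ⟨A, hA⟩ := ha.bdd_pd i
    obtain ⟨B, hB⟩ := hb.bdd_pd i
    refine ⟨A + B, fun x hx => ?_⟩
    have : pd i (fun y => a y + b y) x = pd i a x + pd i b x := by
      simp only [pd]
      rw [fderiv_fun_add (differentiableAt_of_Cyl ha.smooth hx)
        (differentiableAt_of_Cyl hb.smooth hx)]
      simp
    rw [this]
    exact (abs_add_le _ _).trans (add_le_add (hA x hx) (hB x hx))

lemma memLp_bdd_mul {a f : E3 → ℝ} (ha : ContinuousOn a Cyl) (hb : ∃ C, ∀ x ∈ Cyl, |a x| ≤ C)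
    (hf : MemLp f 2 μC) : MemLp (fun x => a x * f x) 2 μC := by
  obtain ⟨C, hC⟩ := hb
  refine (hf.const_mul C).of_le ((ha.aestronglyMeasurable measurableSet_Cyl).mul hf.1) ?_
  filter_upwards [ae_mem_Cyl] with x hx
  rw [norm_mul, norm_mul]
  exact mul_le_mul_of_nonneg_right ((hC x hx).trans (le_abs_self C)) (norm_nonneg _)

lemma IsCoeff.memLp_mul {a f : E3 → ℝ} (ha : IsCoeff a) (hf : MemLp f 2 μC) :
    MemLp (fun x => a x * f x) 2 μC := memLp_bdd_mul ha.smooth.continuousOn ha.bdd hf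

lemma IsCoeff.memLp_pd_mul {a f : E3 → ℝ} (i : Fin 3) (ha : IsCoeff a) (hf : MemLp f 2 μC) :
    MemLp (fun x => pd i a x * f x) 2 μC :=
  memLp_bdd_mul (contDiffOn_pd i ha.smooth).continuousOn (ha.bdd_pd i) hf

lemma MemH1.coeff_mul {a f : E3 → ℝ} (ha : IsCoeff a) (hf : MemH1 f) :
    MemH1 fun x => a x * f x :=
  ⟨ha.memLp_mul hf.1, fun i => ⟨_, (hf.hasWeakPartial i).smooth_mul ha.smooth,
    (ha.memLp_mul (hf.memLp_wpd i)).add (ha.memLp_pd_mul i hf.1)⟩⟩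

lemma MemH1.wpd_coeff_mul {a f : E3 → ℝ} (ha : IsCoeff a) (hf : MemH1 f) (i : Fin 3) :
    wpd i (fun x => a x * f x) =ᵐ[μC] fun x => a x * wpd i f x + pd i a x * f x :=
  ((hf.hasWeakPartial i).smooth_mul ha.smooth).wpd_ae

lemma MemH2.coeff_mul {a f : E3 → ℝ} (ha : IsCoeff a) (ha' : ∀ i, IsCoeff (pd i a))
    (hf : MemH2 f) : MemH2 fun x => a x * f x :=
  ⟨ha.memLp_mul hf.1, fun i => ⟨_, (hf.memH1.hasWeakPartial i).smooth_mul ha.smooth,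
    ((hf.memH1_wpd i).coeff_mul ha).add (hf.memH1.coeff_mul (ha' i))⟩⟩

/-! ### The radial unit vector -/

lemma one_lt_rad {x : E3} (hx : x ∈ Cyl) : 1 < rad x := hx

lemma rad_pos {x : E3} (hx : x ∈ Cyl) : 0 < rad x := zero_lt_one.trans hx

lemma rad_sq (x : E3) : rad x ^ 2 = x 0 ^ 2 + x 1 ^ 2 := Real.sq_sqrt (by positivity)

lemma hasFDerivAt_coord (i : Fin 3) (x : E3) :
    HasFDerivAt (fun y : E3 => y i) (EuclideanSpace.proj i : E3 →L[ℝ] ℝ) x :=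
  (EuclideanSpace.proj i : E3 →L[ℝ] ℝ).hasFDerivAt

lemma pd_coord (i j : Fin 3) (x : E3) : pd i (fun y => y j) x = if i = j then 1 else 0 := by
  simp only [pd]
  rw [(hasFDerivAt_coord j x).fderiv]
  simp [eq_comm]

lemma contDiff_coord (j : Fin 3) : ContDiff ℝ ∞ (fun y : E3 => y j) :=
  (EuclideanSpace.proj j : E3 →L[ℝ] ℝ).contDiff

lemma contDiffOn_rad : ContDiffOn ℝ ∞ rad Cyl := by
  unfold rad
  refine ContDiffOn.sqrt ?_ fun x hx => ?_
  · exact (((contDiff_coord 0).pow 2).add ((contDiff_coord 1).pow 2)).contDiffOn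
  · rw [← rad_sq]
    exact (pow_pos (rad_pos hx) 2).ne'

lemma pd_sq (i : Fin 3) {a : E3 → ℝ} {x : E3} (ha : DifferentiableAt ℝ a x) :
    pd i (fun y => a y ^ 2) x = 2 * a x * pd i a x := by
  have : (fun y => a y ^ 2) = fun y => a y * a y := by ext; ring
  rw [this, pd_mul i ha ha]; ring

@[simp] lemma er_two (x : E3) : er x 2 = 0 := by simp [er]

lemma er_eq (x : E3) (j : Fin 3) : er x j = (if j = 2 then 0 else x j) / rad x := by
  fin_cases j <;> simp [er]

lemma pd_rad (i : Fin 3) {x : E3} (hx : x ∈ Cyl) : pd i rad x = er x i := by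
  have h1 : pd i (fun y => rad y ^ 2) x = pd i (fun y : E3 => y 0 * y 0 + y 1 * y 1) x := by
    simp_rw [rad_sq, sq]
  have hd := fun j => (hasFDerivAt_coord j x).differentiableAt
  have h2 : pd i (fun y : E3 => y 0 * y 0 + y 1 * y 1) x
      = pd i (fun y : E3 => y 0 * y 0) x + pd i (fun y : E3 => y 1 * y 1) x := by
    simp only [pd]
    rw [fderiv_fun_add ((hd 0).fun_mul (hd 0)) ((hd 1).fun_mul (hd 1))]; simp
  rw [pd_sq i (differentiableAt_of_Cyl contDiffOn_rad hx), h2, pd_mul i (hd 0) (hd 0),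
    pd_mul i (hd 1) (hd 1)] at h1
  simp only [pd_coord] at h1
  have := rad_pos hx
  rw [er_eq, eq_div_iff this.ne']
  refine mul_left_cancel₀ two_ne_zero ?_
  have h3 : 2 * (pd i rad x * rad x) = 2 * rad x * pd i rad x := by ring
  rw [h3, h1]
  fin_cases i <;> simp <;> ring

lemma contDiffOn_inv_rad : ContDiffOn ℝ ∞ (fun x => (rad x)⁻¹) Cyl :=
  contDiffOn_rad.inv fun _ hx => (rad_pos hx).ne'

lemma pd_inv_rad (i : Fin 3) {x : E3} (hx : x ∈ Cyl) :
    pd i (fun y => (rad y)⁻¹) x = -er x i * ((rad x)⁻¹ * (rad x)⁻¹) := by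
  have hd := differentiableAt_of_Cyl contDiffOn_rad hx
  have h0 := (rad_pos hx).ne'
  have h1 : pd i (fun y => rad y * (rad y)⁻¹) x = 0 := by
    rw [← pd_const i 1 x]
    exact pd_congr_Cyl i (fun y hy => mul_inv_cancel₀ (rad_pos hy).ne') hx
  rw [pd_mul i hd (differentiableAt_of_Cyl contDiffOn_inv_rad hx), pd_rad i hx] at h1
  field_simp
  field_simp at h1
  linarith

/-- The orthogonal projection onto the horizontal plane, as a matrix. -/
def horiz (i j : Fin 3) : ℝ := if i = j ∧ j ≠ 2 then 1 else 0

lemma pd_er (i j : Fin 3) {x : E3} (hx : x ∈ Cyl) :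
    pd i (fun y => er y j) x = (horiz i j - er x i * er x j) * (rad x)⁻¹ := by
  have h1 : ∀ y, er y j = (if j = 2 then 0 else y j) * (rad y)⁻¹ := fun y => by
    rw [er_eq, div_eq_mul_inv]
  have h3 : DifferentiableAt ℝ (fun y : E3 => if j = 2 then (0 : ℝ) else y j) x := by
    split_ifs
    · exact differentiableAt_const _
    · exact (hasFDerivAt_coord j x).differentiableAt
  have h4 : pd i (fun y : E3 => if j = 2 then (0 : ℝ) else y j) x = horiz i j := by
    split_ifs with h
    · simp [pd_const, horiz, h]
    · simp [pd_coord, horiz, h]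
  simp_rw [h1]
  rw [pd_mul i h3 (differentiableAt_of_Cyl contDiffOn_inv_rad hx), pd_inv_rad i hx, h4, ← h1]
  simp only [h1 x]
  ring

/-- Valid on the axis too, where division by zero makes `er` vanish. -/
lemma abs_er_le (j : Fin 3) (x : E3) : |er x j| ≤ 1 := by
  have h0 : 0 ≤ rad x := Real.sqrt_nonneg _
  rw [er_eq, abs_div, abs_of_nonneg h0]
  refine div_le_one_of_le₀ ?_ h0
  split_ifs with h
  · simpa using h0
  · rw [rad]
    refine Real.abs_le_sqrt ?_
    fin_cases j <;> simp_all <;> positivity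

lemma inv_rad_le {x : E3} (hx : x ∈ Cyl) : |(rad x)⁻¹| ≤ 1 := by
  rw [abs_of_pos (inv_pos.2 (rad_pos hx))]
  exact inv_le_one_of_one_le₀ (one_lt_rad hx).le

lemma er_sq {x : E3} (hx : x ∈ Cyl) : er x 0 ^ 2 + er x 1 ^ 2 = 1 := by
  have := rad_pos hx
  simp only [er_eq]
  simp
  field_simp
  rw [rad_sq]

lemma contDiffOn_er (j : Fin 3) : ContDiffOn ℝ ∞ (fun x => er x j) Cyl := by
  have h1 : ∀ y, er y j = (if j = 2 then 0 else y j) * (rad y)⁻¹ := fun y => by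
    rw [er_eq, div_eq_mul_inv]
  simp_rw [h1]
  refine ContDiffOn.mul ?_ contDiffOn_inv_rad
  split_ifs
  · exact contDiffOn_const
  · exact (contDiff_coord j).contDiffOn

lemma isCoeff_inv_rad : IsCoeff fun x => (rad x)⁻¹ where
  smooth := contDiffOn_inv_rad
  bdd := ⟨1, fun x hx => inv_rad_le hx⟩
  bdd_pd i := ⟨1 * (1 * 1), fun x hx => by
    rw [pd_inv_rad i hx]
    exact abs_mul_le_of_le (by simpa using abs_er_le i x)
      (abs_mul_le_of_le (inv_rad_le hx) (inv_rad_le hx))⟩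

lemma isCoeff_er (j : Fin 3) : IsCoeff fun x => er x j where
  smooth := contDiffOn_er j
  bdd := ⟨1, fun x _ => abs_er_le j x⟩
  bdd_pd i := ⟨(|horiz i j| + 1 * 1) * 1, fun x hx => by
    rw [pd_er i j hx]
    exact abs_mul_le_of_le ((abs_sub _ _).trans
      (add_le_add le_rfl (abs_mul_le_of_le (abs_er_le i x) (abs_er_le j x)))) (inv_rad_le hx)⟩

/-- Second derivatives of `e_r` are bounded on `Π` as well; this is what puts `u^r = u · e_r` in
`H²`. -/
lemma isCoeff_pd_er (i j : Fin 3) : IsCoeff (pd i fun x => er x j) := by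
  have h : IsCoeff fun x => (horiz i j + -1 * (er x i * er x j)) * (rad x)⁻¹ :=
    ((isCoeff_const _).add ((isCoeff_const _).mul ((isCoeff_er i).mul (isCoeff_er j)))).mul
      isCoeff_inv_rad
  refine h.congr fun x hx => ?_
  rw [pd_er i j hx]; ring

/-! ### Mollification combined with a dilation -/

/-- The mollification of `F` with kernel `b`, evaluated at `c x`. -/
noncomputable def moll (b : ContDiffBump (0 : E3)) (c : ℝ) (F : E3 → ℝ) (x : E3) : ℝ :=
  ∫ t, F t * b.normed volume (c • x - t)

lemma moll_eq (b : ContDiffBump (0 : E3)) (c : ℝ) (F : E3 → ℝ) (x : E3) :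
    moll b c F x = ∫ t, b.normed volume t * F (c • x - t) := by
  rw [moll, ← integral_sub_left_eq_self _ _ (c • x)]
  refine integral_congr_ae (.of_forall fun t => ?_)
  simp only [sub_sub_cancel]
  ring

lemma integrable_moll (b : ContDiffBump (0 : E3)) {F : E3 → ℝ} (hF : LocallyIntegrable F)
    (y : E3) : Integrable (fun t => F t * b.normed volume (y - t)) :=
  b.hasCompactSupport_normed.convolutionExists_right (ContinuousLinearMap.mul ℝ ℝ) hF
    b.continuous_normed y

lemma moll_sub (b : ContDiffBump (0 : E3)) (c : ℝ) {F G : E3 → ℝ} (hF : LocallyIntegrable F)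
    (hG : LocallyIntegrable G) (x : E3) :
    moll b c (F - G) x = moll b c F x - moll b c G x := by
  simp only [moll, Pi.sub_apply, sub_mul]
  exact integral_sub (integrable_moll b hF _) (integrable_moll b hG _)

lemma moll_congr (b : ContDiffBump (0 : E3)) (c : ℝ) {F G : E3 → ℝ} (h : F =ᵐ[volume] G) :
    moll b c F = moll b c G := by
  ext x
  refine integral_congr_ae ?_
  filter_upwards [h] with t ht
  rw [ht]

lemma contDiff_moll (b : ContDiffBump (0 : E3)) (c : ℝ) {F : E3 → ℝ} (hF : LocallyIntegrable F) :
    ContDiff ℝ ∞ (moll b c F) := by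
  have h := b.hasCompactSupport_normed (μ := volume) |>.contDiff_convolution_right (n := ⊤)
    (ContinuousLinearMap.mul ℝ ℝ) hF b.contDiff_normed
  exact h.comp (contDiff_const_smul c)

lemma lintegral_enorm_normed (b : ContDiffBump (0 : E3)) :
    ∫⁻ t, ‖b.normed volume t‖ₑ = 1 := by
  have h := integral_eq_lintegral_of_nonneg_ae (f := b.normed volume)
    (.of_forall b.nonneg_normed) (b.continuous_normed).aestronglyMeasurable (μ := volume)
  rw [b.integral_normed] at h
  have h2 : ∀ t, ‖b.normed volume t‖ₑ = ENNReal.ofReal (b.normed volume t) := fun t =>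
    Real.enorm_of_nonneg (b.nonneg_normed t)
  simp_rw [h2]
  exact (ENNReal.toReal_eq_one_iff _).1 h.symm

lemma eLpNorm_two_sq {α F : Type*} [MeasurableSpace α] [NormedAddCommGroup F] (μ : Measure α)
    (f : α → F) : eLpNorm f 2 μ ^ 2 = ∫⁻ x, ‖f x‖ₑ ^ 2 ∂μ := by
  rw [eLpNorm_eq_lintegral_rpow_enorm_toReal (by simp) (by simp)]
  simp only [ENNReal.toReal_ofNat, ← ENNReal.rpow_natCast, ← ENNReal.rpow_mul]
  norm_num

lemma eLpNorm_two_le_of_lintegral {α F : Type*} [MeasurableSpace α] [NormedAddCommGroup F]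
    {μ : Measure α} {f : α → F} {A : ℝ≥0∞} (h : ∫⁻ x, ‖f x‖ₑ ^ 2 ∂μ ≤ A ^ 2) :
    eLpNorm f 2 μ ≤ A := by
  rw [← eLpNorm_two_sq] at h
  exact (ENNReal.pow_le_pow_left_iff two_ne_zero).1 h

/-- Cauchy–Schwarz for the probability measure whose density is the kernel. -/
lemma enorm_moll_sq_le (b : ContDiffBump (0 : E3)) {F : E3 → ℝ} (hF : Measurable F) (c : ℝ)
    (x : E3) :
    ‖moll b c F x‖ₑ ^ 2 ≤ ∫⁻ t, ‖b.normed volume t‖ₑ * ‖F (c • x - t)‖ₑ ^ 2 := by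
  have hm : Measurable fun t => ‖b.normed volume t‖ₑ := b.continuous_normed.measurable.enorm
  have hFm : Measurable fun t => ‖F (c • x - t)‖ₑ :=
    (hF.comp (measurable_const.sub measurable_id)).enorm
  set ν : Measure E3 := volume.withDensity fun t => ‖b.normed volume t‖ₑ
  have hν : ν Set.univ = 1 := by
    rw [withDensity_apply _ MeasurableSet.univ, setLIntegral_univ, lintegral_enorm_normed]
  have h1 : ‖moll b c F x‖ₑ ≤ ∫⁻ t, ‖F (c • x - t)‖ₑ ∂ν := by
    rw [moll_eq, lintegral_withDensity_eq_lintegral_mul _ hm hFm]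
    refine (enorm_integral_le_lintegral_enorm _).trans_eq ?_
    simp [enorm_mul]
  have h2 := ENNReal.lintegral_mul_le_Lp_mul_Lq ν Real.HolderConjugate.two_two
    hFm.aemeasurable (g := 1) aemeasurable_const
  simp only [Pi.mul_apply, Pi.one_apply, mul_one, ENNReal.one_rpow, lintegral_const, hν] at h2
  have h3 := ENNReal.pow_le_pow_left (h1.trans h2) (n := 2)
  refine h3.trans_eq ?_
  rw [← ENNReal.rpow_natCast, ← ENNReal.rpow_mul,
    lintegral_withDensity_eq_lintegral_mul _ hm (hFm.pow_const _)]
  norm_num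

lemma lintegral_comp_smul_sub (g : E3 → ℝ≥0∞) (hg : Measurable g) {c : ℝ} (hc : 1 / 2 ≤ c)
    (t : E3) : ∫⁻ x, g (c • x - t) ≤ 8 * ∫⁻ x, g x := by
  have hc0 : 0 < c := by linarith
  have hg' : Measurable fun y => g (y - t) := hg.comp (measurable_id.sub_const t)
  rw [← lintegral_map (f := fun y => g (y - t)) hg' (measurable_const_smul c),
    Measure.map_addHaar_smul _ hc0.ne', lintegral_smul_measure, lintegral_sub_right_eq_self, smul_eq_mul]
  refine mul_le_mul' ?_ le_rfl
  have h3 : Module.finrank ℝ E3 = 3 := by simp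
  rw [h3, abs_of_pos (by positivity)]
  have h4 : (c ^ 3)⁻¹ ≤ 8 := by
    have : (1 / 2) ^ 3 ≤ c ^ 3 := by gcongr
    calc (c ^ 3)⁻¹ ≤ ((1 / 2 : ℝ) ^ 3)⁻¹ := by gcongr
      _ = 8 := by norm_num
  calc ENNReal.ofReal (c ^ 3)⁻¹ ≤ ENNReal.ofReal 8 := ENNReal.ofReal_le_ofReal h4
    _ = 8 := by norm_num

/-- Integrating the pointwise Cauchy–Schwarz bound in `x` costs the Jacobian `c⁻³ ≤ 8` of the
dilation. Only uniformity in the kernel and in `c` matters, so `√8` is relaxed to `8`. -/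
lemma eLpNorm_moll_le (b : ContDiffBump (0 : E3)) {F : E3 → ℝ} (hF : MemLp F 2) {c : ℝ}
    (hc : 1 / 2 ≤ c) : eLpNorm (moll b c F) 2 ≤ 8 * eLpNorm F 2 := by
  obtain ⟨G, hG, hFG⟩ := hF.1
  rw [moll_congr b c hFG, eLpNorm_congr_ae hFG]
  have hGm := hG.measurable
  refine eLpNorm_two_le_of_lintegral ?_
  calc ∫⁻ x, ‖moll b c G x‖ₑ ^ 2
      ≤ ∫⁻ x, ∫⁻ t, ‖b.normed volume t‖ₑ * ‖G (c • x - t)‖ₑ ^ 2 :=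
        lintegral_mono fun x => enorm_moll_sq_le b hGm c x
    _ = ∫⁻ t, ∫⁻ x, ‖b.normed volume t‖ₑ * ‖G (c • x - t)‖ₑ ^ 2 := by
        refine lintegral_lintegral_swap (Measurable.aemeasurable ?_)
        refine (b.continuous_normed.measurable.comp measurable_snd).enorm.mul ?_
        exact (hGm.comp ((measurable_fst.const_smul c).sub measurable_snd)).enorm.pow_const 2
    _ ≤ ∫⁻ t, ‖b.normed volume t‖ₑ * (8 * ∫⁻ x, ‖G x‖ₑ ^ 2) := by
        refine lintegral_mono fun t => ?_
        rw [lintegral_const_mul]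
        · gcongr
          exact lintegral_comp_smul_sub (fun y => ‖G y‖ₑ ^ 2) (hGm.enorm.pow_const 2) hc t
        · exact (hGm.comp ((measurable_id.const_smul c).sub_const t)).enorm.pow_const 2
    _ = 8 * eLpNorm G 2 volume ^ 2 := by
        rw [lintegral_mul_const _ b.continuous_normed.measurable.enorm, lintegral_enorm_normed,
          one_mul, eLpNorm_two_sq]
    _ ≤ (8 * eLpNorm G 2 volume) ^ 2 := by
        rw [mul_pow]
        gcongr
        norm_num

lemma tendsto_eLpNorm_two_of_dominated {α : Type*} [MeasurableSpace α] {μ : Measure α}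
    {f : ℕ → α → ℝ} {h : α → ℝ} (hf : ∀ n, AEStronglyMeasurable (f n) μ) (hh : MemLp h 2 μ)
    (hb : ∀ n, ∀ᵐ x ∂μ, |f n x| ≤ h x) (hl : ∀ᵐ x ∂μ, Tendsto (fun n => f n x) atTop (𝓝 0)) :
    Tendsto (fun n => eLpNorm (f n) 2 μ) atTop (𝓝 0) := by
  have h1 : Tendsto (fun n => ∫⁻ x, ‖f n x‖ₑ ^ 2 ∂μ) atTop (𝓝 (∫⁻ _, 0 ∂μ)) := by
    refine tendsto_lintegral_of_dominated_convergence' (fun x => ‖h x‖ₑ ^ 2)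
      (fun n => (hf n).enorm.pow_const 2) (fun n => ?_) ?_ ?_
    · filter_upwards [hb n] with x hx
      gcongr
      rw [← enorm_norm (f n x), ← enorm_norm (h x), Real.enorm_of_nonneg (norm_nonneg _),
        Real.enorm_of_nonneg (norm_nonneg _)]
      exact ENNReal.ofReal_le_ofReal (hx.trans (le_abs_self _))
    · rw [← eLpNorm_two_sq]
      exact ENNReal.pow_ne_top hh.2.ne
    · filter_upwards [hl] with x hx
      have := (ENNReal.continuous_pow 2).tendsto _ |>.comp (hx.enorm)
      simpa [Function.comp_def] using this
  simp_rw [← eLpNorm_two_sq, lintegral_zero] at h1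
  have h2 := (ENNReal.continuous_rpow_const (y := 1 / 2)).tendsto 0 |>.comp h1
  simp only [Function.comp_def, ← ENNReal.rpow_natCast, ← ENNReal.rpow_mul] at h2
  simpa using h2

lemma tendsto_moll_of_continuous {b : ℕ → ContDiffBump (0 : E3)} {c : ℕ → ℝ}
    (hb : Tendsto (fun n => (b n).rOut) atTop (𝓝 0)) (hb1 : ∀ n, (b n).rOut ≤ 1)
    (hc : Tendsto c atTop (𝓝 1)) (hc2 : ∀ n, 1 / 2 ≤ c n) {k : E3 → ℝ} (hk : Continuous k)
    (hks : HasCompactSupport k) :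
    Tendsto (fun n => eLpNorm (moll (b n) (c n) k - k) 2) atTop (𝓝 0) := by
  obtain ⟨M, hM⟩ := hk.bounded_above_of_compact_support hks
  have hM0 : 0 ≤ M := (norm_nonneg _).trans (hM 0)
  obtain ⟨R, hR⟩ := hks.isCompact.isBounded.subset_closedBall 0
  have hz : ∀ y, R < ‖y‖ → k y = 0 := fun y hy => by
    by_contra h
    have := hR (subset_tsupport k h)
    simp at this
    linarith
  have hbd : ∀ n x, |moll (b n) (c n) k x| ≤ M := fun n x => by
    rw [moll_eq, ← Real.norm_eq_abs]
    refine (norm_integral_le_of_norm_le (μ := volume) (((b n).integrable_normed (μ := volume)).mul_const M)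
      (.of_forall fun t => ?_)).trans_eq ?_
    · rw [norm_mul, Real.norm_of_nonneg ((b n).nonneg_normed t)]
      exact mul_le_mul_of_nonneg_left (hM _) ((b n).nonneg_normed t)
    · rw [integral_mul_const, (b n).integral_normed, one_mul]
  -- Since `c n ≥ 1/2`, the point `c n • x` has norm above `R + 1`, hence is farther than the kernel
  -- radius, at most `1`, from the support of `k`.
  have hzero : ∀ n x, 2 * (R + 1) < ‖x‖ → moll (b n) (c n) k x = 0 := fun n x hx => by
    rw [moll]
    refine integral_eq_zero_of_ae (.of_forall fun t => ?_)
    by_cases ht : R < ‖t‖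
    · simp [hz t ht]
    · have : t ∉ Metric.ball (c n • x) (b n).rOut := fun h => by
        rw [mem_ball_iff_norm'] at h
        have h1 : ‖c n • x‖ ≤ ‖c n • x - t‖ + ‖t‖ := by
          simpa using norm_add_le (c n • x - t) t
        rw [norm_smul, Real.norm_of_nonneg (by linarith [hc2 n])] at h1
        have h2 : 1 / 2 * ‖x‖ ≤ c n * ‖x‖ := by gcongr; exact hc2 n
        linarith [hb1 n]
      have h0 : (b n).normed volume (c n • x - t) = 0 := by
        rw [← Function.notMem_support, (b n).support_normed_eq]
        rwa [mem_ball_zero_iff, ← mem_ball_iff_norm']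
      simp [h0]
  -- The absolute value of `R` guards against a negative radius, which is possible when `k` vanishes
  -- identically.
  refine tendsto_eLpNorm_two_of_dominated
    (h := (Metric.closedBall (0 : E3) (2 * (|R| + 1))).indicator fun _ => 2 * M)
    (fun n => ?_) ?_ (fun n => .of_forall fun x => ?_) (.of_forall fun x => ?_)
  · exact ((contDiff_moll _ _ hk.locallyIntegrable).continuous.sub hk).aestronglyMeasurable
  · exact memLp_indicator_const 2 Metric.isClosed_closedBall.measurableSet _
      (Or.inr measure_closedBall_lt_top.ne)
  · by_cases hx : x ∈ Metric.closedBall (0 : E3) (2 * (|R| + 1))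
    · rw [Set.indicator_of_mem hx]
      have h2 : |k x| ≤ M := hM x
      exact (abs_sub _ _).trans (by linarith [hbd n x])
    · rw [Set.indicator_of_notMem hx]
      simp only [mem_closedBall_zero_iff, not_le] at hx
      have h1 := le_abs_self R
      have h0 := abs_nonneg R
      simp [hzero n x (by linarith), hz x (by linarith)]
  · have h1 : Tendsto (fun n => c n • x) atTop (𝓝 x) := by
      simpa using hc.smul_const x
    have h2 := ContDiffBump.convolution_tendsto_right (μ := volume) (φ := b) (g := fun _ => k)
      (k := fun n => c n • x) (x₀ := x) (z₀ := k x) hb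
      (.of_forall fun _ => hk.aestronglyMeasurable) ((hk.tendsto x).comp tendsto_snd) h1
    have h3 : ∀ n, (convolution ((b n).normed volume) k (ContinuousLinearMap.lsmul ℝ ℝ) volume)
        (c n • x) = moll (b n) (c n) k x := fun n => by
      rw [moll_eq]; rfl
    simp_rw [h3] at h2
    simpa using h2.sub_const (k x)

/-- The usual density argument: convergence for continuous compactly supported functions, extended
by the uniform `L²` bound. -/
lemma tendsto_moll {b : ℕ → ContDiffBump (0 : E3)} {c : ℕ → ℝ}
    (hb : Tendsto (fun n => (b n).rOut) atTop (𝓝 0)) (hb1 : ∀ n, (b n).rOut ≤ 1)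
    (hc : Tendsto c atTop (𝓝 1)) (hc2 : ∀ n, 1 / 2 ≤ c n) {F : E3 → ℝ} (hF : MemLp F 2) :
    Tendsto (fun n => eLpNorm (moll (b n) (c n) F - F) 2) atTop (𝓝 0) := by
  have hFl := hF.locallyIntegrable (by norm_num)
  rw [ENNReal.tendsto_nhds_zero]
  intro ε hε
  -- The three errors add up to `(8 + 1 + 1)` times this quantity, well within `ε`.
  have hδ : ε / 20 ≠ 0 := (ENNReal.div_pos hε.ne' (by norm_num)).ne'
  obtain ⟨k, hks, hkn, hk, hkm⟩ := hF.exists_hasCompactSupport_eLpNorm_sub_le (by simp) hδ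
  filter_upwards [ENNReal.tendsto_nhds_zero.1 (tendsto_moll_of_continuous hb hb1 hc hc2 hk hks)
    (ε / 20) (pos_iff_ne_zero.2 hδ)] with n hn
  have e : moll (b n) (c n) F - F
      = (moll (b n) (c n) (F - k) + (moll (b n) (c n) k - k)) - (F - k) := by
    ext x
    simp only [Pi.sub_apply, Pi.add_apply, moll_sub _ _ hFl hk.locallyIntegrable]
    ring
  have m1 := (contDiff_moll (b n) (c n)
    (hFl.sub hk.locallyIntegrable)).continuous.aestronglyMeasurable (μ := (volume : Measure E3))
  have m2 := ((contDiff_moll (b n) (c n)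
    hk.locallyIntegrable).continuous.sub hk).aestronglyMeasurable (μ := (volume : Measure E3))
  have m3 := (hF.sub hkm).1
  calc eLpNorm (moll (b n) (c n) F - F) 2 volume
      ≤ eLpNorm (moll (b n) (c n) (F - k) + (moll (b n) (c n) k - k)) 2 volume + eLpNorm (F - k) 2 volume := by
        rw [e]; exact eLpNorm_sub_le (m1.add m2) m3 (by norm_num)
    _ ≤ eLpNorm (moll (b n) (c n) (F - k)) 2 volume + eLpNorm (moll (b n) (c n) k - k) 2 volume
          + eLpNorm (F - k) 2 volume := by gcongr; exact eLpNorm_add_le m1 m2 (by norm_num)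
    _ ≤ 8 * (ε / 20) + ε / 20 + ε / 20 := by
        gcongr
        exact (eLpNorm_moll_le _ (hF.sub hkm) (hc2 n)).trans (by gcongr)
    _ ≤ 20 * (ε / 20) := by
        rw [← add_one_mul, ← add_one_mul]
        gcongr; norm_num
    _ = ε := ENNReal.mul_div_cancel (by norm_num) (by norm_num)

lemma tendsto_mul_moll {b : ℕ → ContDiffBump (0 : E3)} {c : ℕ → ℝ}
    (hb : Tendsto (fun n => (b n).rOut) atTop (𝓝 0)) (hb1 : ∀ n, (b n).rOut ≤ 1)
    (hc : Tendsto c atTop (𝓝 1)) (hc2 : ∀ n, 1 / 2 ≤ c n) {F : E3 → ℝ} (hF : MemLp F 2) :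
    Tendsto (fun n => eLpNorm (fun x => c n * moll (b n) (c n) F x - F x) 2) atTop (𝓝 0) := by
  have h1 := tendsto_moll hb hb1 hc hc2 hF
  have e : ∀ n, (fun x => c n * moll (b n) (c n) F x - F x)
      = c n • (moll (b n) (c n) F - F) + (c n - 1) • F := fun n => by
    ext x; simp; ring
  have h2 : Tendsto (fun n => ‖c n‖ₑ * eLpNorm (moll (b n) (c n) F - F) 2
      + ‖c n - 1‖ₑ * eLpNorm F 2) atTop (𝓝 (‖(1 : ℝ)‖ₑ * 0 + ‖(1 : ℝ) - 1‖ₑ * eLpNorm F 2)) := by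
    refine (ENNReal.Tendsto.mul hc.enorm (by simp) h1 (by simp)).add
      (ENNReal.Tendsto.mul_const (hc.sub_const 1).enorm (Or.inr hF.2.ne))
  rw [sub_self, enorm_zero, zero_mul, mul_zero, add_zero] at h2
  refine tendsto_of_tendsto_of_tendsto_of_le_of_le tendsto_const_nhds h2 (fun _ => zero_le)
    fun n => ?_
  rw [e n]
  have m := (contDiff_moll (b n) (c n)
    (hF.locallyIntegrable (by norm_num))).continuous.aestronglyMeasurable
      (μ := (volume : Measure E3))
  refine (eLpNorm_add_le ((m.sub hF.1).const_smul _) (hF.1.const_smul _) (by norm_num)).trans ?_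
  rw [eLpNorm_const_smul, eLpNorm_const_smul]

/-- Integration by parts is required only against functions supported in the ball seen by the kernel
at `c • x`. A weak derivative known in `Π` alone therefore suffices whenever that ball lies in `Π`.
The factor `c` is the chain rule for the dilation. -/
lemma pd_moll (b : ContDiffBump (0 : E3)) (c : ℝ) {F G : E3 → ℝ} (hF : LocallyIntegrable F)
    (i : Fin 3) (x : E3)
    (h : ∀ φ : E3 → ℝ, ContDiff ℝ ∞ φ → HasCompactSupport φ →
      tsupport φ ⊆ Metric.closedBall (c • x) b.rOut → ∫ t, F t * pd i φ t = -∫ t, G t * φ t) :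
    pd i (moll b c F) x = c * moll b c G x := by
  have hη : ContDiff ℝ ∞ (b.normed volume) := b.contDiff_normed (n := ⊤)
  have hs := b.hasCompactSupport_normed (μ := volume)
  have h1 := hs.hasFDerivAt_convolution_right (ContinuousLinearMap.mul ℝ ℝ) hF
    (hη.of_le (by simp)) (c • x)
  have h2 := h1.comp x ((hasFDerivAt_id x).const_smul c)
  have h3 : pd i (moll b c F) x
      = c * ∫ t, F t * pd i (b.normed volume) (c • x - t) := by
    have : moll b c F = (convolution F (b.normed volume) (ContinuousLinearMap.mul ℝ ℝ) volume)
      ∘ (c • id) := rfl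
    have h5 : fderiv ℝ (convolution F (b.normed volume) (ContinuousLinearMap.mul ℝ ℝ) volume
      ∘ (c • id)) x = _ := h2.fderiv
    rw [pd, this, h5]
    simp only [ContinuousLinearMap.comp_apply, ContinuousLinearMap.id_apply, smul_apply, map_smul, smul_eq_mul]
    congr 1
    rw [convolution_precompR_apply _ hF (hs.fderiv ℝ) (hη.continuous_fderiv (by simp))]
    rfl
  have h4 : ∀ t, pd i (fun s => b.normed volume (c • x - s)) t
      = -pd i (b.normed volume) (c • x - t) := fun t => by
    have := ((hη.differentiable (by simp)) (c • x - t)).hasFDerivAt.comp t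
      ((hasFDerivAt_id t).const_sub (c • x))
    have h5 : fderiv ℝ (fun s => b.normed volume (c • x - s)) t = _ := this.fderiv
    simp only [pd]
    rw [h5]
    simp
  have h6 := h (fun s => b.normed volume (c • x - s)) (hη.comp (contDiff_const.sub contDiff_id))
    (hs.comp_homeomorph (Homeomorph.subLeft (c • x))) (by
      refine closure_minimal (fun s hs => ?_) Metric.isClosed_closedBall
      have : c • x - s ∈ Metric.ball (0 : E3) b.rOut := by
        rw [← b.support_normed_eq (μ := volume)]; exact hs
      rw [mem_ball_zero_iff] at this
      rw [mem_closedBall_iff_norm']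
      exact this.le)
  simp_rw [h4, mul_neg, integral_neg, neg_inj] at h6
  rw [h3, h6]
  rfl

/-! ### Truncation at infinity -/

/-- A smooth function equal to `1` on the ball of radius `m + 1`, supported in the ball of radius
`2 (m + 1)`. -/
noncomputable def cutoff (m : ℕ) (x : E3) : ℝ :=
  (⟨1, 2, one_pos, one_lt_two⟩ : ContDiffBump (0 : E3)) ((m + 1 : ℝ)⁻¹ • x)

lemma contDiff_cutoff (m : ℕ) : ContDiff ℝ ∞ (cutoff m) :=
  (ContDiffBump.contDiff _).comp (contDiff_const_smul _)

lemma cutoff_eq_zero {m : ℕ} {x : E3} (h : 2 * (m + 1 : ℝ) ≤ ‖x‖) : cutoff m x = 0 := by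
  refine ContDiffBump.zero_of_le_dist _ ?_
  have : (0 : ℝ) < m + 1 := by positivity
  rw [dist_zero_right, norm_smul, norm_inv, Real.norm_of_nonneg this.le]
  show (2 : ℝ) ≤ _
  rwa [← div_eq_inv_mul, le_div_iff₀ this]

lemma hasCompactSupport_cutoff (m : ℕ) : HasCompactSupport (cutoff m) :=
  HasCompactSupport.intro (isCompact_closedBall (0 : E3) (2 * (m + 1 : ℝ))) fun x hx =>
    cutoff_eq_zero (by simpa using (not_le.1 (by simpa using hx)).le)

lemma abs_cutoff_le (m : ℕ) (x : E3) : |cutoff m x| ≤ 1 := by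
  rw [abs_of_nonneg (show 0 ≤ cutoff m x from ContDiffBump.nonneg _)]
  exact ContDiffBump.le_one _

lemma tendsto_inv_nat_smul (x : E3) :
    Tendsto (fun m : ℕ => (m + 1 : ℝ)⁻¹ • x) atTop (𝓝 0) := by
  have := (tendsto_one_div_add_atTop_nhds_zero_nat (𝕜 := ℝ)).smul_const x
  simpa using this

lemma tendsto_cutoff (x : E3) : Tendsto (fun m => cutoff m x) atTop (𝓝 1) := by
  refine tendsto_const_nhds.congr' ?_
  filter_upwards [(tendsto_inv_nat_smul x).eventually (Metric.ball_mem_nhds 0 one_pos)] with m hm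
  exact (ContDiffBump.one_of_mem_closedBall _ (Metric.ball_subset_closedBall hm)).symm

/-- By scaling, the derivatives decay like `1/(m + 1)`, so the commutator of truncation and
differentiation disappears in the limit. -/
lemma exists_abs_pd_cutoff_le (i : Fin 3) :
    ∃ C, ∀ m x, |pd i (cutoff m) x| ≤ (m + 1 : ℝ)⁻¹ * C := by
  set b : ContDiffBump (0 : E3) := ⟨1, 2, one_pos, one_lt_two⟩
  have hb : ContDiff ℝ ∞ b := b.contDiff
  obtain ⟨C, hC⟩ := (contDiff_pd i hb).continuous.bounded_above_of_compact_support
    (hasCompactSupport_pd i b.hasCompactSupport)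
  refine ⟨C, fun m x => ?_⟩
  have h := ((hb.differentiable (by simp)) ((m + 1 : ℝ)⁻¹ • x)).hasFDerivAt.comp x
    ((hasFDerivAt_id x).const_smul (m + 1 : ℝ)⁻¹)
  have h1 : fderiv ℝ (cutoff m) x = _ := h.fderiv
  have h2 : pd i (cutoff m) x = (m + 1 : ℝ)⁻¹ * pd i b ((m + 1 : ℝ)⁻¹ • x) := by
    rw [pd, h1]; simp [pd]
  rw [h2, abs_mul, abs_of_nonneg (by positivity)]
  gcongr
  exact hC _

lemma eLpNorm_cutoff_sub {f : E3 → ℝ} (hf : MemLp f 2 μC) :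
    Tendsto (fun m => nrm 2 fun x => f x - cutoff m x * f x) atTop (𝓝 0) := by
  refine tendsto_eLpNorm_two_of_dominated (h := fun x => 2 * |f x|)
    (fun m => hf.1.sub ((contDiff_cutoff m).continuous.aestronglyMeasurable.mul hf.1))
    (hf.abs.const_mul 2) (fun m => .of_forall fun x => ?_) (.of_forall fun x => ?_)
  · have := abs_mul_le_of_le (abs_cutoff_le m x) (le_refl |f x|)
    exact (abs_sub _ _).trans (by linarith)
  · simpa using ((tendsto_cutoff x).mul_const (f x)).const_sub (f x)

lemma eLpNorm_pd_cutoff_mul (i : Fin 3) {f : E3 → ℝ} (hf : MemLp f 2 μC) :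
    Tendsto (fun m => nrm 2 fun x => pd i (cutoff m) x * f x) atTop (𝓝 0) := by
  obtain ⟨C, hC⟩ := exists_abs_pd_cutoff_le i
  have hC0 : 0 ≤ C := by simpa using (abs_nonneg _).trans (hC 0 0)
  refine tendsto_eLpNorm_two_of_dominated (h := fun x => C * |f x|)
    (fun m => (contDiff_pd i (contDiff_cutoff m)).continuous.aestronglyMeasurable.mul hf.1)
    (hf.abs.const_mul C) (fun m => .of_forall fun x => ?_) (.of_forall fun x => ?_)
  · refine abs_mul_le_of_le ((hC m x).trans ?_) le_rfl
    have : (m + 1 : ℝ)⁻¹ ≤ 1 := inv_le_one_of_one_le₀ (by linarith [m.cast_nonneg (α := ℝ)])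
    nlinarith
  · have h1 : Tendsto (fun m : ℕ => (m + 1 : ℝ)⁻¹ * C) atTop (𝓝 0) := by
      simpa using (tendsto_one_div_add_atTop_nhds_zero_nat (𝕜 := ℝ)).mul_const C
    have h2 := squeeze_zero_norm (f := fun m => pd i (cutoff m) x) (fun m => hC m x) h1
    simpa using h2.mul_const (f x)

lemma tendsto_nrm_add {f g : ℕ → E3 → ℝ} (hf : ∀ n, AEStronglyMeasurable (f n) μC)
    (hg : ∀ n, AEStronglyMeasurable (g n) μC)
    (h1 : Tendsto (fun n => nrm 2 (f n)) atTop (𝓝 0))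
    (h2 : Tendsto (fun n => nrm 2 (g n)) atTop (𝓝 0)) :
    Tendsto (fun n => nrm 2 fun x => f n x + g n x) atTop (𝓝 0) :=
  tendsto_of_tendsto_of_tendsto_of_le_of_le tendsto_const_nhds (by simpa [nrm] using h1.add h2)
    (fun _ => zero_le) fun n => eLpNorm_add_le (hf n) (hg n) (by norm_num)

lemma eLpNorm_cutoff_deriv_sub (i : Fin 3) {f g : E3 → ℝ} (hf : MemLp f 2 μC)
    (hg : MemLp g 2 μC) :
    Tendsto (fun m => nrm 2 fun x => g x - (cutoff m x * g x + pd i (cutoff m) x * f x))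
      atTop (𝓝 0) := by
  have e : ∀ m, (fun x => g x - (cutoff m x * g x + pd i (cutoff m) x * f x))
    = fun x => (g x - cutoff m x * g x) + -(pd i (cutoff m) x * f x) := fun m => by
      ext x; ring
  simp_rw [e]
  refine tendsto_nrm_add
    (fun m => hg.1.sub ((contDiff_cutoff m).continuous.aestronglyMeasurable.mul hg.1))
    (fun m => ((contDiff_pd i
      (contDiff_cutoff m)).continuous.aestronglyMeasurable.mul hf.1).neg)
    (eLpNorm_cutoff_sub hg) ?_
  have h := eLpNorm_pd_cutoff_mul i hf
  refine h.congr fun m => ?_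
  exact (eLpNorm_neg (fun x => pd i (cutoff m) x * f x) 2 μC).symm

/-! ### Functions with vanishing trace -/

/-- `g` is the weak derivative `∂_i f` on all of `ℝ³` once `f` and `g` are extended by zero. -/
def HasZeroExtPartial (i : Fin 3) (f g : E3 → ℝ) : Prop :=
  ∀ φ : E3 → ℝ, ContDiff ℝ ∞ φ → HasCompactSupport φ →
    ∫ x, f x * pd i φ x ∂μC = -∫ x, g x * φ x ∂μC

lemma HasZeroExtPartial.hasWeakPartial {i : Fin 3} {f g : E3 → ℝ} (hf : MemLp f 2 μC)
    (hg : MemLp g 2 μC) (h : HasZeroExtPartial i f g) : HasWeakPartial i f g :=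
  .of_memLp hf hg fun φ hφ => h φ hφ.1 hφ.2.1

lemma memLp_of_contDiff {φ : E3 → ℝ} (h : ContDiff ℝ ∞ φ) (hs : HasCompactSupport φ)
    (p : ℝ≥0∞) : MemLp φ p μC :=
  (h.continuous.memLp_of_hasCompactSupport hs).mono_measure Measure.restrict_le_self

lemma integrable_mul_of_memLp {f g : E3 → ℝ} (hf : MemLp f 2 μC) (hg : MemLp g 2 μC) :
    Integrable (fun x => f x * g x) μC := hf.integrable_mul hg

lemma HasZeroExtPartial.smooth_mul {i : Fin 3} {f g a : E3 → ℝ} (ha : ContDiff ℝ ∞ a)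
    (hf : MemLp f 2 μC) (hg : MemLp g 2 μC) (h : HasZeroExtPartial i f g) :
    HasZeroExtPartial i (fun x => a x * f x) (fun x => a x * g x + pd i a x * f x) := by
  intro φ hφ hs
  have key := h _ (ha.mul hφ) hs.mul_left
  have hI : ∀ {f b ψ : E3 → ℝ}, MemLp f 2 μC → ContDiff ℝ ∞ b → ContDiff ℝ ∞ ψ →
      HasCompactSupport ψ → Integrable (fun x => f x * (b x * ψ x)) μC :=
    fun hf hb hψ hs => integrable_mul_of_memLp hf (memLp_of_contDiff (hb.mul hψ) hs.mul_left 2)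
  have e1 : ∀ x, f x * pd i (fun y => a y * φ y) x
      = f x * (a x * pd i φ x) + f x * (pd i a x * φ x) := fun x => by
    rw [pd_mul i (ha.differentiable (by simp) x) (hφ.differentiable (by simp) x)]
    ring
  have i2 := hI hf (contDiff_pd i ha) hφ hs
  simp_rw [e1] at key
  rw [integral_add (hI hf ha (contDiff_pd i hφ) (hasCompactSupport_pd i hs)) i2] at key
  have e2 : ∀ x, (a x * g x + pd i a x * f x) * φ x
    = g x * (a x * φ x) + f x * (pd i a x * φ x) := fun x => by ring
  simp_rw [e2]
  rw [integral_add (hI hg ha hφ hs) i2]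
  have e3 : ∀ x, a x * f x * pd i φ x = f x * (a x * pd i φ x) := fun x => by ring
  simp_rw [e3]
  linarith

lemma abs_integral_mul_le {f g : E3 → ℝ} (hf : MemLp f 2 μC) (hg : MemLp g 2 μC) :
    ENNReal.ofReal |∫ x, f x * g x ∂μC| ≤ nrm 2 f * nrm 2 g := by
  have h1 : ENNReal.ofReal |∫ x, f x * g x ∂μC| ≤ ∫⁻ x, ‖f x * g x‖ₑ ∂μC := by
    rw [← Real.norm_eq_abs, ofReal_norm]
    exact enorm_integral_le_lintegral_enorm _
  refine h1.trans ?_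
  rw [← eLpNorm_one_eq_lintegral_enorm]
  have := eLpNorm_le_eLpNorm_mul_eLpNorm_of_nnnorm (p := 2) (q := 2) (r := 1) hf.1 hg.1
    (fun a b => a * b) 1 (.of_forall fun x => by simp)
  simpa [nrm] using this

lemma tendsto_integral_mul {f : E3 → ℝ} {φ : ℕ → E3 → ℝ} {g : E3 → ℝ} (hf : MemLp f 2 μC)
    (hφ : ∀ n, MemLp (φ n) 2 μC) (hg : MemLp g 2 μC)
    (h : Tendsto (fun n => nrm 2 fun x => f x - φ n x) atTop (𝓝 0)) :
    Tendsto (fun n => ∫ x, φ n x * g x ∂μC) atTop (𝓝 (∫ x, f x * g x ∂μC)) := by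
  have h1 : Tendsto (fun n => (nrm 2 fun x => f x - φ n x) * nrm 2 g) atTop (𝓝 0) := by
    simpa using ENNReal.Tendsto.mul_const h (Or.inr hg.2.ne) (b := nrm 2 g)
  rw [tendsto_iff_dist_tendsto_zero]
  have h2 := (ENNReal.tendsto_toReal ENNReal.zero_ne_top).comp h1
  refine squeeze_zero (fun _ => dist_nonneg) (fun n => ?_) h2
  rw [dist_comm, Real.dist_eq, ← integral_sub (integrable_mul_of_memLp hf hg)
    (integrable_mul_of_memLp (hφ n) hg)]
  simp_rw [← sub_mul]
  have h3 := abs_integral_mul_le (hf.sub (hφ n)) hg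
  refine (ENNReal.ofReal_le_iff_le_toReal ?_).1 h3
  exact ENNReal.mul_ne_top (hf.sub (hφ n)).2.ne hg.2.ne

/-- The functions tested against need not vanish on the boundary of `Π`. Integration by parts is
exact for the compactly supported approximants of `f` and passes to the limit in `L²`. -/
lemma MemH10.hasZeroExtPartial {f : E3 → ℝ} (h : MemH10 f) (i : Fin 3) :
    HasZeroExtPartial i f (wpd i f) := by
  obtain ⟨hf, φ, hφ, h0, h1⟩ := h
  intro ψ hψ hs
  have l1 := tendsto_integral_mul hf.1 (fun n => (hφ n).memLp 2)
    (memLp_of_contDiff (contDiff_pd i hψ) (hasCompactSupport_pd i hs) 2) h0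
  have l2 := tendsto_integral_mul (hf.memLp_wpd i) (fun n => ((hφ n).pd i).memLp 2)
    (memLp_of_contDiff hψ hs 2) (h1 i)
  refine tendsto_nhds_unique l1 (l2.neg.congr fun n => ?_)
  have e1 : ∀ a b : E3 → ℝ, IsTest a → ∫ x, a x * b x ∂μC = ∫ x, a x * b x := fun a b ha => by
    simpa [mul_comm] using setIntegral_mul_test (f := b) ha
  rw [e1 _ _ ((hφ n).pd i), e1 _ _ (hφ n), integral_pd_mul i (hφ n).1 hψ hs]

/-! ### Approximation by smooth functions -/

lemma rad_eq_norm (x : E3) : rad x = ‖(!₂[x 0, x 1] : EuclideanSpace ℝ (Fin 2))‖ := by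
  rw [EuclideanSpace.norm_eq, rad]
  simp

/-- The distance to the axis is 1-Lipschitz, being the norm of an orthogonal projection. This
controls on which side of the boundary a mollification ball lies. -/
lemma rad_le_add (x y : E3) : rad x ≤ rad y + ‖y - x‖ := by
  have h1 : rad (x - y) ≤ ‖x - y‖ := by
    rw [EuclideanSpace.norm_eq, rad]
    refine Real.sqrt_le_sqrt ?_
    simp only [Fin.sum_univ_three, Real.norm_eq_abs, sq_abs]
    nlinarith [sq_nonneg ((x - y) 2)]
  have h2 : rad x ≤ rad y + rad (x - y) := by
    simp only [rad_eq_norm]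
    refine le_of_eq_of_le ?_ (norm_add_le _ _)
    congr 1
    ext i
    fin_cases i <;> simp
  rw [norm_sub_rev]
  linarith

lemma rad_smul {c : ℝ} (hc : 0 ≤ c) (x : E3) : rad (c • x) = c * rad x := by
  rw [rad, rad, ← Real.sqrt_sq hc, ← Real.sqrt_mul (sq_nonneg c), Real.sqrt_sq hc]
  congr 1
  simp
  ring

/-- A bump function with outer radius `1 / (n + 4)`. -/
noncomputable def shrinkingBump (n : ℕ) : ContDiffBump (0 : E3) :=
  ⟨1 / (2 * (n + 4)), 1 / (n + 4), by positivity, by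
    have : (0 : ℝ) < n + 4 := by positivity
    exact one_div_lt_one_div_of_lt this (by linarith)⟩

lemma shrinkingBump_rOut (n : ℕ) : (shrinkingBump n).rOut = 1 / (n + 4) := rfl

lemma tendsto_one_div_add_four : Tendsto (fun n : ℕ => 1 / (n + 4 : ℝ)) atTop (𝓝 0) := by
  have := (tendsto_add_atTop_iff_nat (f := fun n : ℕ => 1 / ((n : ℝ) + 1)) 3).2
    tendsto_one_div_add_atTop_nhds_zero_nat
  refine this.congr fun n => ?_
  push_cast
  ring

lemma one_div_add_four_le (n : ℕ) : 1 / (n + 4 : ℝ) ≤ 1 / 4 :=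
  one_div_le_one_div_of_le (by norm_num) (by linarith [n.cast_nonneg (α := ℝ)])

lemma one_div_add_four_pos (n : ℕ) : 0 < 1 / (n + 4 : ℝ) := by positivity

lemma hasCompactSupport_moll (b : ContDiffBump (0 : E3)) {c : ℝ} (hc : c ≠ 0) {F : E3 → ℝ}
    (hF : HasCompactSupport F) : HasCompactSupport (moll b c F) := by
  have h := HasCompactSupport.convolution (L := ContinuousLinearMap.mul ℝ ℝ) (μ := volume)
    hF (b.hasCompactSupport_normed (μ := volume))
  exact h.comp_homeomorph (Homeomorph.smulOfNeZero c hc)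

lemma moll_eq_zero (b : ContDiffBump (0 : E3)) {c : ℝ} (hc : 0 ≤ c) {f : E3 → ℝ} {x : E3}
    (hx : c * rad x < 1 - b.rOut) : moll b c (Cyl.indicator f) x = 0 := by
  rw [moll]
  refine integral_eq_zero_of_ae (.of_forall fun t => ?_)
  by_cases ht : t ∈ Cyl
  · have h0 : b.normed volume (c • x - t) = 0 := by
      rw [← Function.notMem_support, b.support_normed_eq, mem_ball_zero_iff, not_lt]
      have := rad_le_add t (c • x)
      rw [rad_smul hc] at this
      have := one_lt_rad ht
      linarith
    simp [h0]
  · simp [ht]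

lemma memLp_indicator_Cyl {f : E3 → ℝ} (hf : MemLp f 2 μC) :
    MemLp (Cyl.indicator f) 2 volume := (memLp_indicator_iff_restrict measurableSet_Cyl).2 hf

lemma integral_indicator_mul (f φ : E3 → ℝ) :
    ∫ x, Cyl.indicator f x * φ x = ∫ x, f x * φ x ∂μC := by
  rw [μC, ← integral_indicator measurableSet_Cyl]
  congr 1 with x
  by_cases hx : x ∈ Cyl <;> simp [hx]

lemma nrm_sub_le_eLpNorm_indicator (f G : E3 → ℝ) :
    nrm 2 (fun x => f x - G x) ≤ eLpNorm (fun x => G x - Cyl.indicator f x) 2 volume := by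
  refine le_trans (le_of_eq ?_)
    (eLpNorm_mono_measure _ (Measure.restrict_le_self (s := Cyl)))
  rw [nrm, μC, ← eLpNorm_neg]
  refine eLpNorm_congr_ae ?_
  filter_upwards [ae_restrict_mem measurableSet_Cyl] with x hx
  simp [hx]

lemma exists_contDiff_approx_of_bounded {f : E3 → ℝ} {g : Fin 3 → E3 → ℝ} (hf : MemLp f 2 μC)
    (hg : ∀ i, MemLp (g i) 2 μC) (h : ∀ i, HasWeakPartial i f (g i)) (hs : HasCompactSupport f) :
    ∃ φ : ℕ → E3 → ℝ, (∀ n, ContDiff ℝ ∞ (φ n) ∧ HasCompactSupport (φ n)) ∧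
      Tendsto (fun n => nrm 2 fun x => f x - φ n x) atTop (𝓝 0) ∧
      ∀ i, Tendsto (fun n => nrm 2 fun x => g i x - pd i (φ n) x) atTop (𝓝 0) := by
  -- Dilating outwards by twice the kernel radius `1/(n + 4)`: for `x` in `Π`, the ball of that
  -- radius about `c n • x` stays in `Π`, so weak derivatives in `Π` can be mollified.
  set c : ℕ → ℝ := fun n => 1 + 2 * (1 / (n + 4))
  have hc : Tendsto c atTop (𝓝 1) := by
    simpa [c] using (tendsto_one_div_add_four.const_mul 2).const_add 1
  have hc1 : ∀ n, 1 ≤ c n := fun n => by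
    have := one_div_add_four_pos n
    simp only [c]; linarith
  have hc2 : ∀ n, 1 / 2 ≤ c n := fun n => by linarith [hc1 n]
  have hb : Tendsto (fun n => (shrinkingBump n).rOut) atTop (𝓝 0) := tendsto_one_div_add_four
  have hb1 : ∀ n, (shrinkingBump n).rOut ≤ 1 := fun n => by
    rw [shrinkingBump_rOut]; linarith [one_div_add_four_le n]
  have hF := memLp_indicator_Cyl hf
  have hFl := hF.locallyIntegrable (by norm_num)
  have hpd : ∀ n i, ∀ x ∈ Cyl, pd i (moll (shrinkingBump n) (c n) (Cyl.indicator f)) x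
      = c n * moll (shrinkingBump n) (c n) (Cyl.indicator (g i)) x := fun n i x hx => by
    refine pd_moll _ _ hFl i x fun φ h1 h2 h3 => ?_
    rw [integral_indicator_mul, integral_indicator_mul]
    refine (h i).2.2 φ ⟨h1, h2, fun t ht => ?_⟩
    have h4 := h3 ht
    rw [mem_closedBall_iff_norm, shrinkingBump_rOut] at h4
    have h5 := rad_le_add (c n • x) t
    rw [rad_smul (by linarith [hc1 n])] at h5
    have h6 : c n * 1 ≤ c n * rad x :=
      mul_le_mul_of_nonneg_left (one_lt_rad hx).le (by linarith [hc1 n])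
    show 1 < rad t
    have h7 : c n = 1 + 2 * (1 / (n + 4)) := rfl
    have := one_div_add_four_pos n
    linarith
  refine ⟨fun n => moll (shrinkingBump n) (c n) (Cyl.indicator f), fun n =>
    ⟨contDiff_moll _ _ hFl, hasCompactSupport_moll _ (by linarith [hc1 n]) ?_⟩, ?_, fun i => ?_⟩
  · exact hs.mono (by rw [Set.support_indicator]; exact Set.inter_subset_right)
  · exact tendsto_of_tendsto_of_tendsto_of_le_of_le tendsto_const_nhds
      (tendsto_moll hb hb1 hc hc2 hF) (fun _ => zero_le) fun n => nrm_sub_le_eLpNorm_indicator _ _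
  · refine tendsto_of_tendsto_of_tendsto_of_le_of_le tendsto_const_nhds
      (tendsto_mul_moll hb hb1 hc hc2 (memLp_indicator_Cyl (hg i))) (fun _ => zero_le) fun n => ?_
    refine le_trans (le_of_eq (eLpNorm_congr_ae ?_)) (nrm_sub_le_eLpNorm_indicator _ _)
    filter_upwards [ae_mem_Cyl] with x hx
    rw [hpd n i x hx]

lemma exists_isTest_approx_of_bounded {f : E3 → ℝ} {g : Fin 3 → E3 → ℝ} (hf : MemLp f 2 μC)
    (hg : ∀ i, MemLp (g i) 2 μC) (h : ∀ i, HasZeroExtPartial i f (g i))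
    (hs : HasCompactSupport f) :
    ∃ φ : ℕ → E3 → ℝ, (∀ n, IsTest (φ n)) ∧
      Tendsto (fun n => nrm 2 fun x => f x - φ n x) atTop (𝓝 0) ∧
      ∀ i, Tendsto (fun n => nrm 2 fun x => g i x - pd i (φ n) x) atTop (𝓝 0) := by
  -- Now the dilation goes the other way: the mollified function lives where `c n * rad x ≥ 1 - 1/(n
  -- + 4)`, which forces `rad x > 1`. Its support is thus pushed into `Π`, while the derivative
  -- identity is available everywhere.
  set c : ℕ → ℝ := fun n => 1 - 2 * (1 / (n + 4))
  have hc : Tendsto c atTop (𝓝 1) := by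
    simpa [c] using (tendsto_one_div_add_four.const_mul 2).const_sub 1
  have hc2 : ∀ n, 1 / 2 ≤ c n := fun n => by
    have := one_div_add_four_le n
    simp only [c]; linarith
  have hb : Tendsto (fun n => (shrinkingBump n).rOut) atTop (𝓝 0) := tendsto_one_div_add_four
  have hb1 : ∀ n, (shrinkingBump n).rOut ≤ 1 := fun n => by
    rw [shrinkingBump_rOut]; linarith [one_div_add_four_le n]
  have hF := memLp_indicator_Cyl hf
  have hFl := hF.locallyIntegrable (by norm_num)
  have hpd : ∀ n i x, pd i (moll (shrinkingBump n) (c n) (Cyl.indicator f)) x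
      = c n * moll (shrinkingBump n) (c n) (Cyl.indicator (g i)) x := fun n i x => by
    refine pd_moll _ _ hFl i x fun φ h1 h2 h3 => ?_
    rw [integral_indicator_mul, integral_indicator_mul]
    exact h i φ h1 h2
  refine ⟨fun n => moll (shrinkingBump n) (c n) (Cyl.indicator f), fun n =>
    ⟨contDiff_moll _ _ hFl, hasCompactSupport_moll _ (by linarith [hc2 n]) ?_, ?_⟩, ?_, fun i => ?_⟩
  · exact hs.mono (by rw [Set.support_indicator]; exact Set.inter_subset_right)
  · have hcl : IsClosed {x | 1 - (shrinkingBump n).rOut ≤ c n * rad x} :=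
      isClosed_le continuous_const (continuous_const.mul continuous_rad)
    refine (closure_minimal (fun x hx => ?_) hcl).trans fun x hx => ?_
    · by_contra hlt
      exact hx (moll_eq_zero _ (by linarith [hc2 n]) (not_le.1 hlt))
    · have hx' : 1 - 1 / (n + 4 : ℝ) ≤ c n * rad x := hx
      show 1 < rad x
      have h7 : c n = 1 - 2 * (1 / (n + 4)) := rfl
      have h8 := one_div_add_four_pos n
      by_contra hlt
      have : c n * rad x ≤ c n * 1 :=
        mul_le_mul_of_nonneg_left (not_lt.1 hlt) (by linarith [hc2 n])
      linarith
  · exact tendsto_of_tendsto_of_tendsto_of_le_of_le tendsto_const_nhds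
      (tendsto_moll hb hb1 hc hc2 hF) (fun _ => zero_le) fun n => nrm_sub_le_eLpNorm_indicator _ _
  · refine tendsto_of_tendsto_of_tendsto_of_le_of_le tendsto_const_nhds
      (tendsto_mul_moll hb hb1 hc hc2 (memLp_indicator_Cyl (hg i))) (fun _ => zero_le) fun n => ?_
    simp_rw [hpd]
    exact nrm_sub_le_eLpNorm_indicator _ _

/-- Sequential `H¹` closures are closed: a function that is a limit of limits of `P`-functions is
itself a limit of `P`-functions. -/
lemma exists_diagonal_approx {P : (E3 → ℝ) → Prop} (hP : ∀ φ, P φ → ContDiff ℝ ∞ φ)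
    {f : E3 → ℝ} {g : Fin 3 → E3 → ℝ}
    (hf : AEStronglyMeasurable f μC) (hg : ∀ i, AEStronglyMeasurable (g i) μC)
    {F : ℕ → E3 → ℝ} {G : ℕ → Fin 3 → E3 → ℝ} (hF : ∀ m, AEStronglyMeasurable (F m) μC)
    (hG : ∀ m i, AEStronglyMeasurable (G m i) μC)
    (h0 : Tendsto (fun m => nrm 2 fun x => f x - F m x) atTop (𝓝 0))
    (h1 : ∀ i, Tendsto (fun m => nrm 2 fun x => g i x - G m i x) atTop (𝓝 0))
    (h : ∀ m, ∃ φ : ℕ → E3 → ℝ, (∀ n, P (φ n)) ∧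
      Tendsto (fun n => nrm 2 fun x => F m x - φ n x) atTop (𝓝 0) ∧
      ∀ i, Tendsto (fun n => nrm 2 fun x => G m i x - pd i (φ n) x) atTop (𝓝 0)) :
    ∃ φ : ℕ → E3 → ℝ, (∀ n, P (φ n)) ∧
      Tendsto (fun n => nrm 2 fun x => f x - φ n x) atTop (𝓝 0) ∧
      ∀ i, Tendsto (fun n => nrm 2 fun x => g i x - pd i (φ n) x) atTop (𝓝 0) := by
  have key : ∀ m : ℕ, ∃ φ, P φ ∧ nrm 2 (fun x => F m x - φ x) ≤ (m : ℝ≥0∞)⁻¹ ∧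
      ∀ i, nrm 2 (fun x => G m i x - pd i φ x) ≤ (m : ℝ≥0∞)⁻¹ := fun m => by
    obtain ⟨φ, hφ, a0, a1⟩ := h m
    -- For `m = 0` the inverse is `⊤`, so the tolerance is positive for every `m`.
    have hm : (0 : ℝ≥0∞) < (m : ℝ≥0∞)⁻¹ := ENNReal.inv_pos.2 (ENNReal.natCast_ne_top m)
    obtain ⟨n, hn0, hn1⟩ := ((ENNReal.tendsto_nhds_zero.1 a0 _ hm).and
      (eventually_all.2 fun i => ENNReal.tendsto_nhds_zero.1 (a1 i) _ hm)).exists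
    exact ⟨φ n, hφ n, hn0, hn1⟩
  choose φ hφ hφ0 hφ1 using key
  have comb : ∀ {a : E3 → ℝ} {A B : ℕ → E3 → ℝ}, AEStronglyMeasurable a μC →
      (∀ m, AEStronglyMeasurable (A m) μC) → (∀ m, AEStronglyMeasurable (B m) μC) →
      Tendsto (fun m => nrm 2 fun x => a x - A m x) atTop (𝓝 0) →
      (∀ m, nrm 2 (fun x => A m x - B m x) ≤ (m : ℝ≥0∞)⁻¹) →
      Tendsto (fun m => nrm 2 fun x => a x - B m x) atTop (𝓝 0) := by
    intro a A B ha hA hB h2 h3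
    have h4 := tendsto_nrm_add (fun m => ha.sub (hA m)) (fun m => (hA m).sub (hB m)) h2
      (tendsto_of_tendsto_of_tendsto_of_le_of_le tendsto_const_nhds
        ENNReal.tendsto_inv_nat_nhds_zero (fun _ => zero_le) h3)
    simpa using h4
  refine ⟨φ, hφ, comb hf hF (fun m => (hP _ (hφ m)).continuous.aestronglyMeasurable) h0 hφ0,
    fun i => comb (hg i) (fun m => hG m i)
      (fun m => (contDiff_pd i (hP _ (hφ m))).continuous.aestronglyMeasurable) (h1 i)
      fun m => hφ1 m i⟩

lemma memLp_cutoff_mul (m : ℕ) {f : E3 → ℝ} (hf : MemLp f 2 μC) :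
    MemLp (fun x => cutoff m x * f x) 2 μC :=
  memLp_bdd_mul (contDiff_cutoff m).continuous.continuousOn ⟨1, fun x _ => abs_cutoff_le m x⟩ hf

lemma memLp_cutoff_deriv (m : ℕ) (i : Fin 3) {f g : E3 → ℝ} (hf : MemLp f 2 μC)
    (hg : MemLp g 2 μC) : MemLp (fun x => cutoff m x * g x + pd i (cutoff m) x * f x) 2 μC := by
  obtain ⟨C, hC⟩ := exists_abs_pd_cutoff_le i
  exact (memLp_cutoff_mul m hg).add
    (memLp_bdd_mul (contDiff_pd i (contDiff_cutoff m)).continuous.continuousOn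
      ⟨_, fun x _ => hC m x⟩ hf)

/-- Restrictions of smooth compactly supported functions on `ℝ³` are dense in `H¹(Π)`. -/
theorem MemH1.exists_contDiff_approx {f : E3 → ℝ} (h : MemH1 f) :
    ∃ φ : ℕ → E3 → ℝ, (∀ n, ContDiff ℝ ∞ (φ n) ∧ HasCompactSupport (φ n)) ∧
      Tendsto (fun n => nrm 2 fun x => f x - φ n x) atTop (𝓝 0) ∧
      ∀ i, Tendsto (fun n => nrm 2 fun x => wpd i f x - pd i (φ n) x) atTop (𝓝 0) := by
  have hm := fun m => memLp_cutoff_mul m h.1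
  have hm' := fun m i => memLp_cutoff_deriv m i h.1 (h.memLp_wpd i)
  exact exists_diagonal_approx (P := fun φ => ContDiff ℝ ∞ φ ∧ HasCompactSupport φ)
    (fun _ h => h.1) h.1.1 (fun i => (h.memLp_wpd i).1) (fun m => (hm m).1)
    (fun m i => (hm' m i).1) (eLpNorm_cutoff_sub h.1)
    (fun i => eLpNorm_cutoff_deriv_sub i h.1 (h.memLp_wpd i)) fun m =>
    exists_contDiff_approx_of_bounded (hm m) (hm' m)
      (fun i => (h.hasWeakPartial i).smooth_mul (contDiff_cutoff m).contDiffOn)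
      (hasCompactSupport_cutoff m).mul_right

/-- A function whose extension by zero is in `H¹(ℝ³)` is in `H¹₀(Π)`. -/
theorem memH10_of_hasZeroExtPartial {f : E3 → ℝ} {g : Fin 3 → E3 → ℝ} (hf : MemLp f 2 μC)
    (hg : ∀ i, MemLp (g i) 2 μC) (h : ∀ i, HasZeroExtPartial i f (g i)) : MemH10 f := by
  have hw := fun i => (h i).hasWeakPartial hf (hg i)
  refine ⟨⟨hf, fun i => ⟨g i, hw i, hg i⟩⟩, ?_⟩
  have hm := fun m => memLp_cutoff_mul m hf
  have hm' := fun m i => memLp_cutoff_deriv m i hf (hg i)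
  obtain ⟨φ, h1, h2, h3⟩ := exists_diagonal_approx (P := IsTest) (fun _ h => h.1) hf.1
    (fun i => (hg i).1) (fun m => (hm m).1) (fun m i => (hm' m i).1) (eLpNorm_cutoff_sub hf)
    (fun i => eLpNorm_cutoff_deriv_sub i hf (hg i)) fun m =>
    exists_isTest_approx_of_bounded (hm m) (hm' m)
      (fun i => (h i).smooth_mul (contDiff_cutoff m) hf (hg i))
      (hasCompactSupport_cutoff m).mul_right
  refine ⟨φ, h1, h2, fun i => (h3 i).congr fun n => eLpNorm_congr_ae ?_⟩
  filter_upwards [(hw i).wpd_ae] with x hx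
  rw [hx]

/-! ### The Sobolev inequality on domains that contain an axis-parallel ray in each direction -/

/-- The fundamental theorem of calculus along the ray towards `+∞`, where `f` vanishes. -/
lemma enorm_le_lintegral_Ioi_deriv {f : ℝ → ℝ} (hf : ContDiff ℝ 1 f) (hs : HasCompactSupport f)
    (x : ℝ) : ‖f x‖ₑ ≤ ∫⁻ y in Set.Ioi x, ‖deriv f y‖ₑ := by
  rw [← enorm_neg, ← hs.integral_Ioi_deriv_eq hf x]
  exact enorm_integral_le_lintegral_enorm _

-- Gagliardo's argument. Along a ray inside `D` the value at `x` is bounded by the line integral of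
-- the derivative over that ray, in each of the three directions. Multiplying the square roots of
-- these bounds and applying the Loomis–Whitney type inequality `lintegral_prod_lintegral_pow_le`
-- gives the estimate. Boundary values of `u` on `D` play no role.
open Function in
theorem lintegral_pow_le_of_rays {D : Set (Fin 3 → ℝ)} (hD : MeasurableSet D)
    (hray : ∀ i, (∀ x ∈ D, ∀ t, x i ≤ t → update x i t ∈ D) ∨
      (∀ x ∈ D, ∀ t, t ≤ x i → update x i t ∈ D))
    {u : (Fin 3 → ℝ) → ℝ} (hu : ContDiff ℝ 1 u) (hs : HasCompactSupport u)
    {N : (Fin 3 → ℝ) → ℝ≥0∞} (hN : Measurable N)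
    (hb : ∀ x i, ‖fderiv ℝ u x (Pi.single i 1)‖ₑ ≤ N x) :
    ∫⁻ x in D, ‖u x‖ₑ ^ (3 / 2 : ℝ) ≤ (∫⁻ x in D, N x) ^ (3 / 2 : ℝ) := by
  have hp : Real.HolderConjugate (Fintype.card (Fin 3)) (3 / 2) := by
    rw [Real.holderConjugate_iff]; norm_num
  have key := lintegral_prod_lintegral_pow_le (fun _ : Fin 3 => (volume : Measure ℝ)) hp
    (hN.indicator hD)
  rw [← volume_pi, lintegral_indicator hD] at key
  refine le_trans ?_ key
  rw [← lintegral_indicator hD]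
  refine lintegral_mono fun x => ?_
  by_cases hx : x ∈ D
  · rw [Set.indicator_of_mem hx]
    have hline : ∀ i, ‖u x‖ₑ ≤ ∫⁻ t, D.indicator N (update x i t) := fun i => by
      have hc1 : ContDiff ℝ 1 (u ∘ update x i) := hu.comp (contDiff_update 1 x i)
      have hc2 : HasCompactSupport (u ∘ update x i) :=
        hs.comp_isClosedEmbedding (isClosedEmbedding_update x i)
      have hd : ∀ t, ‖deriv (u ∘ update x i) t‖ₑ ≤ N (update x i t) := fun t => by
        rw [fderiv_comp_deriv _ (hu.differentiable one_ne_zero).differentiableAt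
          (hasDerivAt_update x i t).differentiableAt, deriv_update]
        exact hb _ i
      have hfin : ∀ S : Set ℝ, MeasurableSet S → (∀ t ∈ S, update x i t ∈ D) →
          ∫⁻ t in S, ‖deriv (u ∘ update x i) t‖ₑ ≤ ∫⁻ t, D.indicator N (update x i t) :=
        fun S hS hSD => by
          refine (setLIntegral_mono' hS fun t ht => ?_).trans (setLIntegral_le_lintegral S _)
          rw [Set.indicator_of_mem (hSD t ht)]
          exact hd t
      have h0 : ‖u x‖ₑ = ‖(u ∘ update x i) (x i)‖ₑ := by simp
      rw [h0]
      rcases hray i with h | h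
      · exact (enorm_le_lintegral_Ioi_deriv hc1 hc2 _).trans
          (hfin _ measurableSet_Ioi fun t ht => h x hx t (le_of_lt ht))
      · exact (hc2.enorm_le_lintegral_Ici_deriv hc1 _).trans
          (hfin _ measurableSet_Iic fun t ht => h x hx t ht)
    calc ‖u x‖ₑ ^ (3 / 2 : ℝ) = ∏ _i : Fin 3, ‖u x‖ₑ ^ (1 / 2 : ℝ) := by
          rw [Finset.prod_const, ← ENNReal.rpow_natCast, ← ENNReal.rpow_mul]
          norm_num
      _ ≤ ∏ i : Fin 3, (∫⁻ t, D.indicator N (update x i t)) ^ (1 / 2 : ℝ) :=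
          Finset.prod_le_prod' fun i _ => by gcongr; exact hline i
      _ = _ := by norm_num
  · rw [Set.indicator_of_notMem hx]
    exact zero_le

/-! ### The Sobolev inequality on `Π` -/

/-- The classical gradient. -/
noncomputable def cgrad (φ : E3 → ℝ) (x : E3) : E3 := WithLp.toLp 2 fun i => pd i φ x

lemma continuous_cgrad {φ : E3 → ℝ} (hφ : ContDiff ℝ ∞ φ) : Continuous (cgrad φ) :=
  (PiLp.continuous_toLp 2 _).comp (continuous_pi fun i => (contDiff_pd i hφ).continuous)

/-- The intersection of `Π` with the quadrant `s₀ x₀ ≥ 0`, `s₁ x₁ ≥ 0`. -/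
def quadrant (s₀ s₁ : ℝ) : Set E3 := Cyl ∩ {x | 0 ≤ s₀ * x 0 ∧ 0 ≤ s₁ * x 1}

lemma measurableSet_quadrant (s₀ s₁ : ℝ) : MeasurableSet (quadrant s₀ s₁) := by
  refine measurableSet_Cyl.inter (IsClosed.measurableSet ?_)
  have h := fun j => (contDiff_coord j).continuous
  exact (isClosed_le continuous_const (continuous_const.mul (h 0))).inter
    (isClosed_le continuous_const (continuous_const.mul (h 1)))

lemma mem_Cyl_iff (x : E3) : x ∈ Cyl ↔ 1 < x 0 ^ 2 + x 1 ^ 2 := by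
  rw [← rad_sq]
  have h0 : 0 ≤ rad x := Real.sqrt_nonneg _
  show 1 < rad x ↔ _
  constructor
  · intro h; nlinarith
  · intro h; nlinarith

-- In a quadrant, moving a horizontal coordinate away from zero increases `|x_h|`, and moving
-- vertically leaves it unchanged.
open Function in
lemma quadrant_rays {s₀ s₁ : ℝ} (h₀ : s₀ = 1 ∨ s₀ = -1) (h₁ : s₁ = 1 ∨ s₁ = -1) (i : Fin 3) :
    (∀ x : Fin 3 → ℝ, WithLp.toLp 2 x ∈ quadrant s₀ s₁ → ∀ t, x i ≤ t →
      WithLp.toLp 2 (update x i t) ∈ quadrant s₀ s₁) ∨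
    (∀ x : Fin 3 → ℝ, WithLp.toLp 2 x ∈ quadrant s₀ s₁ → ∀ t, t ≤ x i →
      WithLp.toLp 2 (update x i t) ∈ quadrant s₀ s₁) := by
  simp only [quadrant, Set.mem_inter_iff, mem_Cyl_iff, Set.mem_ofPred_eq]
  fin_cases i
  · rcases h₀ with rfl | rfl
    · left
      rintro x ⟨h1, h2, h3⟩ t ht
      simp at h1 h2 h3 ht ⊢
      exact ⟨by nlinarith, by linarith, h3⟩
    · right
      rintro x ⟨h1, h2, h3⟩ t ht
      simp at h1 h2 h3 ht ⊢
      exact ⟨by nlinarith, by linarith, h3⟩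
  · rcases h₁ with rfl | rfl
    · left
      rintro x ⟨h1, h2, h3⟩ t ht
      simp at h1 h2 h3 ht ⊢
      exact ⟨by nlinarith, h2, by linarith⟩
    · right
      rintro x ⟨h1, h2, h3⟩ t ht
      simp at h1 h2 h3 ht ⊢
      exact ⟨by nlinarith, h2, by linarith⟩
  · left
    rintro x ⟨h1, h2, h3⟩ t -
    simp at h1 h2 h3 ⊢
    exact ⟨h1, h2, h3⟩

lemma enorm_pd_le (i : Fin 3) (φ : E3 → ℝ) (x : E3) : ‖pd i φ x‖ₑ ≤ ‖cgrad φ x‖ₑ :=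
  enorm_le_iff_norm_le.2 (PiLp.norm_apply_le (cgrad φ x) i)

lemma pd_pow_four (i : Fin 3) {φ : E3 → ℝ} {x : E3} (h : DifferentiableAt ℝ φ x) :
    pd i (fun y => φ y ^ 4) x = 4 * φ x ^ 3 * pd i φ x := by
  have h2 : DifferentiableAt ℝ (fun y => φ y ^ 2) x := h.pow 2
  have : (fun y => φ y ^ 4) = fun y => (φ y ^ 2) ^ 2 := by ext; ring
  rw [this, pd_sq i h2, pd_sq i h]
  ring

lemma setLIntegral_toLp (s : Set E3) (g : E3 → ℝ≥0∞) :
    ∫⁻ x in WithLp.toLp 2 ⁻¹' s, g (WithLp.toLp 2 x) = ∫⁻ x in s, g x :=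
  (PiLp.volume_preserving_toLp (Fin 3)).setLIntegral_comp_preimage_emb
    (MeasurableEquiv.toLp 2 (Fin 3 → ℝ)).measurableEmbedding g s

/-- The ray inequality applied to `φ ^ 4`: the exponent `3/2` turns the left side into the sixth
power. -/
lemma lintegral_quadrant_le {s₀ s₁ : ℝ} (h₀ : s₀ = 1 ∨ s₀ = -1) (h₁ : s₁ = 1 ∨ s₁ = -1)
    {φ : E3 → ℝ} (hφ : ContDiff ℝ ∞ φ) (hs : HasCompactSupport φ) :
    ∫⁻ x in quadrant s₀ s₁, ‖φ x‖ₑ ^ 6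
      ≤ (∫⁻ x in quadrant s₀ s₁, 4 * ‖φ x‖ₑ ^ 3 * ‖cgrad φ x‖ₑ) ^ (3 / 2 : ℝ) := by
  set e : (Fin 3 → ℝ) → E3 := WithLp.toLp 2
  have hm := measurableSet_quadrant s₀ s₁
  have hφ4 : ContDiff ℝ ∞ fun y => φ y ^ 4 := hφ.pow 4
  have hec : ContDiff ℝ ∞ e := (PiLp.continuousLinearEquiv 2 ℝ fun _ : Fin 3 => ℝ).symm.contDiff
  have hN : Measurable fun x => 4 * ‖φ x‖ₑ ^ 3 * ‖cgrad φ x‖ₑ :=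
    ((hφ.continuous.measurable.enorm.pow_const 3).const_mul 4).mul
      (continuous_cgrad hφ).measurable.enorm
  have hse : HasCompactSupport ((fun y => φ y ^ 4) ∘ e) := by
    have h4 : HasCompactSupport fun y => φ y ^ 4 := hs.comp_left (g := fun t => t ^ 4) (by simp)
    exact h4.comp_homeomorph
      (PiLp.continuousLinearEquiv 2 ℝ fun _ : Fin 3 => ℝ).symm.toHomeomorph
  have key := lintegral_pow_le_of_rays (D := e ⁻¹' quadrant s₀ s₁)
    (hec.continuous.measurable hm) (quadrant_rays h₀ h₁)
    ((hφ4.comp hec).of_le (by simp)) hse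
    (N := fun x => 4 * ‖φ (e x)‖ₑ ^ 3 * ‖cgrad φ (e x)‖ₑ) (hN.comp hec.continuous.measurable)
    (fun x i => by
      have h1 : fderiv ℝ ((fun y => φ y ^ 4) ∘ e) x (Pi.single i 1)
          = pd i (fun y => φ y ^ 4) (e x) := by
        have h2 := ((hφ4.differentiable (by simp)) (e x)).hasFDerivAt.comp x
          (PiLp.continuousLinearEquiv 2 ℝ fun _ : Fin 3 => ℝ).symm.hasFDerivAt
        have h3 : fderiv ℝ ((fun y => φ y ^ 4) ∘ e) x = _ := h2.fderiv
        rw [h3]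
        rfl
      rw [h1, pd_pow_four i (hφ.differentiable (by simp) _), enorm_mul, enorm_mul, enorm_pow]
      gcongr
      · simp [Real.enorm_eq_ofReal]
      · exact enorm_pd_le i φ _)
  have e1 := setLIntegral_toLp (quadrant s₀ s₁) fun x => 4 * ‖φ x‖ₑ ^ 3 * ‖cgrad φ x‖ₑ
  have e2 := setLIntegral_toLp (quadrant s₀ s₁) fun x => ‖φ x‖ₑ ^ 6
  rw [← e1, ← e2]
  refine le_of_eq_of_le (lintegral_congr fun x => ?_) key
  simp only [Function.comp_apply, enorm_pow]
  rw [← ENNReal.rpow_natCast, ← ENNReal.rpow_natCast, ← ENNReal.rpow_mul]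
  norm_num
  rfl

/-- By Cauchy–Schwarz the previous bound reads `A ≤ 8 A^{3/4} B^{3/4}`. Compact support makes `A`
finite, so if `A ≠ 0` the factor `A^{3/4}` cancels, and the fourth power gives `8 ^ 4 = 4096`. -/
lemma lintegral_quadrant_pow_six_le {s₀ s₁ : ℝ} (h₀ : s₀ = 1 ∨ s₀ = -1) (h₁ : s₁ = 1 ∨ s₁ = -1)
    {φ : E3 → ℝ} (hφ : ContDiff ℝ ∞ φ) (hs : HasCompactSupport φ) :
    ∫⁻ x in quadrant s₀ s₁, ‖φ x‖ₑ ^ 6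
      ≤ 4096 * (∫⁻ x in quadrant s₀ s₁, ‖cgrad φ x‖ₑ ^ 2) ^ 3 := by
  set A := ∫⁻ x in quadrant s₀ s₁, ‖φ x‖ₑ ^ 6
  set B := ∫⁻ x in quadrant s₀ s₁, ‖cgrad φ x‖ₑ ^ 2
  have hmφ : Measurable fun x => ‖φ x‖ₑ ^ 3 := hφ.continuous.measurable.enorm.pow_const 3
  have hmg : Measurable fun x => ‖cgrad φ x‖ₑ := (continuous_cgrad hφ).measurable.enorm
  have hA : A ≠ ⊤ := by
    have h6 : MemLp φ 6 volume := hφ.continuous.memLp_of_hasCompactSupport hs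
    have := lintegral_rpow_enorm_lt_top_of_eLpNorm_lt_top (by simp) (by simp) h6.2
    simp only [ENNReal.toReal_ofNat] at this
    refine ne_top_of_le_ne_top this.ne ?_
    refine (setLIntegral_le_lintegral _ _).trans_eq (lintegral_congr fun x => ?_)
    rw [← ENNReal.rpow_natCast]; norm_num
  have h1 := ENNReal.lintegral_mul_le_Lp_mul_Lq (volume.restrict (quadrant s₀ s₁))
    Real.HolderConjugate.two_two hmφ.aemeasurable hmg.aemeasurable
  have hAB : ∫⁻ x in quadrant s₀ s₁, 4 * ‖φ x‖ₑ ^ 3 * ‖cgrad φ x‖ₑ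
      ≤ 4 * (A ^ (1 / 2 : ℝ) * B ^ (1 / 2 : ℝ)) := by
    simp_rw [mul_assoc]
    have h0 := lintegral_const_mul (μ := volume.restrict (quadrant s₀ s₁)) 4 (hmφ.mul hmg)
    simp only [Pi.mul_apply] at h0 h1
    rw [h0]
    gcongr
    refine h1.trans_eq ?_
    congr 3
    · ext x
      rw [← ENNReal.rpow_natCast, ← ENNReal.rpow_natCast, ← ENNReal.rpow_mul]
      norm_num
    · ext x
      rw [← ENNReal.rpow_natCast]
      norm_num
  have h2 : A ≤ 8 * (A ^ (3 / 4 : ℝ) * B ^ (3 / 4 : ℝ)) := by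
    refine ((lintegral_quadrant_le h₀ h₁ hφ hs).trans
      (ENNReal.rpow_le_rpow hAB (by norm_num))).trans_eq ?_
    rw [ENNReal.mul_rpow_of_nonneg _ _ (by norm_num), ENNReal.mul_rpow_of_nonneg _ _ (by norm_num),
      ← ENNReal.rpow_mul, ← ENNReal.rpow_mul]
    have : (4 : ℝ≥0∞) ^ (3 / 2 : ℝ) = 8 := by
      rw [show (4 : ℝ≥0∞) = 2 ^ (2 : ℝ) by norm_num, ← ENNReal.rpow_mul]
      norm_num
    rw [this]
    norm_num
  rcases eq_or_ne A 0 with h0 | h0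
  · rw [h0]; exact zero_le
  · have h3 : A ^ (1 / 4 : ℝ) ≤ 8 * B ^ (3 / 4 : ℝ) := by
      have h4 : A = A ^ (3 / 4 : ℝ) * A ^ (1 / 4 : ℝ) := by
        rw [← ENNReal.rpow_add _ _ h0 hA]; norm_num
      have h5 : A ^ (3 / 4 : ℝ) * A ^ (1 / 4 : ℝ) ≤ A ^ (3 / 4 : ℝ) * (8 * B ^ (3 / 4 : ℝ)) := by
        rw [← h4]
        refine h2.trans_eq ?_
        ring
      rwa [ENNReal.mul_le_mul_iff_right] at h5
      · exact (ENNReal.rpow_pos (pos_iff_ne_zero.2 h0) hA).ne'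
      · exact ENNReal.rpow_ne_top_of_nonneg (by norm_num) hA
    have h6 := ENNReal.pow_le_pow_left h3 (n := 4)
    rw [mul_pow, ← ENNReal.rpow_natCast, ← ENNReal.rpow_natCast (B ^ _), ← ENNReal.rpow_mul,
      ← ENNReal.rpow_mul] at h6
    norm_num at h6
    exact_mod_cast h6

/-- The four quadrants cover `Π`, and each gradient integral is bounded by the one over `Π`; hence
`4 * 4096`. -/
lemma lintegral_pow_six_le {φ : E3 → ℝ} (hφ : ContDiff ℝ ∞ φ) (hs : HasCompactSupport φ) :
    ∫⁻ x, ‖φ x‖ₑ ^ 6 ∂μC ≤ 16384 * (∫⁻ x, ‖cgrad φ x‖ₑ ^ 2 ∂μC) ^ 3 := by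
  have hq : ∀ s₀ s₁ : ℝ, (s₀ = 1 ∨ s₀ = -1) → (s₁ = 1 ∨ s₁ = -1) →
      ∫⁻ x in quadrant s₀ s₁, ‖φ x‖ₑ ^ 6 ≤ 4096 * (∫⁻ x, ‖cgrad φ x‖ₑ ^ 2 ∂μC) ^ 3 :=
    fun s₀ s₁ h₀ h₁ => (lintegral_quadrant_pow_six_le h₀ h₁ hφ hs).trans (by
      gcongr
      exact Measure.restrict_mono Set.inter_subset_left le_rfl)
  have hcov : Cyl ⊆ (quadrant 1 1 ∪ quadrant 1 (-1)) ∪ (quadrant (-1) 1 ∪ quadrant (-1) (-1)) := by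
    intro x hx
    simp only [quadrant, Set.mem_union, Set.mem_inter_iff, hx, true_and, Set.mem_ofPred_eq]
    rcases le_total 0 (x 0) with h | h <;> rcases le_total 0 (x 1) with h' | h' <;>
      simp [h, h']
  calc ∫⁻ x, ‖φ x‖ₑ ^ 6 ∂μC
      ≤ ∫⁻ x in (quadrant 1 1 ∪ quadrant 1 (-1)) ∪ (quadrant (-1) 1 ∪ quadrant (-1) (-1)),
          ‖φ x‖ₑ ^ 6 := lintegral_mono_set hcov
    _ ≤ ((∫⁻ x in quadrant 1 1, ‖φ x‖ₑ ^ 6) + ∫⁻ x in quadrant 1 (-1), ‖φ x‖ₑ ^ 6)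
        + ((∫⁻ x in quadrant (-1) 1, ‖φ x‖ₑ ^ 6) + ∫⁻ x in quadrant (-1) (-1), ‖φ x‖ₑ ^ 6) :=
        (lintegral_union_le _ _ _).trans
          (add_le_add (lintegral_union_le _ _ _) (lintegral_union_le _ _ _))
    _ ≤ _ := add_le_add (add_le_add (hq _ _ (by simp) (by simp)) (hq _ _ (by simp) (by simp)))
        (add_le_add (hq _ _ (by simp) (by simp)) (hq _ _ (by simp) (by simp)))
    _ = 16384 * (∫⁻ x, ‖cgrad φ x‖ₑ ^ 2 ∂μC) ^ 3 := by
        rw [← add_mul, ← add_mul]; norm_num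

/-- Interpolation between `L²` and `L⁶`: Cauchy–Schwarz on `|φ|⁴ = |φ| |φ|³`, followed by the
Sobolev bound. -/
lemma nrm_four_le_of_contDiff {φ : E3 → ℝ} (hφ : ContDiff ℝ ∞ φ) (hs : HasCompactSupport φ) :
    nrm 4 φ ≤ 4 * nrm 2 φ ^ (1 / 4 : ℝ) * nrm 2 (cgrad φ) ^ (3 / 4 : ℝ) := by
  have hm : Measurable fun x => ‖φ x‖ₑ := hφ.continuous.measurable.enorm
  have h1 := ENNReal.lintegral_mul_le_Lp_mul_Lq μC Real.HolderConjugate.two_two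
    hm.aemeasurable (hm.pow_const 3).aemeasurable
  have e1 : ∫⁻ x, ((fun x => ‖φ x‖ₑ) * fun x => ‖φ x‖ₑ ^ 3) x ∂μC = nrm 4 φ ^ 4 := by
    rw [nrm, eLpNorm_eq_lintegral_rpow_enorm_toReal (by simp) (by simp), ← ENNReal.rpow_natCast,
      ← ENNReal.rpow_mul]
    norm_num
    refine lintegral_congr fun x => ?_
    ring
  have e2 : (∫⁻ x, ‖φ x‖ₑ ^ (2 : ℝ) ∂μC) ^ (1 / 2 : ℝ) = nrm 2 φ := by
    rw [nrm, eLpNorm_eq_lintegral_rpow_enorm_toReal (by simp) (by simp)]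
    norm_num
  have e3 : (∫⁻ x, (‖φ x‖ₑ ^ 3) ^ (2 : ℝ) ∂μC) ≤ 16384 * nrm 2 (cgrad φ) ^ 6 := by
    refine le_of_eq_of_le (lintegral_congr fun x => ?_)
      ((lintegral_pow_six_le hφ hs).trans_eq ?_) (b := ∫⁻ x, ‖φ x‖ₑ ^ 6 ∂μC)
    · rw [← ENNReal.rpow_natCast, ← ENNReal.rpow_natCast, ← ENNReal.rpow_mul]; norm_num
    · rw [← eLpNorm_two_sq, ← pow_mul]; rfl
  rw [e1, e2] at h1
  have h2 : nrm 4 φ ^ 4 ≤ nrm 2 φ * (16384 * nrm 2 (cgrad φ) ^ 6) ^ (1 / 2 : ℝ) :=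
    h1.trans (by gcongr)
  have h3 := ENNReal.rpow_le_rpow h2 (z := 1 / 4) (by norm_num)
  rw [← ENNReal.rpow_natCast, ← ENNReal.rpow_mul] at h3
  norm_num at h3
  refine h3.trans ?_
  rw [ENNReal.mul_rpow_of_nonneg _ _ (by norm_num), ENNReal.mul_rpow_of_nonneg _ _ (by norm_num),
    ENNReal.mul_rpow_of_nonneg _ _ (by norm_num), ← ENNReal.rpow_natCast, ← ENNReal.rpow_mul,
    ← ENNReal.rpow_mul, ← ENNReal.rpow_mul]
  -- The constant is an eighth root, and `16384 = 2 ^ 14 ≤ 4 ^ 8`.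
  have h4 : (16384 : ℝ≥0∞) ^ (1 / 2 * (1 / 4) : ℝ) ≤ 4 := by
    have : (16384 : ℝ≥0∞) ≤ 4 ^ (8 : ℝ) := by
      rw [show (8 : ℝ) = ((8 : ℕ) : ℝ) by norm_num, ENNReal.rpow_natCast]; norm_num
    refine (ENNReal.rpow_le_rpow this (by norm_num)).trans_eq ?_
    rw [← ENNReal.rpow_mul]; norm_num
  have h5 : ((6 : ℕ) : ℝ) * (1 / 2 * (1 / 4)) = 3 / 4 := by norm_num
  rw [h5, mul_comm 4, mul_assoc]
  gcongr

lemma nrm_two_le_sum {w : E3 → E3} (hw : ∀ i, AEStronglyMeasurable (fun x => w x i) μC) :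
    nrm 2 w ≤ ∑ i, nrm 2 fun x => w x i := by
  calc nrm 2 w ≤ nrm 2 (∑ i, fun x => ‖w x i‖) := by
        refine eLpNorm_mono_real fun x => ?_
        rw [EuclideanSpace.norm_eq, Finset.sum_apply]
        refine Real.sqrt_le_iff.2 ⟨Finset.sum_nonneg fun i _ => norm_nonneg _, ?_⟩
        exact Finset.sum_sq_le_sq_sum_of_nonneg fun i _ => norm_nonneg _
    _ ≤ ∑ i, nrm 2 fun x => ‖w x i‖ := eLpNorm_sum_le (fun i _ => (hw i).norm) (by norm_num)
    _ = _ := Finset.sum_congr rfl fun i _ => eLpNorm_norm _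

lemma aestronglyMeasurable_of_coord {ι : Type*} [Fintype ι] {w : E3 → EuclideanSpace ℝ ι}
    (hw : ∀ i, AEStronglyMeasurable (fun x => w x i) μC) : AEStronglyMeasurable w μC :=
  ((PiLp.continuous_toLp 2 _).measurable.comp_aemeasurable
    (aemeasurable_pi_lambda _ fun i => (hw i).aemeasurable)).aestronglyMeasurable

/-- **Ladyzhenskaya's inequality** on the exterior of the cylinder. -/
theorem MemH1.nrm_four_le {f : E3 → ℝ} (h : MemH1 f) :
    nrm 4 f ≤ 4 * nrm 2 f ^ (1 / 4 : ℝ) * nrm 2 (grad f) ^ (3 / 4 : ℝ) := by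
  obtain ⟨φ, hφ, h0, h1⟩ := h.exists_contDiff_approx
  have hmφ := fun n => ((hφ n).1.continuous).aestronglyMeasurable (μ := μC)
  have hmg : AEStronglyMeasurable (grad f) μC :=
    aestronglyMeasurable_of_coord fun i => (h.memLp_wpd i).1
  have hmc := fun n => (continuous_cgrad (hφ n).1).aestronglyMeasurable (μ := μC)
  have hd1 : ∀ n, nrm 2 (φ n) ≤ nrm 2 f + nrm 2 (fun x => f x - φ n x) := fun n => by
    have e : φ n = f - fun x => f x - φ n x := by ext; simp
    calc nrm 2 (φ n) = nrm 2 (f - fun x => f x - φ n x) := by rw [← e]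
      _ ≤ _ := eLpNorm_sub_le h.1.1 (h.1.1.sub (hmφ n)) (by norm_num)
  have hd2 : ∀ n, nrm 2 (cgrad (φ n))
      ≤ nrm 2 (grad f) + ∑ i, nrm 2 (fun x => wpd i f x - pd i (φ n) x) := fun n => by
    have e : cgrad (φ n) = grad f - fun x => grad f x - cgrad (φ n) x := by ext; simp
    calc nrm 2 (cgrad (φ n)) = nrm 2 (grad f - fun x => grad f x - cgrad (φ n) x) := by rw [← e]
      _ ≤ nrm 2 (grad f) + nrm 2 (fun x => grad f x - cgrad (φ n) x) :=
        eLpNorm_sub_le hmg (hmg.sub (hmc n)) (by norm_num)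
      _ ≤ _ := by
        gcongr
        refine nrm_two_le_sum fun i => ?_
        exact (h.memLp_wpd i).1.sub
          (contDiff_pd i (hφ n).1).continuous.aestronglyMeasurable
  have hgt : nrm 2 (grad f) ≠ ⊤ := by
    refine ne_top_of_le_ne_top ?_ (nrm_two_le_sum fun i => (h.memLp_wpd i).1)
    exact ENNReal.sum_ne_top.2 fun i _ => (h.memLp_wpd i).2.ne
  have hft : nrm 2 f ≠ ⊤ := h.1.2.ne
  have l1 : Tendsto (fun n => nrm 2 f + nrm 2 (fun x => f x - φ n x)) atTop (𝓝 (nrm 2 f)) := by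
    simpa using h0.const_add (nrm 2 f)
  have l2 : Tendsto (fun n => nrm 2 (grad f) + ∑ i, nrm 2 (fun x => wpd i f x - pd i (φ n) x))
      atTop (𝓝 (nrm 2 (grad f))) := by
    simpa using (tendsto_finsetSum _ fun i _ => h1 i).const_add (nrm 2 (grad f))
  have l3 := ENNReal.Tendsto.mul
    (ENNReal.Tendsto.const_mul (a := 4) ((ENNReal.continuous_rpow_const (y := 1 / 4)).tendsto _
      |>.comp l1) (Or.inr (by simp)))
    (Or.inr (ENNReal.rpow_ne_top_of_nonneg (y := 3 / 4) (by norm_num) hgt))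
    ((ENNReal.continuous_rpow_const (y := 3 / 4)).tendsto _ |>.comp l2)
    (Or.inr (ENNReal.mul_ne_top (by simp)
      (ENNReal.rpow_ne_top_of_nonneg (y := 1 / 4) (by norm_num) hft)))
  -- The `L⁴` norm passes to the limit by Fatou along an almost everywhere convergent subsequence,
  -- so `f` need not be known to lie in `L⁴`.
  have hme : TendstoInMeasure μC φ atTop f := by
    refine tendstoInMeasure_of_tendsto_eLpNorm (p := 2) (by simp) hmφ h.1.1
      (h0.congr fun n => ?_)
    rw [nrm, ← eLpNorm_neg]
    congr 1
    ext x
    simp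
  obtain ⟨ns, hns, hae⟩ := hme.exists_seq_tendsto_ae
  refine (Lp.eLpNorm_lim_le_liminf_eLpNorm (fun n => hmφ (ns n)) f hae).trans ?_
  rw [← (l3.comp hns.tendsto_atTop).liminf_eq]
  refine liminf_le_liminf (.of_forall fun n => ?_)
  refine (nrm_four_le_of_contDiff (hφ (ns n)).1 (hφ (ns n)).2).trans ?_
  simp only [Function.comp_apply]
  gcongr
  · exact hd1 _
  · exact hd2 _

/-! ### Operations on `H¹₀` -/

lemma HasZeroExtPartial.add {i : Fin 3} {f g f' g' : E3 → ℝ} (hf : MemLp f 2 μC)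
    (hg : MemLp g 2 μC) (hf' : MemLp f' 2 μC) (hg' : MemLp g' 2 μC)
    (h : HasZeroExtPartial i f g) (h' : HasZeroExtPartial i f' g') :
    HasZeroExtPartial i (fun x => f x + f' x) (fun x => g x + g' x) := by
  intro φ hφ hs
  have m1 := memLp_of_contDiff hφ hs 2
  have m2 := memLp_of_contDiff (contDiff_pd i hφ) (hasCompactSupport_pd i hs) 2
  simp_rw [add_mul]
  rw [integral_add (integrable_mul_of_memLp hf m2) (integrable_mul_of_memLp hf' m2),
    integral_add (integrable_mul_of_memLp hg m1) (integrable_mul_of_memLp hg' m1),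
    h φ hφ hs, h' φ hφ hs]
  ring

lemma MemH10.add {f g : E3 → ℝ} (hf : MemH10 f) (hg : MemH10 g) :
    MemH10 fun x => f x + g x :=
  memH10_of_hasZeroExtPartial (hf.1.1.add hg.1.1)
    (fun i => (hf.1.memLp_wpd i).add (hg.1.memLp_wpd i)) fun i =>
    (hf.hasZeroExtPartial i).add hf.1.1 (hf.1.memLp_wpd i) hg.1.1 (hg.1.memLp_wpd i)
      (hg.hasZeroExtPartial i)

lemma MemH10.const_mul {f : E3 → ℝ} (c : ℝ) (hf : MemH10 f) : MemH10 fun x => c * f x :=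
  memH10_of_hasZeroExtPartial (hf.1.1.const_mul c) (fun i => (hf.1.memLp_wpd i).const_mul c)
    fun i φ hφ hs => by
      simp_rw [mul_assoc]
      rw [integral_const_mul, integral_const_mul, hf.hasZeroExtPartial i φ hφ hs, mul_neg]

lemma MemH10.congr {f g : E3 → ℝ} (hf : MemH10 f) (h : f =ᵐ[μC] g) : MemH10 g :=
  memH10_of_hasZeroExtPartial (hf.1.1.ae_eq h) (fun i => hf.1.memLp_wpd i) fun i φ hφ hs => by
    rw [← hf.hasZeroExtPartial i φ hφ hs]
    exact integral_congr_ae (by filter_upwards [h] with x hx; rw [hx])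

/-- Integration by parts in `Π` when one of the functions vanishes on the boundary. -/
lemma MemH10.integral_mul_wpd {f g : E3 → ℝ} (hg : MemH10 g) (hf : MemH1 f) (i : Fin 3) :
    ∫ x, wpd i g x * f x ∂μC = -∫ x, g x * wpd i f x ∂μC := by
  obtain ⟨φ, hφ, h0, h1⟩ := hg.2
  have l1 := tendsto_integral_mul (hg.1.memLp_wpd i) (fun n => ((hφ n).pd i).memLp 2) hf.1 (h1 i)
  have l2 := tendsto_integral_mul hg.1.1 (fun n => (hφ n).memLp 2) (hf.memLp_wpd i) h0
  refine tendsto_nhds_unique l1 (l2.neg.congr fun n => ?_)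
  have := (hf.hasWeakPartial i).2.2 (φ n) (hφ n)
  simp_rw [mul_comm (φ n _), mul_comm (pd i (φ n) _)]
  exact this.symm

lemma pd_comm (i j : Fin 3) {φ : E3 → ℝ} (hφ : ContDiff ℝ ∞ φ) (x : E3) :
    pd i (pd j φ) x = pd j (pd i φ) x := by
  have h2 : ∀ k l, pd k (pd l φ) x
      = fderiv ℝ (fderiv ℝ φ) x (EuclideanSpace.single k 1) (EuclideanSpace.single l 1) :=
    fun k l => by
      have hd : DifferentiableAt ℝ (fderiv ℝ φ) x :=
        (hφ.fderiv_right (m := ∞) (by simp)).differentiable (by simp) x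
      have h3 := (hd.hasFDerivAt.clm_apply
        (hasFDerivAt_const (EuclideanSpace.single l (1 : ℝ)) x)).fderiv
      have h4 : fderiv ℝ (pd l φ) x = _ := h3
      rw [pd, h4]
      simp
  rw [h2, h2]
  exact (hφ.contDiffAt.isSymmSndFDerivAt (by simpa using! WithTop.coe_le_coe.2 (le_top : (2 : ℕ∞) ≤ ⊤))).eq _ _

/-- Derivatives may be interchanged between a function in `H¹` and one in `H¹₀`. -/
lemma MemH10.integral_wpd_mul_wpd_comm {f g : E3 → ℝ} (hg : MemH10 g) (hf : MemH1 f)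
    (i j : Fin 3) :
    ∫ x, wpd i g x * wpd j f x ∂μC = ∫ x, wpd j g x * wpd i f x ∂μC := by
  obtain ⟨φ, hφ, -, h1⟩ := hg.2
  have l := fun i j => tendsto_integral_mul (hg.1.memLp_wpd i) (fun n => ((hφ n).pd i).memLp 2)
    (hf.memLp_wpd j) (h1 i)
  refine tendsto_nhds_unique (l i j) ((l j i).congr fun n => ?_)
  -- For a test function both sides are `-∫ f ∂_i ∂_j φ`, so no second derivative ever falls on `f`
  -- or `g`.
  have e : ∀ i j, ∫ x, pd i (φ n) x * wpd j f x ∂μC = -∫ x, f x * pd j (pd i (φ n)) x ∂μC :=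
    fun i j => by
      rw [(hf.hasWeakPartial j).2.2 _ ((hφ n).pd i), neg_neg]
      simp_rw [mul_comm]
  rw [e, e]
  simp_rw [pd_comm i j (hφ n).1]

lemma tendsto_nrm_bdd_mul {a : E3 → ℝ} (hb : ∃ C, ∀ x ∈ Cyl, |a x| ≤ C)
    {f : ℕ → E3 → ℝ} (h : Tendsto (fun n => nrm 2 (f n)) atTop (𝓝 0)) :
    Tendsto (fun n => nrm 2 fun x => a x * f n x) atTop (𝓝 0) := by
  obtain ⟨C, hC⟩ := hb
  have h1 : Tendsto (fun n => ENNReal.ofReal C * nrm 2 (f n)) atTop (𝓝 0) := by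
    simpa using ENNReal.Tendsto.const_mul h (Or.inr ENNReal.ofReal_ne_top) (a := ENNReal.ofReal C)
  refine tendsto_of_tendsto_of_tendsto_of_le_of_le tendsto_const_nhds h1 (fun _ => zero_le)
    fun n => ?_
  refine eLpNorm_le_mul_eLpNorm_of_ae_le_mul ?_ 2
  filter_upwards [ae_mem_Cyl] with x hx
  rw [norm_mul]
  gcongr
  exact hC x hx

/-- The coefficient is smooth only on `Π`, so it cannot be absorbed into a test function on the
whole space; the approximating sequence is multiplied instead. -/
lemma MemH10.coeff_mul {a f : E3 → ℝ} (ha : IsCoeff a) (hf : MemH10 f) :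
    MemH10 fun x => a x * f x := by
  refine ⟨hf.1.coeff_mul ha, ?_⟩
  obtain ⟨φ, hφ, h0, h1⟩ := hf.2
  refine ⟨fun n x => a x * φ n x, fun n => (hφ n).mul_left ha.smooth, ?_, fun i => ?_⟩
  · simpa [mul_sub] using tendsto_nrm_bdd_mul ha.bdd h0
  · have h2 := tendsto_nrm_add
      (fun n => (ha.memLp_mul ((hf.1.memLp_wpd i).sub (((hφ n).pd i).memLp 2))).1)
      (fun n => (ha.memLp_pd_mul i (hf.1.1.sub ((hφ n).memLp 2))).1)
      (tendsto_nrm_bdd_mul ha.bdd (h1 i)) (tendsto_nrm_bdd_mul (ha.bdd_pd i) h0)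
    refine h2.congr fun n => eLpNorm_congr_ae ?_
    filter_upwards [ae_mem_Cyl, hf.1.wpd_coeff_mul ha i] with x hx hw
    rw [hw, pd_mul i (differentiableAt_of_Cyl ha.smooth hx) ((hφ n).1.differentiable (by simp) x)]
    simp only [Pi.sub_apply]
    ring

/-! ### Derivatives in the direction of the axis -/

/-- A smooth function of `x_h` that vanishes near the boundary of `Π` and tends to `1` in `Π`. -/
noncomputable def radialCutoff (n : ℕ) (x : E3) : ℝ :=
  Real.smoothTransition (n * (x 0 ^ 2 + x 1 ^ 2 - 1) - 1)

lemma contDiff_radialCutoff (n : ℕ) : ContDiff ℝ ∞ (radialCutoff n) :=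
  Real.smoothTransition.contDiff.comp
    ((contDiff_const.mul ((((contDiff_coord 0).pow 2).add ((contDiff_coord 1).pow 2)).sub
      contDiff_const)).sub contDiff_const)

lemma pd_two_radialCutoff (n : ℕ) (x : E3) : pd 2 (radialCutoff n) x = 0 := by
  have hd := (contDiff_radialCutoff n).differentiable (by simp) x
  have h1 : HasDerivAt (fun t : ℝ => radialCutoff n (x + t • EuclideanSpace.single 2 1))
      (pd 2 (radialCutoff n) x) 0 := by
    have hl : HasDerivAt (fun t : ℝ => x + t • EuclideanSpace.single (2 : Fin 3) (1 : ℝ))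
        (EuclideanSpace.single 2 1) 0 := by
      simpa using ((hasDerivAt_id (0 : ℝ)).smul_const
        (EuclideanSpace.single (2 : Fin 3) (1 : ℝ))).const_add x
    have hx : HasFDerivAt (radialCutoff n) (fderiv ℝ (radialCutoff n) x)
        (x + (0 : ℝ) • EuclideanSpace.single (2 : Fin 3) (1 : ℝ)) := by
      simpa using hd.hasFDerivAt
    exact hx.comp_hasDerivAt (0 : ℝ) hl
  have h2 : (fun t : ℝ => radialCutoff n (x + t • EuclideanSpace.single 2 1))
      = fun _ => radialCutoff n x := by
    ext t
    simp [radialCutoff]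
  rw [h2] at h1
  exact h1.unique (hasDerivAt_const _ _)

lemma tsupport_radialCutoff_subset (n : ℕ) : tsupport (radialCutoff n) ⊆ Cyl := by
  have h := fun j => (contDiff_coord j).continuous
  have hcl : IsClosed {x : E3 | 1 ≤ n * (x 0 ^ 2 + x 1 ^ 2 - 1)} :=
    isClosed_le continuous_const
      (continuous_const.mul ((((h 0).pow 2).add ((h 1).pow 2)).sub continuous_const))
  refine (closure_minimal (fun x hx => ?_) hcl).trans fun x hx => ?_
  · by_contra hlt
    refine hx (Real.smoothTransition.zero_of_nonpos ?_)
    have : (n : ℝ) * (x 0 ^ 2 + x 1 ^ 2 - 1) < 1 := not_le.1 hlt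
    linarith
  · rw [mem_Cyl_iff]
    have h1 : 1 ≤ n * (x 0 ^ 2 + x 1 ^ 2 - 1) := hx
    by_contra hlt
    have h2 : n * (x 0 ^ 2 + x 1 ^ 2 - 1) ≤ 0 :=
      mul_nonpos_of_nonneg_of_nonpos n.cast_nonneg (by linarith)
    linarith

lemma abs_radialCutoff_le (n : ℕ) (x : E3) : |radialCutoff n x| ≤ 1 := by
  rw [radialCutoff, abs_of_nonneg (Real.smoothTransition.nonneg _)]
  exact Real.smoothTransition.le_one _

lemma tendsto_radialCutoff {x : E3} (hx : x ∈ Cyl) :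
    Tendsto (fun n => radialCutoff n x) atTop (𝓝 1) := by
  refine tendsto_const_nhds.congr' ?_
  have h0 : 0 < x 0 ^ 2 + x 1 ^ 2 - 1 := by linarith [(mem_Cyl_iff x).1 hx]
  filter_upwards [(tendsto_natCast_atTop_atTop.atTop_mul_const h0).eventually_ge_atTop 2] with n hn
  exact (Real.smoothTransition.one_of_one_le (by linarith)).symm

lemma tendsto_integral_radialCutoff_mul {f : E3 → ℝ} (hf : Integrable f μC) :
    Tendsto (fun n => ∫ x, radialCutoff n x * f x ∂μC) atTop (𝓝 (∫ x, f x ∂μC)) := by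
  refine tendsto_integral_of_dominated_convergence (fun x => |f x|)
    (fun n => (contDiff_radialCutoff n).continuous.aestronglyMeasurable.mul hf.1) hf.abs
    (fun n => .of_forall fun x => ?_) ?_
  · simpa using abs_mul_le_of_le (abs_radialCutoff_le n x) (le_refl |f x|)
  · filter_upwards [ae_mem_Cyl] with x hx
    simpa using (tendsto_radialCutoff hx).mul_const (f x)

/-- No boundary term arises when integrating by parts in the direction of the axis. -/
lemma MemH1.hasZeroExtPartial_two {h : E3 → ℝ} (hh : MemH1 h) :
    HasZeroExtPartial 2 h (wpd 2 h) := by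
  intro φ hφ hs
  have i1 := integrable_mul_of_memLp hh.1
    (memLp_of_contDiff (contDiff_pd 2 hφ) (hasCompactSupport_pd 2 hs) 2)
  have i2 := integrable_mul_of_memLp (hh.memLp_wpd 2) (memLp_of_contDiff hφ hs 2)
  refine tendsto_nhds_unique (tendsto_integral_radialCutoff_mul i1)
    ((tendsto_integral_radialCutoff_mul i2).neg.congr fun n => ?_)
  have ht : IsTest fun x => radialCutoff n x * φ x :=
    ⟨(contDiff_radialCutoff n).mul hφ, hs.mul_left,
      tsupport_mul_subset_left.trans (tsupport_radialCutoff_subset n)⟩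
  have key := (hh.hasWeakPartial 2).2.2 _ ht
  -- The cutoff depends on `x_h` alone, so `∂_z` does not see it. Its horizontal derivatives, which
  -- blow up at the boundary, never enter.
  have e : ∀ x, pd 2 (fun x => radialCutoff n x * φ x) x = radialCutoff n x * pd 2 φ x :=
    fun x => by
      rw [pd_mul 2 ((contDiff_radialCutoff n).differentiable (by simp) x)
        (hφ.differentiable (by simp) x), pd_two_radialCutoff]
      ring
  simp_rw [e] at key
  simp_rw [mul_left_comm (radialCutoff n _)]
  exact key.symm

/-- The tangential derivative `∂_z f` of a function in `H¹₀ ∩ H²` has vanishing trace. -/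
lemma MemH10.wpd_two {f : E3 → ℝ} (hf : MemH10 f) (hf2 : MemH2 f) : MemH10 (wpd 2 f) := by
  -- The candidate for `∂_i ∂_z f` is `∂_z ∂_i f`: the derivative `∂_i` is moved while `f` still has
  -- zero trace, and the remaining `∂_z` produces no boundary term.
  refine memH10_of_hasZeroExtPartial (hf.1.memLp_wpd 2)
    (fun i => (hf2.memH1_wpd i).memLp_wpd 2) fun i φ hφ hs => ?_
  have h1 := hf.hasZeroExtPartial 2 (pd i φ) (contDiff_pd i hφ) (hasCompactSupport_pd i hs)
  have h2 := hf.hasZeroExtPartial i (pd 2 φ) (contDiff_pd 2 hφ) (hasCompactSupport_pd 2 hs)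
  have h3 := (hf2.memH1_wpd i).hasZeroExtPartial_two φ hφ hs
  simp_rw [pd_comm 2 i hφ] at h1
  linarith

/-! ### Rotations about the axis -/

/-- The rotation by the angle `η` about the `z`-axis. -/
noncomputable def rotMap (η : ℝ) : E3 →ₗ[ℝ] E3 := Matrix.toEuclideanLin (rot η)

lemma rotMap_zero_apply (η : ℝ) (x : E3) :
    rotMap η x 0 = Real.cos η * x 0 - Real.sin η * x 1 := by
  simp [rotMap, rot, Matrix.toLpLin_apply, dotProduct, Fin.sum_univ_three]
  ring

lemma rotMap_one_apply (η : ℝ) (x : E3) :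
    rotMap η x 1 = Real.sin η * x 0 + Real.cos η * x 1 := by
  simp [rotMap, rot, Matrix.toLpLin_apply, dotProduct, Fin.sum_univ_three]

lemma rotMap_two_apply (η : ℝ) (x : E3) : rotMap η x 2 = x 2 := by
  simp [rotMap, rot, Matrix.toLpLin_apply, dotProduct, Fin.sum_univ_three]

lemma rotMap_sq_add_sq (η : ℝ) (x : E3) :
    rotMap η x 0 ^ 2 + rotMap η x 1 ^ 2 = x 0 ^ 2 + x 1 ^ 2 := by
  rw [rotMap_zero_apply, rotMap_one_apply]
  linear_combination (x 0 ^ 2 + x 1 ^ 2) * Real.sin_sq_add_cos_sq η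

lemma rad_rotMap (η : ℝ) (x : E3) : rad (rotMap η x) = rad x := by
  rw [rad, rad, rotMap_sq_add_sq]

lemma norm_rotMap (η : ℝ) (x : E3) : ‖rotMap η x‖ = ‖x‖ := by
  simp only [EuclideanSpace.norm_eq, Fin.sum_univ_three, Real.norm_eq_abs, sq_abs,
    rotMap_two_apply, rotMap_sq_add_sq]

/-- The rotation by the angle `η` about the `z`-axis as an isometry. -/
noncomputable def rotEquiv (η : ℝ) : E3 ≃ₗᵢ[ℝ] E3 :=
  LinearIsometry.toLinearIsometryEquiv ⟨rotMap η, norm_rotMap η⟩ rfl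

lemma measurePreserving_rotEquiv (η : ℝ) : MeasurePreserving (rotEquiv η) μC μC := by
  have h := (rotEquiv η).measurePreserving.restrict_preimage measurableSet_Cyl
  have e : rotEquiv η ⁻¹' Cyl = Cyl := by
    ext x
    show 1 < rad (rotMap η x) ↔ 1 < rad x
    rw [rad_rotMap]
  rwa [e] at h

lemma integral_rotEquiv (η : ℝ) (g : E3 → ℝ) :
    ∫ x, g (rotMap η x) ∂μC = ∫ x, g x ∂μC :=
  (measurePreserving_rotEquiv η).integral_comp
    (rotEquiv η).toHomeomorph.measurableEmbedding g

/-- The derivative of the rotation by the angle `η` with respect to `η`. -/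
noncomputable def rotDeriv (η : ℝ) (x : E3) : E3 :=
  !₂[-rotMap η x 1, rotMap η x 0, 0]

lemma hasDerivAt_rotMap (η : ℝ) (x : E3) :
    HasDerivAt (fun s => rotMap s x) (rotDeriv η x) η := by
  have hc := Real.hasDerivAt_cos η
  have hs := Real.hasDerivAt_sin η
  have h : HasDerivAt (fun s => (!₂[Real.cos s * x 0 - Real.sin s * x 1,
      Real.sin s * x 0 + Real.cos s * x 1, x 2] : E3)) (rotDeriv η x) η := by
    refine (PiLp.continuousLinearEquiv 2 ℝ fun _ : Fin 3 => ℝ).symm.hasFDerivAt.comp_hasDerivAt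
      (f := fun s => ![Real.cos s * x 0 - Real.sin s * x 1,
        Real.sin s * x 0 + Real.cos s * x 1, x 2])
      (f' := ![-rotMap η x 1, rotMap η x 0, 0]) η (hasDerivAt_pi.2 fun i => ?_)
    fin_cases i
    · refine ((hc.mul_const (x 0)).sub (hs.mul_const (x 1))).congr_deriv ?_
      show _ = -rotMap η x 1
      rw [rotMap_one_apply]
      ring
    · refine ((hs.mul_const (x 0)).add (hc.mul_const (x 1))).congr_deriv ?_
      show _ = rotMap η x 0
      rw [rotMap_zero_apply]
      ring
    · exact hasDerivAt_const η (x 2)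
  refine h.congr_of_eventuallyEq (.of_forall fun s => ?_)
  ext i
  fin_cases i
  · exact rotMap_zero_apply s x
  · exact rotMap_one_apply s x
  · exact rotMap_two_apply s x

lemma norm_rotDeriv_le (η : ℝ) (x : E3) : ‖rotDeriv η x‖ ≤ ‖x‖ := by
  rw [← norm_rotMap η x, EuclideanSpace.norm_eq, EuclideanSpace.norm_eq]
  refine Real.sqrt_le_sqrt ?_
  simp only [rotDeriv, Fin.sum_univ_three, Real.norm_eq_abs, sq_abs]
  simp
  nlinarith [sq_nonneg (rotMap η x 2)]

lemma fderiv_rotDeriv (φ : E3 → ℝ) (x : E3) :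
    fderiv ℝ φ x (rotDeriv 0 x) = x 0 * pd 1 φ x - x 1 * pd 0 φ x := by
  have h : rotDeriv 0 x = x 0 • EuclideanSpace.single (1 : Fin 3) (1 : ℝ)
      - x 1 • EuclideanSpace.single (0 : Fin 3) (1 : ℝ) := by
    ext i
    fin_cases i <;> simp [rotDeriv, rotMap_zero_apply, rotMap_one_apply]
  rw [h, map_sub, map_smul, map_smul]
  rfl

lemma rotMap_zero (x : E3) : rotMap 0 x = x := by
  ext i
  fin_cases i
  · simpa using rotMap_zero_apply 0 x
  · simpa using rotMap_one_apply 0 x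
  · exact rotMap_two_apply 0 x

lemma continuous_rotDeriv (η : ℝ) : Continuous (rotDeriv η) := by
  have h : Continuous (rotMap η) := (rotEquiv η).continuous
  have h' := fun j => (contDiff_coord j).continuous.comp h
  refine (PiLp.continuous_toLp 2 _).comp (continuous_pi fun i => ?_)
  fin_cases i
  · exact (h' 1).neg
  · exact h' 0
  · exact continuous_const

/-- A scalar function that is invariant under rotations about the axis. -/
def IsRotInvariant (f : E3 → ℝ) : Prop := ∀ η, ∀ᵐ x ∂μC, f x = f (rotMap η x)

/-- By invariance of `f` and of the measure, `∫ f(x) φ(R_η x)` is constant in `η`; its derivative at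
`η = 0` is the integral in question. Rotations preserve norms, so a single ball contains the
supports of all rotated `φ` and provides the dominating function. -/
lemma IsRotInvariant.integral_mul_eq_zero {f : E3 → ℝ} (hf : IsRotInvariant f)
    (hm : MemLp f 2 μC) {φ : E3 → ℝ} (hφ : IsTest φ) :
    ∫ x, f x * (x 0 * pd 1 φ x - x 1 * pd 0 φ x) ∂μC = 0 := by
  have hconst : ∀ η, ∫ x, f x * φ (rotMap η x) ∂μC = ∫ x, f x * φ x ∂μC := fun η => by
    rw [← integral_rotEquiv η fun x => f x * φ x]
    refine integral_congr_ae ?_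
    filter_upwards [hf η] with x hx
    rw [← hx]
  have hd := hφ.1.differentiable (by simp)
  obtain ⟨M, hM⟩ := (hφ.1.continuous_fderiv (by simp)).bounded_above_of_compact_support
    (hφ.2.1.fderiv ℝ)
  have hM0 : 0 ≤ M := (norm_nonneg _).trans (hM 0)
  obtain ⟨R, hR⟩ := hφ.2.1.isCompact.isBounded.subset_closedBall 0
  have hcr : ∀ η, Continuous (rotMap η) := fun η => (rotEquiv η).continuous
  have hball : MemLp ((Metric.closedBall (0 : E3) R).indicator fun _ => M * |R|) 2 μC :=
    (memLp_indicator_const 2 Metric.isClosed_closedBall.measurableSet _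
      (Or.inr measure_closedBall_lt_top.ne)).mono_measure Measure.restrict_le_self
  have key := hasDerivAt_integral_of_dominated_loc_of_deriv_le (μ := μC) (x₀ := (0 : ℝ))
    (F := fun η x => f x * φ (rotMap η x))
    (F' := fun η x => f x * fderiv ℝ φ (rotMap η x) (rotDeriv η x))
    (bound := fun x => |f x| * (Metric.closedBall (0 : E3) R).indicator (fun _ => M * |R|) x)
    (s := Set.univ) Filter.univ_mem
    (.of_forall fun η => hm.1.mul ((hφ.1.continuous.comp (hcr η)).aestronglyMeasurable))
    (integrable_mul_of_memLp hm (by simpa [rotMap_zero] using hφ.memLp 2)) ?_ ?_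
    (integrable_mul_of_memLp hm.abs hball) ?_
  · have h1 := key.2
    simp_rw [hconst] at h1
    have h2 := h1.unique (hasDerivAt_const _ _)
    rw [← h2]
    refine integral_congr_ae (.of_forall fun x => ?_)
    simp only
    rw [← fderiv_rotDeriv, rotMap_zero]
  · refine hm.1.mul (Continuous.aestronglyMeasurable ?_)
    exact ((hφ.1.continuous_fderiv (by simp)).comp (hcr 0)).clm_apply (continuous_rotDeriv 0)
  · refine .of_forall fun x η _ => ?_
    rw [norm_mul, Real.norm_eq_abs]
    gcongr
    by_cases hx : x ∈ Metric.closedBall (0 : E3) R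
    · rw [Set.indicator_of_mem hx]
      refine (ContinuousLinearMap.le_opNorm _ _).trans ?_
      gcongr
      · exact hM _
      · exact (norm_rotDeriv_le η x).trans ((mem_closedBall_zero_iff.1 hx).trans (le_abs_self R))
    · rw [Set.indicator_of_notMem hx]
      have h0 : fderiv ℝ φ (rotMap η x) = 0 := by
        by_contra hne
        have h1 := hR (support_fderiv_subset ℝ hne)
        rw [mem_closedBall_zero_iff, norm_rotMap] at h1
        exact hx (mem_closedBall_zero_iff.2 h1)
      simp [h0]
  · refine .of_forall fun x η _ => ?_
    exact ((hd _).hasFDerivAt.comp_hasDerivAt η (hasDerivAt_rotMap η x)).const_mul (f x)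

/-- The derivative of a rotationally invariant function in the direction `e_θ` vanishes. -/
lemma IsRotInvariant.er_mul_wpd {f : E3 → ℝ} (hf : IsRotInvariant f) (h : MemH1 f) :
    ∀ᵐ x ∂μC, er x 0 * wpd 1 f x = er x 1 * wpd 0 f x := by
  have hl := fun i => (h.hasWeakPartial i).2.1
  have hc := fun j => (contDiff_coord j).continuous.continuousOn (s := Cyl)
  have hlc := isOpen_Cyl.isLocallyClosed
  have l1 := (hl 1).continuousOn_mul (hc 0) hlc
  have l0 := (hl 0).continuousOn_mul (hc 1) hlc
  have key := ae_eq_of_integral_test l1 l0 fun φ hφ => by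
    have t0 := hφ.mul_contDiff (contDiff_coord 0)
    have t1 := hφ.mul_contDiff (contDiff_coord 1)
    have e1 := (h.hasWeakPartial 1).2.2 _ t0
    have e0 := (h.hasWeakPartial 0).2.2 _ t1
    have hd := hφ.1.differentiable (by simp)
    -- The coefficients of `x₀ ∂₁ - x₁ ∂₀` commute with the derivatives they multiply, so moving
    -- this field onto `f` creates no zeroth order term.
    have p1 : ∀ x, pd 1 (fun x => x 0 * φ x) x = x 0 * pd 1 φ x := fun x => by
      rw [pd_mul 1 (hasFDerivAt_coord 0 x).differentiableAt (hd x), pd_coord]; simp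
    have p0 : ∀ x, pd 0 (fun x => x 1 * φ x) x = x 1 * pd 0 φ x := fun x => by
      rw [pd_mul 0 (hasFDerivAt_coord 1 x).differentiableAt (hd x), pd_coord]; simp
    have h0 := hf.integral_mul_eq_zero h.1 hφ
    simp_rw [mul_sub] at h0
    rw [integral_sub (integrable_mul_test (h.hasWeakPartial 0).1
        ((hφ.pd 1).mul_contDiff (contDiff_coord 0)))
      (integrable_mul_test (h.hasWeakPartial 0).1
        ((hφ.pd 0).mul_contDiff (contDiff_coord 1)))] at h0
    simp_rw [p1] at e1
    simp_rw [p0] at e0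
    have s1 : ∫ x, x 0 * wpd 1 f x * φ x ∂μC = ∫ x, wpd 1 f x * (x 0 * φ x) ∂μC :=
      integral_congr_ae (.of_forall fun x => by simp only; ring)
    have s0 : ∫ x, x 1 * wpd 0 f x * φ x ∂μC = ∫ x, wpd 0 f x * (x 1 * φ x) ∂μC :=
      integral_congr_ae (.of_forall fun x => by simp only; ring)
    rw [s1, s0]
    linarith
  filter_upwards [key] with x hx
  rw [er_eq, er_eq]
  simp only [Fin.isValue, show ((0 : Fin 3) = 2) = False by simp,
    show ((1 : Fin 3) = 2) = False by simp, if_false]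
  rw [div_mul_eq_mul_div, div_mul_eq_mul_div, hx]

/-- The weak radial derivative. -/
noncomputable def radialDeriv (f : E3 → ℝ) (x : E3) : ℝ :=
  er x 0 * wpd 0 f x + er x 1 * wpd 1 f x

/-- With no derivative along `e_θ`, the horizontal gradient is its own radial part. -/
lemma IsRotInvariant.wpd_eq {f : E3 → ℝ} (hf : IsRotInvariant f) (h : MemH1 f) :
    ∀ᵐ x ∂μC, wpd 0 f x = er x 0 * radialDeriv f x ∧ wpd 1 f x = er x 1 * radialDeriv f x := by
  filter_upwards [hf.er_mul_wpd h, ae_mem_Cyl] with x hx hc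
  have h1 := er_sq hc
  simp only [radialDeriv]
  constructor
  · linear_combination (-wpd 0 f x) * h1 - er x 1 * hx
  · linear_combination (-wpd 1 f x) * h1 + er x 0 * hx

/-! ### Cylindrical components -/

lemma ur_eq (u : E3 → E3) (x : E3) : ur u x = er x 0 * u x 0 + er x 1 * u x 1 := by
  simp [ur, PiLp.inner_apply, Fin.sum_univ_three]

lemma uz_eq (u : E3 → E3) : uz u = fun x => u x 2 := by
  ext x
  simp [uz, ez, PiLp.inner_apply, Fin.sum_univ_three]

/-- The swirl `u^θ = u · e_θ`. -/
noncomputable def swirl (u : E3 → E3) (x : E3) : ℝ := er x 0 * u x 1 + -1 * (er x 1 * u x 0)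

lemma eθ_zero (x : E3) : eθ x 0 = -er x 1 := by simp [eθ, er, neg_div]

lemma eθ_one (x : E3) : eθ x 1 = er x 0 := by simp [eθ, er]

lemma eθ_two (x : E3) : eθ x 2 = 0 := by simp [eθ]

lemma ωθ_eq (u : E3 → E3) (x : E3) :
    ωθ u x = (er x 0 * wpd 2 (fun y => u y 0) x + er x 1 * wpd 2 (fun y => u y 1) x)
      - radialDeriv (fun y => u y 2) x := by
  simp only [ωθ, PiLp.inner_apply, Fin.sum_univ_three, eθ_zero, eθ_one, eθ_two, radialDeriv]
  simp [curl]
  ring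

lemma merid_apply (u : E3 → E3) (x : E3) (j : Fin 3) :
    merid u x j = er x j * ur u x + ez j * uz u x := by
  simp [merid, mul_comm]

section Axisymmetric

variable {u : E3 → E3}

lemma IsAxisymmetric.ae_eq (h : IsAxisymmetric u) (η : ℝ) : ∀ᵐ x ∂μC,
    u x 0 = Real.cos η * u (rotMap η x) 0 + Real.sin η * u (rotMap η x) 1 ∧
    u x 1 = -Real.sin η * u (rotMap η x) 0 + Real.cos η * u (rotMap η x) 1 ∧
    u x 2 = u (rotMap η x) 2 := by
  filter_upwards [h η] with x hx
  refine ⟨?_, ?_, ?_⟩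
  all_goals
    conv_lhs => rw [hx]
    simp [rotMap, rot, Matrix.toLpLin_apply, Matrix.mulVec, dotProduct, Fin.sum_univ_three]

lemma er_rotMap_zero (η : ℝ) (x : E3) :
    er (rotMap η x) 0 = Real.cos η * er x 0 - Real.sin η * er x 1 := by
  simp [er, rad_rotMap, rotMap_zero_apply]
  ring

lemma er_rotMap_one (η : ℝ) (x : E3) :
    er (rotMap η x) 1 = Real.sin η * er x 0 + Real.cos η * er x 1 := by
  simp [er, rad_rotMap, rotMap_one_apply]
  ring

lemma IsAxisymmetric.ur (h : IsAxisymmetric u) : IsRotInvariant (ur u) := fun η => by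
  filter_upwards [h.ae_eq η] with x ⟨h0, h1, _⟩
  rw [ur_eq, ur_eq, h0, h1, er_rotMap_zero, er_rotMap_one]
  ring

lemma IsAxisymmetric.swirl (h : IsAxisymmetric u) : IsRotInvariant (swirl u) := fun η => by
  filter_upwards [h.ae_eq η] with x ⟨h0, h1, _⟩
  rw [CylinderFlow.swirl, CylinderFlow.swirl, h0, h1, er_rotMap_zero, er_rotMap_one]
  ring

lemma IsAxisymmetric.uz (h : IsAxisymmetric u) : IsRotInvariant (uz u) := fun η => by
  filter_upwards [h.ae_eq η] with x ⟨_, _, h2⟩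
  rw [uz_eq]
  exact h2

lemma MemDA.memH2_ur (h : MemDA u) : MemH2 (ur u) := by
  have := ((h.memH2 0).coeff_mul (isCoeff_er 0) fun i => isCoeff_pd_er i 0).add
    ((h.memH2 1).coeff_mul (isCoeff_er 1) fun i => isCoeff_pd_er i 1)
  rwa [show ur u = _ from funext (ur_eq u)]

lemma MemDA.memH2_uz (h : MemDA u) : MemH2 (uz u) := by
  rw [uz_eq]; exact h.memH2 2

lemma MemDA.memH1_ur (h : MemDA u) : MemH1 (ur u) := h.memH2_ur.memH1

lemma MemDA.memH1_uz (h : MemDA u) : MemH1 (uz u) := h.memH2_uz.memH1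

lemma MemDA.memH1_swirl (h : MemDA u) : MemH1 (swirl u) :=
  ((h.memH2 1).memH1.coeff_mul (isCoeff_er 0)).add
    (((h.memH2 0).memH1.coeff_mul (isCoeff_er 1)).const_mul (-1))

lemma MemDA.memH10_ur (h : MemDA u) : MemH10 (ur u) := by
  have := h.impermeable.const_mul (-1)
  refine this.congr (.of_forall fun x => ?_)
  simp [normal, ur]

/-! ### The divergence -/

/-- Being divergence free in the weak sense survives `L²` limits. -/
lemma MemDA.ae_div_eq_zero (h : MemDA u) :
    ∀ᵐ x ∂μC, ∑ i, wpd i (fun y => u y i) x = 0 := by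
  obtain ⟨hu, w, hw, hlim⟩ := h.solenoidal
  have hH := fun i => (h.memH2 i).memH1
  have hl := fun i => ((hH i).hasWeakPartial i).2.1
  have hwc : ∀ n i, ContDiff ℝ ∞ fun y => w n y i := fun n i =>
    (EuclideanSpace.proj i : E3 →L[ℝ] ℝ).contDiff.comp (hw n).1.1
  have hws : ∀ n i, HasCompactSupport fun y => w n y i := fun n i =>
    (hw n).1.2.1.comp_left (g := fun v : E3 => v i) rfl
  have hli : ∀ i, Tendsto (fun n => nrm 2 fun x => u x i - w n x i) atTop (𝓝 0) := fun i =>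
    tendsto_of_tendsto_of_tendsto_of_le_of_le tendsto_const_nhds hlim (fun _ => zero_le) fun n =>
      eLpNorm_mono fun x => PiLp.norm_apply_le (u x - w n x) i
  have hsum : LocallyIntegrableOn (fun x => ∑ i, wpd i (fun y => u y i) x) Cyl := by
    simp_rw [Fin.sum_univ_three]
    exact ((hl 0).add (hl 1)).add (hl 2)
  refine ae_eq_of_integral_test (g := fun _ => 0) hsum locallyIntegrableOn_zero fun φ hφ => ?_
  simp_rw [Finset.sum_mul, zero_mul, integral_zero]
  rw [integral_finsetSum _ fun i _ => integrable_mul_test (hl i) hφ]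
  have e : ∀ i, ∫ x, wpd i (fun y => u y i) x * φ x ∂μC = -∫ x, u x i * pd i φ x ∂μC := fun i => by
    rw [((hH i).hasWeakPartial i).2.2 φ hφ, neg_neg]
  simp_rw [e]
  have l := fun i => tendsto_integral_mul (hH i).1
    (fun n => memLp_of_contDiff (hwc n i) (hws n i) 2) ((hφ.pd i).memLp 2) (hli i)
  have l2 := tendsto_finsetSum Finset.univ fun i _ => (l i).neg
  refine tendsto_nhds_unique l2 (tendsto_const_nhds.congr fun n => ?_)
  have e2 : ∀ i, -∫ x, w n x i * pd i φ x ∂μC = ∫ x, pd i (fun y => w n y i) x * φ x ∂μC :=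
    fun i => by
      rw [(hasWeakPartial_of_contDiff i (hwc n i)).2.2 φ hφ, neg_neg]
  simp_rw [e2]
  rw [← integral_finsetSum _ fun i _ => integrable_mul_test
    ((contDiff_pd i (hwc n i)).continuous.locallyIntegrable.locallyIntegrableOn _) hφ]
  simp_rw [← Finset.sum_mul, (hw n).2, zero_mul, integral_zero]

lemma horiz_zero_zero : horiz 0 0 = 1 := by simp [horiz]
lemma horiz_one_one : horiz 1 1 = 1 := by simp [horiz]
lemma horiz_zero_one : horiz 0 1 = 0 := by simp [horiz]
lemma horiz_one_zero : horiz 1 0 = 0 := by simp [horiz]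
lemma horiz_two (j : Fin 3) : horiz 2 j = 0 := by
  simp only [horiz, ite_eq_right_iff]
  rintro ⟨rfl, h⟩
  simp at h

/-- The divergence of `v = u^r e_r + u^z e_z` vanishes. -/
lemma MemDA.ae_div_merid (h : MemDA u) (ha : IsAxisymmetric u) :
    ∀ᵐ x ∂μC, radialDeriv (CylinderFlow.ur u) x + CylinderFlow.ur u x * (rad x)⁻¹
      + wpd 2 (CylinderFlow.uz u) x = 0 := by
  have hr := h.memH1_ur
  have hs := h.memH1_swirl
  -- The horizontal part of `u` is recomposed from `u^r e_r + u^θ e_θ`. The swirl contributes `e_θ ·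
  -- ∇u^θ` to the divergence, which is zero by rotational invariance, and `e_r` contributes `1/r`.
  have c0 : (fun x => er x 0 * CylinderFlow.ur u x + (-1 * (er x 1 * CylinderFlow.swirl u x)))
      =ᵐ[μC] fun x => u x 0 := by
    filter_upwards [ae_mem_Cyl] with x hx
    rw [ur_eq, CylinderFlow.swirl]
    linear_combination u x 0 * er_sq hx
  have c1 : (fun x => er x 1 * CylinderFlow.ur u x + er x 0 * CylinderFlow.swirl u x)
      =ᵐ[μC] fun x => u x 1 := by
    filter_upwards [ae_mem_Cyl] with x hx
    rw [ur_eq, CylinderFlow.swirl]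
    linear_combination u x 1 * er_sq hx
  have w := fun i j => (hr.hasWeakPartial i).smooth_mul (contDiffOn_er j)
  have w' := fun i j => (hs.hasWeakPartial i).smooth_mul (contDiffOn_er j)
  have d0 := (((w 0 0).add ((w' 0 1).const_mul (-1))).congr c0 ae_eq_rfl).wpd_ae
  have d1 := (((w 1 1).add (w' 1 0)).congr c1 ae_eq_rfl).wpd_ae
  filter_upwards [h.ae_div_eq_zero, d0, d1, ha.swirl.er_mul_wpd hs, ae_mem_Cyl]
    with x hx h0 h1 hsw hc
  rw [Fin.sum_univ_three, h0, h1, pd_er _ _ hc, pd_er _ _ hc, pd_er _ _ hc, pd_er _ _ hc,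
    horiz_zero_zero, horiz_one_one, horiz_zero_one, horiz_one_zero] at hx
  rw [uz_eq, radialDeriv]
  linear_combination hx - hsw + CylinderFlow.ur u x * (rad x)⁻¹ * er_sq hc

end Axisymmetric

/-! ### `L²` norms as real integrals, and the size of gradients. -/

lemma sq_nrm_two {F : Type*} [NormedAddCommGroup F] {f : E3 → F} (hf : MemLp f 2 μC) :
    nrm 2 f ^ 2 = ENNReal.ofReal (∫ x, ‖f x‖ ^ 2 ∂μC) := by
  rw [nrm, eLpNorm_two_sq, ofReal_integral_eq_lintegral_ofReal
    (by simpa using hf.integrable_norm_pow (p := 2) two_ne_zero)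
    (.of_forall fun x => by positivity)]
  simp_rw [ENNReal.ofReal_pow (norm_nonneg _), ofReal_norm]

/-- Reduces an equality of extended norms to one of real integrals, where signed terms can be
integrated by parts. -/
lemma nrm_two_eq_of_integral_sq_eq {F G : Type*} [NormedAddCommGroup F] [NormedAddCommGroup G]
    {f : E3 → F} {g : E3 → G} (hf : MemLp f 2 μC) (hg : MemLp g 2 μC)
    (h : ∫ x, ‖f x‖ ^ 2 ∂μC = ∫ x, ‖g x‖ ^ 2 ∂μC) : nrm 2 f = nrm 2 g :=
  (ENNReal.pow_right_strictMono two_ne_zero).injective (by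
    simp only [sq_nrm_two hf, sq_nrm_two hg, h])

lemma memLp_grad {f : E3 → ℝ} (hf : MemH1 f) : MemLp (grad f) 2 μC :=
  memLp_piLp_iff.2 fun i => hf.memLp_wpd i

lemma memLp_vgrad {w : E3 → E3} (hw : ∀ j, MemH1 fun x => w x j) : MemLp (vgrad w) 2 μC :=
  memLp_piLp_iff.2 fun q => (hw q.2).memLp_wpd q.1

lemma norm_grad_sq (f : E3 → ℝ) (x : E3) :
    ‖grad f x‖ ^ 2 = wpd 0 f x ^ 2 + wpd 1 f x ^ 2 + wpd 2 f x ^ 2 := by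
  simp [EuclideanSpace.norm_sq_eq, grad, Fin.sum_univ_three]

lemma norm_vgrad_sq (w : E3 → E3) (x : E3) :
    ‖vgrad w x‖ ^ 2 = ∑ i, ∑ j, wpd i (fun y => w y j) x ^ 2 := by
  simp [EuclideanSpace.norm_sq_eq, vgrad, Fintype.sum_prod_type]

lemma pd_neg (i : Fin 3) (a : E3 → ℝ) (x : E3) : pd i (fun y => -a y) x = -pd i a x := by
  simp [pd, fderiv_fun_neg]

lemma horiz_right_two (i : Fin 3) : horiz i 2 = 0 := by simp [horiz]

section Axisymmetric

variable {u : E3 → E3}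

/-! ### The azimuthal vorticity -/

lemma MemDA.wpd_two_ur (h : MemDA u) : ∀ᵐ x ∂μC, wpd 2 (ur u) x
    = er x 0 * wpd 2 (fun y => u y 0) x + er x 1 * wpd 2 (fun y => u y 1) x := by
  have hw := fun j => ((h.memH2 j).memH1.hasWeakPartial 2).smooth_mul (contDiffOn_er j)
  have h2 := ((hw 0).add (hw 1)).wpd_ae
  rw [← show ur u = _ from funext (ur_eq u)] at h2
  filter_upwards [h2, ae_mem_Cyl] with x hx hc
  rw [hx, pd_er _ _ hc, pd_er _ _ hc, horiz_two, horiz_two, er_two]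
  ring

/-- `ω^θ = ∂_z u^r - ∂_r u^z`. -/
lemma MemDA.ωθ_ae (h : MemDA u) :
    ∀ᵐ x ∂μC, ωθ u x = wpd 2 (ur u) x - radialDeriv (uz u) x := by
  filter_upwards [h.wpd_two_ur] with x hx
  rw [hx, ωθ_eq, uz_eq]

/-- The normal is horizontal, so taking the tangential part leaves the vertical component unchanged.
-/
lemma tanPart_deformNormal_two (u : E3 → E3) (x : E3) :
    tanPart (deformNormal u) x 2
      = -(er x 0 * wpd 2 (fun y => u y 0) x + er x 1 * wpd 2 (fun y => u y 1) x
        + radialDeriv (uz u) x) / 2 := by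
  simp [tanPart, deformNormal, normal, deform, radialDeriv, uz_eq, Matrix.toLpLin_apply,
    Matrix.mulVec, dotProduct, Fin.sum_univ_three]
  ring

/-- The slip condition says that `ω^θ` vanishes on the boundary. -/
lemma MemDA.memH10_ωθ (h : MemDA u) : MemH10 (ωθ u) := by
  -- With `t` the vertical slip component, `-(∂_z u^r + ∂_r u^z)/2`, one has `ω^θ = 2 ∂_z u^r + 2
  -- t`.
  have := ((h.memH10_ur.wpd_two h.memH2_ur).const_mul 2).add ((h.slip 2).const_mul 2)
  refine this.congr ?_
  filter_upwards [h.wpd_two_ur] with x hx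
  rw [tanPart_deformNormal_two, ωθ_eq, hx, uz_eq]
  ring

lemma MemDA.memH1_merid (h : MemDA u) (j : Fin 3) : MemH1 fun x => merid u x j := by
  simp_rw [merid_apply]
  exact (h.memH1_ur.coeff_mul (isCoeff_er j)).add (h.memH1_uz.const_mul _)

lemma ωθVec_apply (u : E3 → E3) (x : E3) (j : Fin 3) :
    ωθVec u x j = eθ x j * ωθ u x := by simp [ωθVec, mul_comm]

lemma isCoeff_eθ (j : Fin 3) : IsCoeff fun x => eθ x j := by
  fin_cases j
  · simpa [eθ_zero] using (isCoeff_const (-1)).mul (isCoeff_er 1)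
  · simpa [eθ_one] using isCoeff_er 0
  · simpa [eθ_two] using isCoeff_const 0

lemma MemDA.memH1_ωθVec (h : MemDA u) (j : Fin 3) : MemH1 fun x => ωθVec u x j := by
  simp_rw [ωθVec_apply]
  exact h.memH10_ωθ.1.coeff_mul (isCoeff_eθ j)

/-- In `∇(ω^θ e_θ)` the terms `∇ω^θ ⊗ e_θ` and `ω^θ ∇e_θ` are orthogonal, since `e_θ` has constant
length, and `|∇e_θ|² = 1/r²`. -/
lemma MemDA.norm_vgrad_ωθVec_sq (h : MemDA u) : ∀ᵐ x ∂μC,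
    ‖vgrad (ωθVec u) x‖ ^ 2 = ‖grad (ωθ u) x‖ ^ 2 + ‖ωθ u x / rad x‖ ^ 2 := by
  have hw : ∀ᵐ x ∂μC, ∀ i j, wpd i (fun y => ωθVec u y j) x
      = eθ x j * wpd i (ωθ u) x + pd i (fun y => eθ y j) x * ωθ u x := by
    simp_rw [ωθVec_apply]
    exact ae_all_iff.2 fun i => ae_all_iff.2 fun j => h.memH10_ωθ.1.wpd_coeff_mul (isCoeff_eθ j) i
  filter_upwards [hw, ae_mem_Cyl] with x hx hc
  rw [norm_vgrad_sq, norm_grad_sq, Real.norm_eq_abs, sq_abs]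
  simp only [hx, Fin.sum_univ_three, pd_neg, pd_const, eθ_zero, eθ_one, eθ_two,
    pd_er _ _ hc, horiz_two, horiz_zero_zero, horiz_zero_one, horiz_one_zero, horiz_one_one,
    er_two, div_eq_mul_inv]
  linear_combination (wpd 0 (ωθ u) x ^ 2 + wpd 1 (ωθ u) x ^ 2 + wpd 2 (ωθ u) x ^ 2
    - 2 * ωθ u x * (rad x)⁻¹ * (wpd 0 (ωθ u) x * er x 0 + wpd 1 (ωθ u) x * er x 1)
    + (er x 0 ^ 2 + er x 1 ^ 2 - 1) * (ωθ u x * (rad x)⁻¹) ^ 2) * er_sq hc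

lemma MemDA.nrm_vgrad_ωθVec (h : MemDA u) : nrm 2 (vgrad (ωθVec u))
    = (nrm 2 (grad (ωθ u)) ^ 2 + nrm 2 (fun x => ωθ u x / rad x) ^ 2) ^ (1 / 2 : ℝ) := by
  have hω := h.memH10_ωθ.1
  have hr : MemLp (fun x => ωθ u x / rad x) 2 μC := by
    simpa [div_eq_inv_mul] using isCoeff_inv_rad.memLp_mul hω.1
  have hi : ∀ {F : Type} [NormedAddCommGroup F] {f : E3 → F}, MemLp f 2 μC →
      Integrable (fun x => ‖f x‖ ^ 2) μC := fun hf => by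
    simpa using hf.integrable_norm_pow (p := 2) two_ne_zero
  rw [sq_nrm_two (memLp_grad hω), sq_nrm_two hr,
    ← ENNReal.ofReal_add (integral_nonneg fun _ => by positivity)
      (integral_nonneg fun _ => by positivity),
    ← integral_add (hi (memLp_grad hω)) (hi hr), ← integral_congr_ae h.norm_vgrad_ωθVec_sq,
    ← sq_nrm_two (memLp_vgrad h.memH1_ωθVec), ← ENNReal.rpow_natCast, ← ENNReal.rpow_mul]
  norm_num

/-! ### The gradient of the meridional velocity -/

/-- The Cartesian square norm in cylindrical form. The term `u^r/r` comes from `∇e_r`, which acts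
only in the direction `e_θ` and is therefore orthogonal to the radial derivatives. -/
lemma MemDA.norm_vgrad_merid_sq (h : MemDA u) (ha : IsAxisymmetric u) :
    ∀ᵐ x ∂μC, ‖vgrad (merid u) x‖ ^ 2
    = radialDeriv (ur u) x ^ 2 + (ur u x * (rad x)⁻¹) ^ 2 + wpd 2 (ur u) x ^ 2
      + radialDeriv (uz u) x ^ 2 + wpd 2 (uz u) x ^ 2 := by
  have hw : ∀ᵐ x ∂μC, ∀ i j, wpd i (fun y => merid u y j) x
      = (er x j * wpd i (ur u) x + pd i (fun y => er y j) x * ur u x)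
        + ez j * wpd i (uz u) x := by
    simp_rw [merid_apply]
    exact ae_all_iff.2 fun i => ae_all_iff.2 fun j =>
      (((h.memH1_ur.hasWeakPartial i).smooth_mul (contDiffOn_er j)).add
        ((h.memH1_uz.hasWeakPartial i).const_mul _)).wpd_ae
  filter_upwards [hw, ha.ur.wpd_eq h.memH1_ur, ha.uz.wpd_eq h.memH1_uz, ae_mem_Cyl]
    with x hx hr hz hc
  rw [norm_vgrad_sq]
  simp only [hx, Fin.sum_univ_three, hr.1, hr.2, hz.1, hz.2, pd_er _ _ hc, horiz_two,
    horiz_right_two, horiz_zero_zero, horiz_zero_one, horiz_one_zero, horiz_one_one, er_two,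
    show ez 0 = 0 by simp [ez], show ez 1 = 0 by simp [ez], show ez 2 = 1 by simp [ez]]
  linear_combination ((er x 0 ^ 2 + er x 1 ^ 2 + 1) * radialDeriv (ur u) x ^ 2
    - 2 * (er x 0 ^ 2 + er x 1 ^ 2) * radialDeriv (ur u) x * (ur u x * (rad x)⁻¹)
    + (er x 0 ^ 2 + er x 1 ^ 2 - 1) * (ur u x * (rad x)⁻¹) ^ 2
    + wpd 2 (ur u) x ^ 2 + radialDeriv (uz u) x ^ 2) * er_sq hc

/-- With `a = ∂_r u^r` and `b = u^r/r`, so that `∂_z u^z = -(a + b)`, one finds `|∇v|² - ω² = a² +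
b² + (a + b)² + 2 ∂_z u^r ∂_r u^z`. This equals `2 (∂_z u^r ∂_r u^z + (a + b)²) - 2ab`, and the two
parts integrate to zero separately. -/
lemma MemDA.nrm_vgrad_merid (h : MemDA u) (ha : IsAxisymmetric u) :
    nrm 2 (vgrad (merid u)) = nrm 2 (ωθ u) := by
  have hr := h.memH1_ur
  have hz := h.memH1_uz
  have hω := h.memH10_ωθ.1.1
  have hc : ∀ j, IsCoeff fun x => er x j * (rad x)⁻¹ := fun j =>
    (isCoeff_er j).mul isCoeff_inv_rad
  -- The Cartesian components of `u^r e_r` and of `(u^r/r) e_r`. They vanish on the boundary with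
  -- `u^r`, so neither kind of integration by parts below leaves a boundary term.
  have hg := fun j => h.memH10_ur.coeff_mul (isCoeff_er j)
  have hk := fun j => h.memH10_ur.coeff_mul (hc j)
  have iA := fun j => integrable_mul_of_memLp ((hg j).1.memLp_wpd 2) (hz.memLp_wpd j)
  have iB := fun j => integrable_mul_of_memLp ((hg j).1.memLp_wpd j) (hz.memLp_wpd 2)
  have iE := fun j => integrable_mul_of_memLp ((hk j).1.memLp_wpd j) hr.1
  have iF := fun j => integrable_mul_of_memLp (hk j).1.1 (hr.memLp_wpd j)
  have eAB := fun j => (hg j).integral_wpd_mul_wpd_comm hz 2 j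
  have eEF := fun j => (hk j).integral_mul_wpd hr j
  refine nrm_two_eq_of_integral_sq_eq (memLp_vgrad h.memH1_merid) hω ?_
  have iω : Integrable (fun x => ‖ωθ u x‖ ^ 2) μC := by
    simpa using hω.integrable_norm_pow (p := 2) two_ne_zero
  have wg : ∀ᵐ x ∂μC, ∀ i j, wpd i (fun y => er y j * ur u y) x
      = er x j * wpd i (ur u) x + pd i (fun y => er y j) x * ur u x :=
    ae_all_iff.2 fun i => ae_all_iff.2 fun j => hr.wpd_coeff_mul (isCoeff_er j) i
  have wk : ∀ᵐ x ∂μC, ∀ i j, wpd i (fun y => er y j * (rad y)⁻¹ * ur u y) x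
      = er x j * (rad x)⁻¹ * wpd i (ur u) x + pd i (fun y => er y j * (rad y)⁻¹) x * ur u x :=
    ae_all_iff.2 fun i => ae_all_iff.2 fun j => hr.wpd_coeff_mul (hc j) i
  -- The first bracket is `∂_z g_j ∂_j u^z - ∂_j g_j ∂_z u^z` summed over `j = 0, 1`, for `g = u^r
  -- e_r`; it integrates to zero by interchanging derivatives. The second is the divergence of
  -- `(u^r)² e_r / r`, that is `2ab`.
  have key : ∀ᵐ x ∂μC, ‖vgrad (merid u) x‖ ^ 2 = ‖ωθ u x‖ ^ 2
      + 2 * ((wpd 2 (fun y => er y 0 * ur u y) x * wpd 0 (uz u) x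
          - wpd 0 (fun y => er y 0 * ur u y) x * wpd 2 (uz u) x)
        + (wpd 2 (fun y => er y 1 * ur u y) x * wpd 1 (uz u) x
          - wpd 1 (fun y => er y 1 * ur u y) x * wpd 2 (uz u) x))
      - ((wpd 0 (fun y => er y 0 * (rad y)⁻¹ * ur u y) x * ur u x
          + er x 0 * (rad x)⁻¹ * ur u x * wpd 0 (ur u) x)
        + (wpd 1 (fun y => er y 1 * (rad y)⁻¹ * ur u y) x * ur u x
          + er x 1 * (rad x)⁻¹ * ur u x * wpd 1 (ur u) x)) := by
    filter_upwards [wg, wk, h.norm_vgrad_merid_sq ha, h.ωθ_ae, ha.ur.wpd_eq hr, ha.uz.wpd_eq hz,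
      h.ae_div_merid ha, ae_mem_Cyl] with x hg hk hn hω hr hz hd hx
    have dr := fun j => differentiableAt_of_Cyl (contDiffOn_er j) hx
    have di := differentiableAt_of_Cyl contDiffOn_inv_rad hx
    rw [hn, Real.norm_eq_abs, sq_abs, hω]
    simp only [hg, hk, pd_mul _ (dr _) di, pd_inv_rad _ hx, pd_er _ _ hx, horiz_two,
      horiz_zero_zero, horiz_one_one, hr.1, hr.2, hz.1, hz.2, er_two]
    have h1 := er_sq hx
    -- After eliminating `∂_z u^z` by incompressibility, a polynomial identity modulo `|e_r| = 1`
    -- remains.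
    rw [show wpd 2 (uz u) x = -(radialDeriv (ur u) x + ur u x * (rad x)⁻¹) by linarith]
    generalize er x 0 = a at *
    generalize er x 1 = b at *
    have h2 : a ^ 2 = 1 - b ^ 2 := by linarith
    ring_nf
    simp only [h2]
    ring
  rw [integral_congr_ae key]
  have iAB : ∀ j, Integrable (fun x => wpd 2 (fun y => er y j * ur u y) x * wpd j (uz u) x
      - wpd j (fun y => er y j * ur u y) x * wpd 2 (uz u) x) μC := fun j => (iA j).sub (iB j)
  have iEF : ∀ j, Integrable (fun x => wpd j (fun y => er y j * (rad y)⁻¹ * ur u y) x * ur u x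
      + er x j * (rad x)⁻¹ * ur u x * wpd j (ur u) x) μC := fun j => (iE j).add (iF j)
  have zAB : ∀ j, ∫ x, (wpd 2 (fun y => er y j * ur u y) x * wpd j (uz u) x
      - wpd j (fun y => er y j * ur u y) x * wpd 2 (uz u) x) ∂μC = 0 := fun j => by
    rw [integral_sub (iA j) (iB j), eAB, sub_self]
  have zEF : ∀ j, ∫ x, (wpd j (fun y => er y j * (rad y)⁻¹ * ur u y) x * ur u x
      + er x j * (rad x)⁻¹ * ur u x * wpd j (ur u) x) ∂μC = 0 := fun j => by
    rw [integral_add (iE j) (iF j), eEF, neg_add_cancel]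
  have iD := ((iAB 0).fun_add (iAB 1)).const_mul 2
  rw [integral_sub (iω.fun_add iD) ((iEF 0).fun_add (iEF 1)), integral_add iω iD,
    integral_const_mul, integral_add (iAB 0) (iAB 1), integral_add (iEF 0) (iEF 1),
    zAB, zAB, zEF, zEF]
  simp

/-! ### Interpolation estimates for the components, and comparison with `v`. -/

lemma MemDA.nrm_grad_ur_le (h : MemDA u) (ha : IsAxisymmetric u) :
    nrm 2 (grad (ur u)) ≤ nrm 2 (ωθ u) := by
  rw [← h.nrm_vgrad_merid ha]
  refine eLpNorm_mono_ae ?_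
  filter_upwards [h.norm_vgrad_merid_sq ha, ha.ur.wpd_eq h.memH1_ur, ae_mem_Cyl] with x hx hr hc
  have h1 : ‖grad (ur u) x‖ ^ 2 = radialDeriv (ur u) x ^ 2 + wpd 2 (ur u) x ^ 2 := by
    rw [norm_grad_sq, hr.1, hr.2]
    linear_combination radialDeriv (ur u) x ^ 2 * er_sq hc
  rw [← abs_norm, ← abs_norm (vgrad _ _)]
  refine sq_le_sq.1 ?_
  rw [hx, h1]
  nlinarith [sq_nonneg (ur u x * (rad x)⁻¹), sq_nonneg (radialDeriv (uz u) x),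
    sq_nonneg (wpd 2 (uz u) x)]

lemma MemDA.nrm_grad_uz_le (h : MemDA u) (ha : IsAxisymmetric u) :
    nrm 2 (grad (uz u)) ≤ nrm 2 (ωθ u) := by
  rw [← h.nrm_vgrad_merid ha]
  refine eLpNorm_mono_ae ?_
  filter_upwards [h.norm_vgrad_merid_sq ha, ha.uz.wpd_eq h.memH1_uz, ae_mem_Cyl] with x hx hr hc
  have h1 : ‖grad (uz u) x‖ ^ 2 = radialDeriv (uz u) x ^ 2 + wpd 2 (uz u) x ^ 2 := by
    rw [norm_grad_sq, hr.1, hr.2]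
    linear_combination radialDeriv (uz u) x ^ 2 * er_sq hc
  rw [← abs_norm, ← abs_norm (vgrad _ _)]
  refine sq_le_sq.1 ?_
  rw [hx, h1]
  nlinarith [sq_nonneg (ur u x * (rad x)⁻¹), sq_nonneg (radialDeriv (ur u) x),
    sq_nonneg (wpd 2 (ur u) x)]

lemma MemDA.nrm_four_ur_le (h : MemDA u) (ha : IsAxisymmetric u) :
    nrm 4 (ur u) ≤ 4 * nrm 2 (ur u) ^ (1 / 4 : ℝ) * nrm 2 (ωθ u) ^ (3 / 4 : ℝ) :=
  h.memH1_ur.nrm_four_le.trans (by gcongr; exact h.nrm_grad_ur_le ha)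

lemma MemDA.nrm_four_uz_le (h : MemDA u) (ha : IsAxisymmetric u) :
    nrm 4 (uz u) ≤ 4 * nrm 2 (uz u) ^ (1 / 4 : ℝ) * nrm 2 (ωθ u) ^ (3 / 4 : ℝ) :=
  h.memH1_uz.nrm_four_le.trans (by gcongr; exact h.nrm_grad_uz_le ha)

lemma norm_merid_sq (u : E3 → E3) {x : E3} (hx : x ∈ Cyl) :
    ‖merid u x‖ ^ 2 = ur u x ^ 2 + uz u x ^ 2 := by
  simp only [EuclideanSpace.norm_sq_eq, Fin.sum_univ_three, merid_apply, er_two, Real.norm_eq_abs,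
    sq_abs, show ez 0 = 0 by simp [ez], show ez 1 = 0 by simp [ez], show ez 2 = 1 by simp [ez]]
  linear_combination ur u x ^ 2 * er_sq hx

lemma nrm_ur_le_nrm_merid (u : E3 → E3) (p : ℝ≥0∞) : nrm p (ur u) ≤ nrm p (merid u) := by
  refine eLpNorm_mono_ae ?_
  filter_upwards [ae_mem_Cyl] with x hx
  rw [← abs_norm (merid _ _), Real.norm_eq_abs]
  exact sq_le_sq.1 (by rw [norm_merid_sq u hx]; nlinarith [sq_nonneg (uz u x)])

lemma nrm_uz_le_nrm_merid (u : E3 → E3) (p : ℝ≥0∞) : nrm p (uz u) ≤ nrm p (merid u) := by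
  refine eLpNorm_mono_ae ?_
  filter_upwards [ae_mem_Cyl] with x hx
  rw [← abs_norm (merid _ _), Real.norm_eq_abs]
  exact sq_le_sq.1 (by rw [norm_merid_sq u hx]; nlinarith [sq_nonneg (ur u x)])

lemma MemDA.nrm_merid_le (h : MemDA u) {p : ℝ≥0∞} (hp : 1 ≤ p) :
    nrm p (merid u) ≤ nrm p (ur u) + nrm p (uz u) := by
  have e1 : eLpNorm (fun x => ‖ur u x‖) p μC = eLpNorm (ur u) p μC := eLpNorm_norm _
  have e2 : eLpNorm (fun x => ‖uz u x‖) p μC = eLpNorm (uz u) p μC := eLpNorm_norm _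
  calc eLpNorm (merid u) p μC
      ≤ eLpNorm ((fun x => ‖ur u x‖) + fun x => ‖uz u x‖) p μC := by
        refine eLpNorm_mono_ae_real ?_
        filter_upwards [ae_mem_Cyl] with x hx
        refine abs_le_of_sq_le_sq' ?_ (by simp only [Pi.add_apply]; positivity) |>.2
        rw [norm_merid_sq u hx]
        simp only [Pi.add_apply, Real.norm_eq_abs]
        nlinarith [sq_abs (ur u x), sq_abs (uz u x),
          mul_nonneg (abs_nonneg (ur u x)) (abs_nonneg (uz u x))]
    _ ≤ eLpNorm (fun x => ‖ur u x‖) p μC + eLpNorm (fun x => ‖uz u x‖) p μC :=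
        eLpNorm_add_le h.memH1_ur.1.1.norm h.memH1_uz.1.1.norm hp
    _ = eLpNorm (ur u) p μC + eLpNorm (uz u) p μC := by rw [e1, e2]

end Axisymmetric

end CylinderFlow

theorem proposition5p2 :
    ∃ C : ℝ≥0, ∀ u : CylinderFlow.E3 → CylinderFlow.E3,
      CylinderFlow.MemDA u → CylinderFlow.IsAxisymmetric u →
      -- all the derivatives below exist in the weak sense and are square integrable
      (∀ j, CylinderFlow.MemH1 (fun x => CylinderFlow.merid u x j)) ∧
      CylinderFlow.MemH10 (CylinderFlow.ωθ u) ∧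
      (∀ j, CylinderFlow.MemH1 (fun x => CylinderFlow.ωθVec u x j)) ∧
      -- the identity for the gradient of `v`
      CylinderFlow.nrm 2 (CylinderFlow.vgrad (CylinderFlow.merid u))
        = CylinderFlow.nrm 2 (CylinderFlow.ωθ u) ∧
      -- the interpolation inequalities for `u^r`, `u^z` and `ω^θ`
      CylinderFlow.nrm 4 (CylinderFlow.ur u)
        ≤ C * CylinderFlow.nrm 2 (CylinderFlow.ur u) ^ (1 / 4 : ℝ)
          * CylinderFlow.nrm 2 (CylinderFlow.ωθ u) ^ (3 / 4 : ℝ) ∧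
      CylinderFlow.nrm 4 (CylinderFlow.uz u)
        ≤ C * CylinderFlow.nrm 2 (CylinderFlow.uz u) ^ (1 / 4 : ℝ)
          * (CylinderFlow.nrm 2 (CylinderFlow.uz u)
              + CylinderFlow.nrm 2 (CylinderFlow.ωθ u)) ^ (3 / 4 : ℝ) ∧
      CylinderFlow.nrm 4 (CylinderFlow.ωθ u)
        ≤ C * CylinderFlow.nrm 2 (CylinderFlow.ωθ u) ^ (1 / 4 : ℝ)
          * CylinderFlow.nrm 2 (CylinderFlow.grad (CylinderFlow.ωθ u)) ^ (3 / 4 : ℝ) ∧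
      -- the identity for the gradient of `ω^θ e_θ`
      CylinderFlow.nrm 2 (CylinderFlow.vgrad (CylinderFlow.ωθVec u))
        = (CylinderFlow.nrm 2 (CylinderFlow.grad (CylinderFlow.ωθ u)) ^ 2
            + CylinderFlow.nrm 2 (fun x => CylinderFlow.ωθ u x / CylinderFlow.rad x) ^ 2)
              ^ (1 / 2 : ℝ) ∧
      -- the interpolation inequality for `v`
      CylinderFlow.nrm 4 (CylinderFlow.merid u)
        ≤ C * CylinderFlow.nrm 2 (CylinderFlow.merid u) ^ (1 / 4 : ℝ)
          * (CylinderFlow.nrm 2 (CylinderFlow.merid u)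
              + CylinderFlow.nrm 2 (CylinderFlow.ωθ u)) ^ (3 / 4 : ℝ) := by
  -- Each scalar inequality holds with constant `4`; the one for `v` adds those for `u^r` and `u^z`,
  -- whence `8`.
  refine ⟨8, fun u h ha => ⟨h.memH1_merid, h.memH10_ωθ, h.memH1_ωθVec, h.nrm_vgrad_merid ha,
    (h.nrm_four_ur_le ha).trans ?_, (h.nrm_four_uz_le ha).trans ?_,
    h.memH10_ωθ.1.nrm_four_le.trans ?_, h.nrm_vgrad_ωθVec, ?_⟩⟩
  · gcongr
    norm_num
  · gcongr
    · norm_num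
    · exact le_add_self
  · gcongr
    norm_num
  · calc CylinderFlow.nrm 4 (CylinderFlow.merid u)
        ≤ CylinderFlow.nrm 4 (CylinderFlow.ur u) + CylinderFlow.nrm 4 (CylinderFlow.uz u) :=
          h.nrm_merid_le (by norm_num)
      _ ≤ 4 * CylinderFlow.nrm 2 (CylinderFlow.merid u) ^ (1 / 4 : ℝ)
            * (CylinderFlow.nrm 2 (CylinderFlow.merid u)
              + CylinderFlow.nrm 2 (CylinderFlow.ωθ u)) ^ (3 / 4 : ℝ)
          + 4 * CylinderFlow.nrm 2 (CylinderFlow.merid u) ^ (1 / 4 : ℝ)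
            * (CylinderFlow.nrm 2 (CylinderFlow.merid u)
              + CylinderFlow.nrm 2 (CylinderFlow.ωθ u)) ^ (3 / 4 : ℝ) := by
          refine add_le_add ((h.nrm_four_ur_le ha).trans ?_) ((h.nrm_four_uz_le ha).trans ?_)
          · gcongr
            · exact CylinderFlow.nrm_ur_le_nrm_merid u 2
            · exact le_add_self
          · gcongr
            · exact CylinderFlow.nrm_uz_le_nrm_merid u 2
            · exact le_add_self
      _ = _ := by
          rw [← add_mul, ← add_mul]
          norm_num
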